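/- Let $k$ be a field of characteristic zero, let $X$ be a smooth projective variety (integral scheme) over $k$, let $A$ be a local artinian $k$-algebra with residue field $k$, and put $X_A = X\times_{\mathrm{Spec}\,k}\mathrm{Spec}\,A$, which has the same underlying space as $X$. For a commutative $\mathbb{Q}$-algebra $R$ and $p\ge 0$, let $HH_p(R)$ be the $p$-th Hochschild homology group of $R$ over $\mathbb{Q}$, and let $HH^{(p)}_p(R)\subset HH_p(R)$ be the subspace on which the Adams operation $\psi^m$ acts as multiplication by $m^p$ for every $m$. Let $HH^{(p)}_p(O_{X_A})$ and $HH^{(p)}_p(O_X)$ be the Zariski sheaves on $X$ associated with the presheaves obtained by applying $HH^{(p)}_p$ to the sections of $O_{X_A}$ and $O_X$, and let $$\overline{HH}^{(p)}_p(O_{X_A})=\ker\bigl(HH^{(p)}_p(O_{X_A})\to HH^{(p)}_p(O_X)\bigr)$$ be the kernel of the map induced by the augmentation $A\to k$. Call an abelian sheaf $F$ on $X$ Cohen–Macaulay if $H^i_y(X,F)=0$ for every scheme point $y\in X$ and every $i\neq\mathrm{codim}\,\overline{\{y\}}$, where $H^i_y(X,-)$ is the $i$-th right derived functor of the functor that sends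 $F$ to the group of germs in $F_y$ having a representative, on some open neighbourhood $U$ of $y$, with support in $\overline{\{y\}}\cap U$. Then, for every integer $p\ge 0$, the sheaf $\overline{HH}^{(p)}_p(O_{X_A})$ is Cohen–Macaulay. Moreover there are isomorphisms of abelian sheaves $HH^{(p)}_p(O_{X_A})\cong\Omega^p_{X_A/\mathbb{Q}}$ and $HH^{(p)}_p(O_X)\cong\Omega^p_{X/\mathbb{Q}}$ (absolute Kähler differentials) compatible with the maps induced by the augmentation, and the first of them restricts to an isomorphism of $\overline{HH}^{(p)}_p(O_{X_A})$ with $\ker(\Omega^p_{X_A/\mathbb{Q}}\to\Omega^p_{X/\mathbb{Q}})$. -/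

import Mathlib

open CategoryTheory CategoryTheory.Limits TopologicalSpace Opposite AlgebraicGeometry TensorProduct

universe u v

noncomputable section

namespace HochschildCM

/-! ### Hochschild homology of a commutative algebra and its Adams eigenspaces -/

section Hochschild

variable (K : Type v) [CommRing K] (R : Type u) [CommRing R] [Algebra K R]

/-- The `K`-linear map `⨂_ι R → ⨂_κ R` induced by a map of finite sets `f : ι → κ`: the factors
with the same image under `f` are multiplied together, and empty fibres contribute `1`. -/
def tensorMap {ι κ : Type} [Fintype ι] [DecidableEq κ] (f : ι → κ) :
    (⨂[K] _ : ι, R) →ₗ[K] (⨂[K] _ : κ, R) :=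
  PiTensorProduct.lift
    ((MultilinearMap.mkPiAlgebra K ι (⨂[K] _ : κ, R)).compLinearMap
      fun i => (PiTensorProduct.singleAlgHom (R := K) (A := fun _ : κ => R) (f i)).toLinearMap)

theorem tensorMap_tprod {ι κ : Type} [Fintype ι] [DecidableEq κ] (f : ι → κ) (a : ι → R) :
    tensorMap K R f (PiTensorProduct.tprod K a) =
      PiTensorProduct.tprod K fun j => ∏ i with f i = j, a i := by
  simp only [tensorMap, PiTensorProduct.lift.tprod, MultilinearMap.compLinearMap_apply,
    MultilinearMap.mkPiAlgebra_apply, AlgHom.toLinearMap_apply, PiTensorProduct.singleAlgHom_apply]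
  rw [← PiTensorProduct.tprod_prod]
  congr 1
  funext j
  simp only [Finset.prod_apply, MonoidHom.mulSingle_apply, Finset.prod_filter]
  refine Finset.prod_congr rfl fun i _ => ?_
  by_cases h : f i = j
  · subst h; simp
  · simp [h]

/-- The degree `n` term `R ⊗ R^{⊗ n}` of the Hochschild complex of `R` over `K`. -/
abbrev HochschildChain (n : ℕ) : Type (max u v) := ⨂[K] _ : Fin (n + 1), R

/-- The `i`-th face of the simplicial circle. On Hochschild chains it multiplies the neighbouring
factors `i` and `i + 1` if `i ≤ n`, and multiplies the last factor into the zeroth one if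
`i = n + 1`. -/
def circleFace (n : ℕ) (i j : Fin (n + 2)) : Fin (n + 1) :=
  Fin.ofNat (n + 1) (if j ≤ i then (j : ℕ) else (j : ℕ) - 1)

/-- The Hochschild differential
`b (a₀ ⊗ ⋯ ⊗ aₙ₊₁) = ∑_{i ≤ n} (-1)^i a₀ ⊗ ⋯ ⊗ aᵢ aᵢ₊₁ ⊗ ⋯ ⊗ aₙ₊₁
+ (-1)^(n+1) aₙ₊₁ a₀ ⊗ a₁ ⊗ ⋯ ⊗ aₙ`. -/
def hochschildB (n : ℕ) : HochschildChain K R (n + 1) →ₗ[K] HochschildChain K R n :=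
  ∑ i : Fin (n + 2), (-1 : K) ^ (i : ℕ) • tensorMap K R (circleFace n i)

/-- Hochschild cycles of degree `n`. -/
def hochschildCycles : (n : ℕ) → Submodule K (HochschildChain K R n)
  | 0 => ⊤
  | n + 1 => LinearMap.ker (hochschildB K R n)

/-- Hochschild boundaries of degree `n`. -/
def hochschildBoundaries (n : ℕ) : Submodule K (HochschildChain K R n) :=
  LinearMap.range (hochschildB K R n)

/-- The Adams operation `ψ^m` on Hochschild chains of degree `n`:
`ψ^m (a₀ ⊗ a₁ ⊗ ⋯ ⊗ aₙ)` is the sum, over all ways of cutting the word `a₁ ⋯ aₙ` into `m`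
consecutive (possibly empty) subwords, of the signed shuffles of these subwords, with `a₀` left in
place. Such a shuffle is the same as a map `f : {1, …, n} → {1, …, m}` telling which subword the
letter at each place comes from, and the corresponding permutation is the one that sorts `f`
stably: it moves the `i`-th letter to the place `Tuple.sort f i`. These operations commute with `b`, so they
act on Hochschild homology. -/
def adamsPsi (n m : ℕ) : HochschildChain K R n →ₗ[K] HochschildChain K R n :=
  ∑ f : Fin n → Fin m, (((Equiv.Perm.sign (Tuple.sort f) : ℤˣ) : ℤ) : K) •
    tensorMap K R (Fin.cases 0 fun i => (Tuple.sort f i).succ)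

/-- The Hochschild cycles of degree `n` whose homology class lies in the weight `l` eigenspace,
that is, on whose class `ψ^m` acts as `m ^ l` for every `m`. -/
def weightCycles (l n : ℕ) : Submodule K (HochschildChain K R n) :=
  hochschildCycles K R n ⊓
    ⨅ m : ℕ, (hochschildBoundaries K R n).comap
      (adamsPsi K R n m - ((m : K) ^ l) • LinearMap.id)

/-- `HH_n^{(l)}(R)`: the part of the Hochschild homology `HH_n(R)` over `K` on which every Adams
operation `ψ^m` acts as multiplication by `m ^ l`. -/
abbrev HodgeHH (l n : ℕ) : Type (max u v) :=
  weightCycles K R l n ⧸ (hochschildBoundaries K R n).submoduleOf (weightCycles K R l n)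

variable {R} {S : Type u} [CommRing S] [Algebra K S]

/-- The map on Hochschild chains induced by an algebra homomorphism. -/
def chainMap (φ : R →ₐ[K] S) (n : ℕ) : HochschildChain K R n →ₗ[K] HochschildChain K S n :=
  PiTensorProduct.map fun _ => φ.toLinearMap

theorem chainMap_tensorMap (φ : R →ₐ[K] S) {n m : ℕ} (f : Fin (n + 1) → Fin (m + 1))
    (x : HochschildChain K R n) :
    chainMap K φ m (tensorMap K R f x) = tensorMap K S f (chainMap K φ n x) := by
  induction x using PiTensorProduct.induction_on with
  | smul_tprod r a =>
    simp [chainMap, tensorMap_tprod, PiTensorProduct.map_tprod, map_prod]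
  | add x y hx hy => simp [hx, hy]

theorem chainMap_hochschildB (φ : R →ₐ[K] S) (n : ℕ) (x : HochschildChain K R (n + 1)) :
    chainMap K φ n (hochschildB K R n x) = hochschildB K S n (chainMap K φ (n + 1) x) := by
  rw [hochschildB, hochschildB, LinearMap.sum_apply, LinearMap.sum_apply, map_sum]
  refine Finset.sum_congr rfl fun i _ => ?_
  rw [LinearMap.smul_apply, LinearMap.smul_apply, map_smul, chainMap_tensorMap]

theorem chainMap_adamsPsi (φ : R →ₐ[K] S) (n m : ℕ) (x : HochschildChain K R n) :
    chainMap K φ n (adamsPsi K R n m x) = adamsPsi K S n m (chainMap K φ n x) := by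
  rw [adamsPsi, adamsPsi, LinearMap.sum_apply, LinearMap.sum_apply, map_sum]
  refine Finset.sum_congr rfl fun i _ => ?_
  rw [LinearMap.smul_apply, LinearMap.smul_apply, map_smul, chainMap_tensorMap]

theorem chainMap_mem_boundaries (φ : R →ₐ[K] S) (n : ℕ) {x : HochschildChain K R n}
    (hx : x ∈ hochschildBoundaries K R n) : chainMap K φ n x ∈ hochschildBoundaries K S n := by
  obtain ⟨y, rfl⟩ := hx
  exact ⟨chainMap K φ (n + 1) y, (chainMap_hochschildB K φ n y).symm⟩

theorem chainMap_mem_weightCycles (φ : R →ₐ[K] S) (l n : ℕ) {x : HochschildChain K R n}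
    (hx : x ∈ weightCycles K R l n) : chainMap K φ n x ∈ weightCycles K S l n := by
  rw [weightCycles, Submodule.mem_inf, Submodule.mem_iInf] at hx ⊢
  refine ⟨?_, fun m => ?_⟩
  · cases n with
    | zero => exact Submodule.mem_top
    | succ n =>
      have h := hx.1
      simp only [hochschildCycles, LinearMap.mem_ker] at h ⊢
      rw [← chainMap_hochschildB, h, map_zero]
  · have h := chainMap_mem_boundaries K φ n (Submodule.mem_comap.mp (hx.2 m))
    rw [LinearMap.sub_apply, LinearMap.smul_apply, map_sub, map_smul, chainMap_adamsPsi] at h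
    exact h

/-- The map on `HH_n^{(l)}` induced by an algebra homomorphism. -/
def hodgeHHMap (φ : R →ₐ[K] S) (l n : ℕ) : HodgeHH K R l n →ₗ[K] HodgeHH K S l n :=
  Submodule.mapQ _ _
    ((chainMap K φ n).restrict fun _ hx => chainMap_mem_weightCycles K φ l n hx)
    fun _ hx => chainMap_mem_boundaries K φ n hx

theorem hodgeHHMap_mk (φ : R →ₐ[K] S) (l n : ℕ) (x : weightCycles K R l n) :
    hodgeHHMap K φ l n (Submodule.Quotient.mk x) =
      Submodule.Quotient.mk ⟨chainMap K φ n x, chainMap_mem_weightCycles K φ l n x.2⟩ :=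
  rfl

theorem hodgeHHMap_id (l n : ℕ) (x : HodgeHH K R l n) :
    hodgeHHMap K (AlgHom.id K R) l n x = x := by
  obtain ⟨x, rfl⟩ := Submodule.Quotient.mk_surjective _ x
  rw [hodgeHHMap_mk]
  congr 1
  ext1
  exact LinearMap.congr_fun (PiTensorProduct.map_id (R := K) (s := fun _ : Fin (n + 1) => R)) _

theorem hodgeHHMap_comp {T : Type u} [CommRing T] [Algebra K T] (φ : R →ₐ[K] S) (ψ : S →ₐ[K] T)
    (l n : ℕ) (x : HodgeHH K R l n) :
    hodgeHHMap K (ψ.comp φ) l n x = hodgeHHMap K ψ l n (hodgeHHMap K φ l n x) := by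
  obtain ⟨x, rfl⟩ := Submodule.Quotient.mk_surjective _ x
  rw [hodgeHHMap_mk, hodgeHHMap_mk, hodgeHHMap_mk]
  congr 1
  ext1
  exact LinearMap.congr_fun (PiTensorProduct.map_comp (fun _ : Fin (n + 1) => ψ.toLinearMap)
    (fun _ => φ.toLinearMap)) _

end Hochschild

/-- `R ↦ HH_n^{(l)}(R)` as a functor from commutative `K`-algebras to abelian groups. -/
def hodgeHHFunctor (K : Type) [CommRing K] (l n : ℕ) : CommAlgCat.{u} K ⥤ AddCommGrpCat.{u} where
  obj R := AddCommGrpCat.of (HodgeHH K R l n)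
  map φ := AddCommGrpCat.ofHom (hodgeHHMap K φ.hom l n).toAddMonoidHom
  map_id _ := AddCommGrpCat.hom_ext (AddMonoidHom.ext fun x => hodgeHHMap_id K l n x)
  map_comp φ ψ := AddCommGrpCat.hom_ext
    (AddMonoidHom.ext fun x => hodgeHHMap_comp K φ.hom ψ.hom l n x)

/-! ### Kähler differential forms -/

section Forms

variable (K : Type v) [CommRing K] (R : Type u) [CommRing R] [Algebra K R]

/-- The module `Ω^p_{R/K}` of Kähler differential forms of degree `p`. -/
abbrev DiffForms (p : ℕ) : Type u := ⋀[R]^p (Ω[R⁄K])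

variable {R} in
/-- The form `da₁ ∧ ⋯ ∧ daₚ`. -/
def dForm {p : ℕ} (a : Fin p → R) : DiffForms K R p :=
  exteriorPower.ιMulti R p fun i => KaehlerDifferential.D K R (a i)

theorem diffForms_ext {p : ℕ} {G : Type*} [AddCommGroup G] {f g : DiffForms K R p →+ G}
    (h : ∀ (r : R) (a : Fin p → R), f (r • dForm K a) = g (r • dForm K a)) : f = g := by
  have key : Submodule.span R (Set.range (dForm K : (Fin p → R) → DiffForms K R p)) = ⊤ := by
    rw [← exteriorPower.ιMulti_span_of_span R p (Ω[R⁄K])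
      (KaehlerDifferential.span_range_derivation K R)]
    congr 1
    ext x
    constructor
    · rintro ⟨a, rfl⟩
      exact ⟨_, Set.range_subset_iff.mpr fun i => ⟨a i, rfl⟩, rfl⟩
    · rintro ⟨v, hv, rfl⟩
      choose a ha using fun i => hv ⟨i, rfl⟩
      exact ⟨a, congrArg (exteriorPower.ιMulti R p) (funext ha)⟩
  ext x
  have hx : x ∈ Submodule.span R (Set.range (dForm K : (Fin p → R) → DiffForms K R p)) :=
    key ▸ Submodule.mem_top
  induction hx using Submodule.closure_induction with
  | zero => simp
  | add x y _ _ hx hy => simp [hx, hy]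
  | smul_mem r x hx =>
    obtain ⟨a, rfl⟩ := hx
    exact h r a

variable {R} {S : Type u} [CommRing S] [Algebra K S]

/-- The additive map `Ω^p_{R/K} → Ω^p_{S/K}`, `r da₁ ∧ ⋯ ∧ daₚ ↦ φ(r) dφ(a₁) ∧ ⋯ ∧ dφ(aₚ)`,
induced by an algebra homomorphism `φ : R → S`. -/
def diffFormsMap (φ : R →ₐ[K] S) (p : ℕ) : DiffForms K R p →+ DiffForms K S p :=
  letI : Algebra R S := φ.toRingHom.toAlgebra
  haveI : IsScalarTower K R S := IsScalarTower.of_algebraMap_eq fun r => (φ.commutes r).symm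
  let ω : Ω[R⁄K] [⋀^Fin p]→ₗ[R] DiffForms K S p :=
    { toMultilinearMap :=
        ((exteriorPower.ιMulti S p (M := Ω[S⁄K])).toMultilinearMap.restrictScalars R).compLinearMap
          fun _ => KaehlerDifferential.map K K R S
      map_eq_zero_of_eq' := fun v i j hv hij =>
        (exteriorPower.ιMulti S p (M := Ω[S⁄K])).map_eq_zero_of_eq _ (by rw [hv]) hij }
  (exteriorPower.alternatingMapLinearEquiv ω).toAddMonoidHom

theorem diffFormsMap_smul_dForm (φ : R →ₐ[K] S) {p : ℕ} (r : R) (a : Fin p → R) :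
    diffFormsMap K φ p (r • dForm K a) = φ r • dForm K (φ ∘ a) := by
  let _ : Algebra R S := φ.toRingHom.toAlgebra
  have : IsScalarTower K R S := IsScalarTower.of_algebraMap_eq fun r => (φ.commutes r).symm
  change exteriorPower.alternatingMapLinearEquiv _ (r • dForm K a) = _
  rw [map_smul, dForm, exteriorPower.alternatingMapLinearEquiv_apply_ιMulti]
  change algebraMap R S r • exteriorPower.ιMulti S p (fun i =>
    KaehlerDifferential.map K K R S (KaehlerDifferential.D K R (a i))) = _
  simp only [KaehlerDifferential.map_D]
  rfl

end Forms

/-- `R ↦ Ω^p_{R/K}` as a functor from commutative `K`-algebras to abelian groups. -/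
def diffFormsFunctor (K : Type) [CommRing K] (p : ℕ) :
    CommAlgCat.{u} K ⥤ AddCommGrpCat.{u} where
  obj R := AddCommGrpCat.of (DiffForms K R p)
  map φ := AddCommGrpCat.ofHom (diffFormsMap K φ.hom p)
  map_id R := AddCommGrpCat.hom_ext <| diffForms_ext K R fun r a =>
    diffFormsMap_smul_dForm K (AlgHom.id K R) r a
  map_comp {R S T} φ ψ := AddCommGrpCat.hom_ext <| diffForms_ext K R fun r a => by
    change diffFormsMap K (ψ.hom.comp φ.hom) p (r • dForm K a) =
      diffFormsMap K ψ.hom p (diffFormsMap K φ.hom p (r • dForm K a))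
    rw [diffFormsMap_smul_dForm, diffFormsMap_smul_dForm, diffFormsMap_smul_dForm]
    rfl

/-! ### Local cohomology at a point and Cohen–Macaulay abelian sheaves -/

section LocalCohomology

variable {X : TopCat.{u}} (x : X)

/-- `Γ_x(F)`: the subgroup of the stalk `F_x` of those germs that have a representative, on some
open neighbourhood `U` of `x`, whose support is contained in `closure {x}`. -/
def germsWithSupport (F : TopCat.Presheaf AddCommGrpCat.{u} X) : AddSubgroup (F.stalk x) where
  carrier := {t | ∃ (U : Opens X) (hx : x ∈ U) (s : F.obj (op U)), F.germ U x hx s = t ∧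
    ∀ (y : X) (hy : y ∈ U), y ∉ closure {x} → F.germ U y hy s = 0}
  zero_mem' := ⟨⊤, trivial, 0, map_zero _, fun _ _ _ => map_zero _⟩
  add_mem' := by
    rintro _ _ ⟨U, hU, s, rfl, hs⟩ ⟨V, hV, t, rfl, ht⟩
    refine ⟨U ⊓ V, ⟨hU, hV⟩, F.map (homOfLE inf_le_left).op s + F.map (homOfLE inf_le_right).op t,
      ?_, fun y hy h => ?_⟩
    · rw [map_add]
      exact congrArg₂ (· + ·) (F.germ_res_apply (homOfLE inf_le_left) x _ s)
        (F.germ_res_apply (homOfLE inf_le_right) x _ t)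
    · rw [map_add, ← add_zero (0 : F.stalk y)]
      exact congrArg₂ (· + ·)
        ((F.germ_res_apply (homOfLE inf_le_left) y hy s).trans (hs y hy.1 h))
        ((F.germ_res_apply (homOfLE inf_le_right) y hy t).trans (ht y hy.2 h))
  neg_mem' := by
    rintro _ ⟨U, hU, s, rfl, hs⟩
    exact ⟨U, hU, -s, map_neg _ _, fun y hy h => by rw [map_neg, hs y hy h, neg_zero]⟩

theorem germsWithSupport_map {F G : TopCat.Presheaf AddCommGrpCat.{u} X} (α : F ⟶ G)
    {t : F.stalk x} (ht : t ∈ germsWithSupport x F) :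
    (TopCat.Presheaf.stalkFunctor AddCommGrpCat.{u} x).map α t ∈ germsWithSupport x G := by
  obtain ⟨U, hU, s, rfl, hs⟩ := ht
  refine ⟨U, hU, α.app (op U) s, ?_, fun y hy h => ?_⟩
  · rw [TopCat.Presheaf.stalkFunctor_map_germ_apply]
  · rw [← TopCat.Presheaf.stalkFunctor_map_germ_apply, hs y hy h]
    exact map_zero ((TopCat.Presheaf.stalkFunctor AddCommGrpCat.{u} y).map α).hom

/-- The functor `F ↦ Γ_x(F)` on abelian sheaves. -/
def germsWithSupportFunctor : TopCat.Sheaf AddCommGrpCat.{u} X ⥤ AddCommGrpCat.{u} where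
  obj F := AddCommGrpCat.of (germsWithSupport x F.presheaf)
  map {F G} α := AddCommGrpCat.ofHom <|
    (((TopCat.Presheaf.stalkFunctor AddCommGrpCat.{u} x).map α.hom).hom.comp
      (germsWithSupport x F.presheaf).subtype).codRestrict (germsWithSupport x G.presheaf)
      fun t => germsWithSupport_map x α.hom t.2
  map_id F := by
    ext t
    exact ConcreteCategory.congr_hom
      ((TopCat.Presheaf.stalkFunctor AddCommGrpCat.{u} x).map_id F.presheaf) t.1
  map_comp α β := by
    ext t
    exact ConcreteCategory.congr_hom
      ((TopCat.Presheaf.stalkFunctor AddCommGrpCat.{u} x).map_comp α.hom β.hom) t.1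

instance : (germsWithSupportFunctor x).Additive where
  map_add {F G α β} := by
    ext t
    refine Subtype.ext ?_
    exact ConcreteCategory.congr_hom
      ((TopCat.Presheaf.stalkFunctor AddCommGrpCat.{u} x).map_add (f := α.hom) (g := β.hom)) t.1

/-- The local cohomology group `H^i_x(X, F)` of an abelian sheaf at a point: the `i`-th right
derived functor of `Γ_x`. -/
def localCohomologyAt (i : ℕ) (F : TopCat.Sheaf AddCommGrpCat.{u} X) : AddCommGrpCat.{u} :=
  ((germsWithSupportFunctor x).rightDerived i).obj F

end LocalCohomology

/-- An abelian sheaf `F` on a scheme `X` is Cohen–Macaulay if `H^i_y(X, F) = 0` for every point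
`y` of `X` and every `i` different from the codimension of the closure of `y`. The points of `X`
are ordered by specialization, with the generic points at the top, so that this codimension is the
coheight of `y`. -/
def IsCohenMacaulay {X : Scheme.{u}} (F : TopCat.Sheaf AddCommGrpCat.{u} X) : Prop :=
  ∀ (y : X) (i : ℕ), (i : ℕ∞) ≠ Order.coheight y → IsZero (localCohomologyAt y i F)

/-! ### Presheaves of algebras and the sheaves attached to them -/

section AlgebraPresheaf

variable {K : Type} [CommRing K] {X : TopCat.{u}}

/-- A presheaf of commutative rings on a space, together with a ring homomorphism from `K` to its
global sections, as a presheaf of commutative `K`-algebras. -/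
def algebraPresheaf (O : TopCat.Presheaf CommRingCat.{u} X) (c : K →+* O.obj (op ⊤)) :
    (Opens X)ᵒᵖ ⥤ CommAlgCat.{u} K where
  obj U :=
    letI : Algebra K (O.obj U) := ((O.map (homOfLE le_top : U.unop ⟶ ⊤).op).hom.comp c).toAlgebra
    CommAlgCat.of K (O.obj U)
  map {U V} g :=
    letI : Algebra K (O.obj U) := ((O.map (homOfLE le_top : U.unop ⟶ ⊤).op).hom.comp c).toAlgebra
    letI : Algebra K (O.obj V) := ((O.map (homOfLE le_top : V.unop ⟶ ⊤).op).hom.comp c).toAlgebra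
    CommAlgCat.ofHom
      { toRingHom := (O.map g).hom
        commutes' := fun r => by
          change (O.map g).hom ((O.map _).hom (c r)) = (O.map _).hom (c r)
          rw [← CommRingCat.comp_apply, ← O.map_comp]
          rfl }
  map_id U := ConcreteCategory.hom_ext _ _ fun a => ConcreteCategory.congr_hom (O.map_id U) a
  map_comp g h :=
    ConcreteCategory.hom_ext _ _ fun a => ConcreteCategory.congr_hom (O.map_comp g h) a

/-- The morphism of presheaves of `K`-algebras given by a morphism of presheaves of rings that is
compatible with the maps from `K`. -/
def algebraPresheafMap {O O' : TopCat.Presheaf CommRingCat.{u} X} (c : K →+* O.obj (op ⊤))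
    (c' : K →+* O'.obj (op ⊤)) (α : O ⟶ O') (h : (α.app (op ⊤)).hom.comp c = c') :
    algebraPresheaf O c ⟶ algebraPresheaf O' c' where
  app U :=
    letI : Algebra K (O.obj U) := ((O.map (homOfLE le_top : U.unop ⟶ ⊤).op).hom.comp c).toAlgebra
    letI : Algebra K (O'.obj U) :=
      ((O'.map (homOfLE le_top : U.unop ⟶ ⊤).op).hom.comp c').toAlgebra
    CommAlgCat.ofHom
      { toRingHom := (α.app U).hom
        commutes' := fun r => by
          change (α.app U).hom ((O.map _).hom (c r)) = (O'.map _).hom (c' r)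
          rw [← h]
          exact ConcreteCategory.congr_hom (α.naturality (homOfLE le_top : U.unop ⟶ ⊤).op) (c r) }
  naturality _ _ g :=
    ConcreteCategory.hom_ext _ _ fun a => ConcreteCategory.congr_hom (α.naturality g) a

/-- The sheaf `T(O)` obtained by localizing a functor `T` from commutative algebras to abelian
groups: the sheaf associated with `U ↦ T(O(U))`. -/
def localize (T : CommAlgCat.{u} K ⥤ AddCommGrpCat.{u}) (O : (Opens X)ᵒᵖ ⥤ CommAlgCat.{u} K) :
    TopCat.Sheaf AddCommGrpCat.{u} X :=
  (presheafToSheaf (Opens.grothendieckTopology X) AddCommGrpCat.{u}).obj (O ⋙ T)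

/-- The morphism `T(O) ⟶ T(O')` induced by a morphism of presheaves of algebras `O ⟶ O'`. -/
def localizeMap (T : CommAlgCat.{u} K ⥤ AddCommGrpCat.{u})
    {O O' : (Opens X)ᵒᵖ ⥤ CommAlgCat.{u} K} (α : O ⟶ O') : localize T O ⟶ localize T O' :=
  (presheafToSheaf (Opens.grothendieckTopology X) AddCommGrpCat.{u}).map
    (Functor.whiskerRight α T)

end AlgebraPresheaf

/-! ### Projective schemes and infinitesimal thickenings -/

section Thickening

variable {k : Type u} [Field k]

attribute [local instance] MvPolynomial.gradedAlgebra in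
/-- A scheme over a field `k` is projective if it admits a closed immersion over `k` into some
projective space `ℙ^n_k = Proj k[x₀, …, xₙ]`. -/
def IsProjectiveOver {X : Scheme.{u}} (f : X ⟶ Spec (.of k)) : Prop :=
  ∃ (n : ℕ) (i : X ⟶ Proj (MvPolynomial.homogeneousSubmodule (Fin (n + 1)) k)),
    IsClosedImmersion i ∧
      i ≫ Proj.toSpecZero (MvPolynomial.homogeneousSubmodule (Fin (n + 1)) k) ≫
        Spec.map (CommRingCat.ofHom
          (algebraMap k (MvPolynomial.homogeneousSubmodule (Fin (n + 1)) k 0))) = f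

/-- The ring homomorphism from `k` to the global functions of a scheme over `k`. -/
def constants {X : Scheme.{u}} (f : X ⟶ Spec (.of k)) : k →+* Γ(X, ⊤) :=
  ((Scheme.ΓSpecIso (.of k)).inv ≫ f.appTop).hom

/-- The augmentation `A → k` of a local `k`-algebra with residue field `k`. -/
def augmentation (A : Type u) [CommRing A] [Algebra k A] [IsLocalRing A]
    (hA : Function.Bijective (algebraMap k (IsLocalRing.ResidueField A))) : A →ₐ[k] k :=
  (AlgEquiv.ofBijective (Algebra.ofId k (IsLocalRing.ResidueField A)) hA).symm.toAlgHom.comp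
    (IsScalarTower.toAlgHom k A (IsLocalRing.ResidueField A))

variable {X : Scheme.{u}} (f : X ⟶ Spec (.of k)) (A : Type u) [CommRing A] [Algebra k A]

/-- The thickening `X_A = X ×_{Spec k} Spec A`. -/
def thickening : Scheme.{u} :=
  pullback f (Spec.map (CommRingCat.ofHom (algebraMap k A)))

/-- The projection `X_A ⟶ X`. -/
def thickeningProj : thickening f A ⟶ X :=
  pullback.fst f (Spec.map (CommRingCat.ofHom (algebraMap k A)))

/-- The closed immersion `X ⟶ X_A` given by a homomorphism of `k`-algebras `A → k`. -/
def thickeningIncl (ε : A →ₐ[k] k) : X ⟶ thickening f A :=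
  pullback.lift (𝟙 X) (f ≫ Spec.map (CommRingCat.ofHom ε.toRingHom)) (by
    have h : CommRingCat.ofHom (algebraMap k A) ≫ CommRingCat.ofHom ε.toRingHom = 𝟙 _ := by
      ext r
      exact ε.commutes r
    rw [Category.id_comp, Category.assoc, ← Spec.map_comp, h, Spec.map_id, Category.comp_id])

theorem thickeningIncl_proj (ε : A →ₐ[k] k) : thickeningIncl f A ε ≫ thickeningProj f A = 𝟙 X :=
  pullback.lift_fst _ _ _

/-- The structure sheaf `O_{X_A}` as a presheaf of rings on the space of `X`. The projection
`X_A ⟶ X` is a homeomorphism when `A` is a local artinian `k`-algebra with residue field `k`. -/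
def thickeningPresheaf : TopCat.Presheaf CommRingCat.{u} X :=
  (Opens.map (thickeningProj f A).base).op ⋙ (thickening f A).presheaf

/-- The restriction map `O_{X_A} ⟶ O_X` along the closed immersion `X ⟶ X_A`. -/
def thickeningRestrict (ε : A →ₐ[k] k) : thickeningPresheaf f A ⟶ X.presheaf where
  app U := (thickeningIncl f A ε).appLE (thickeningProj f A ⁻¹ᵁ U.unop) U.unop (by
    rw [← Scheme.Hom.comp_preimage, thickeningIncl_proj]
    exact le_rfl)
  naturality U V g := by
    change (thickening f A).presheaf.map _ ≫ _ = _ ≫ X.presheaf.map _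
    rw [Scheme.Hom.map_appLE, Scheme.Hom.appLE_map]

variable [CharZero k]

/-- The structure sheaf of `X` as a presheaf of `ℚ`-algebras. -/
def ratStructure : (Opens X)ᵒᵖ ⥤ CommAlgCat.{u} ℚ :=
  algebraPresheaf X.presheaf ((constants f).comp (algebraMap ℚ k))

/-- The structure sheaf of `X_A`, regarded on the space of `X`, as a presheaf of `ℚ`-algebras. -/
def ratThickening : (Opens X)ᵒᵖ ⥤ CommAlgCat.{u} ℚ :=
  algebraPresheaf (thickeningPresheaf f A)
    ((constants (thickeningProj f A ≫ f)).comp (algebraMap ℚ k))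

/-- The restriction map `O_{X_A} ⟶ O_X` as a morphism of presheaves of `ℚ`-algebras. -/
def ratRestrict (ε : A →ₐ[k] k) : ratThickening f A ⟶ ratStructure f :=
  algebraPresheafMap _ _ (thickeningRestrict f A ε) (Subsingleton.elim _ _)

/-- `T(O_{X_A}) ⟶ T(O_X)`, induced by the augmentation, for a functor `T` from commutative
`ℚ`-algebras to abelian groups. -/
def augMap (ε : A →ₐ[k] k) (T : CommAlgCat.{u} ℚ ⥤ AddCommGrpCat.{u}) :
    localize T (ratThickening f A) ⟶ localize T (ratStructure f) :=
  localizeMap T (ratRestrict f A ε)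

/-- The relative sheaf: the kernel of `T(O_{X_A}) ⟶ T(O_X)`. -/
def relSheaf (ε : A →ₐ[k] k) (T : CommAlgCat.{u} ℚ ⥤ AddCommGrpCat.{u}) :
    TopCat.Sheaf AddCommGrpCat.{u} X :=
  kernel (augMap f A ε T)

/-- The inclusion of the relative sheaf into `T(O_{X_A})`. -/
def relSheafIncl (ε : A →ₐ[k] k) (T : CommAlgCat.{u} ℚ ⥤ AddCommGrpCat.{u}) :
    relSheaf f A ε T ⟶ localize T (ratThickening f A) :=
  kernel.ι (augMap f A ε T)

end Thickening

end HochschildCM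

end

open HochschildCM

set_option linter.unusedSectionVars false

noncomputable section

namespace HochschildCM

/-! ### Antisymmetrization and the Adams operations -/

section Antisymmetrization

variable (K : Type v) [CommRing K] (R : Type u) [CommRing R] [Algebra K R]

/-! The theorem has two independent halves.

Comparison with forms. Over a field of characteristic zero, let `π` send `a₀ ⊗ a₁ ⊗ ⋯ ⊗ aₚ` to `a₀
da₁ ∧ ⋯ ∧ daₚ`, and let `ε` be the signed sum over permutations of `a₁, …, aₚ`. The Leibniz rule
makes `π` vanish on boundaries, and `π ∘ ε = p! π`. Chains in the image of `ε` are cycles, and `ψ^m`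
multiplies them by `m ^ p`. Inclusion-exclusion writes `ε` as an alternating sum of Adams
operations, so on weight `p` classes `ε` acts as `p!` (`antisymm_sub_mem_boundaries`). Finally `ε`
satisfies the Leibniz rule up to boundaries (`antisymm_comp_face_mem`), so modulo boundaries it
factors through `π`. Hence `π` is an isomorphism from `HH_p^{(p)}` to `Ω^p` with inverse induced by
`ε / p!`. It is natural in the algebra, so it sheafifies and passes to kernels.

Cohen–Macaulayness. The projection `X_A ⟶ X` splits the augmentation, so the relative sheaf is a
direct summand of the sheaf of absolute forms on `X_A`, and it suffices to treat the latter.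
Smoothness gives `y` an affine neighbourhood `U`, with `B = Γ(X, U)` standard smooth over `k`, on
which the closure of `y` is cut out by a weakly regular sequence of length the codimension
(`exists_isWeaklyRegular_of_smooth`). Let `C = B ⊗ A` be the ring of functions of `X_A` over `U`.
The sequence `0 → C ⊗ Ω_A → Ω_C → Ω_{C/A} → 0` is exact with free last term, so `Ω_C` is extended
from an `A`-module, and `Ω^p_C` is `B ⊗_k` (a `k`-vector space), hence flat over `B`
(`flat_diffForms`). It is usually not finitely generated, but flatness suffices for the sequence to
be weakly regular on it.

The remaining point is a vanishing statement for quasi-coherent sheaves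
(`rZero_qcSheaf_of_isWeaklyRegular`), by induction on the length of the sequence `f, f₂, …` through
`0 → M → M_f → M_f / M → 0`. The middle term has no local cohomology at `y`, because `f` vanishes
there, and `f₂, …` is weakly regular on the quotient. With no elements left, the module is supported
on the closure of `y` and only degree zero survives. All sheaf cohomology is handled through
vanishing of derived functors, flasque sheaves and comparison of stalks near `y`. -/

theorem tensorMap_comp {ι κ l : Type} [Fintype ι] [Fintype κ] [DecidableEq κ] [DecidableEq l]
    (g : κ → l) (f : ι → κ) :
    tensorMap K R g ∘ₗ tensorMap K R f = tensorMap K R (g ∘ f) := by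
  ext a
  simp only [LinearMap.compMultilinearMap_apply, LinearMap.comp_apply, tensorMap_tprod]
  congr 1
  funext j
  rw [Finset.prod_sigma']
  refine Finset.prod_bij (fun x _ => x.2) ?_ ?_ ?_ ?_
  · rintro ⟨x, y⟩ h
    simp only [Finset.mem_sigma, Finset.mem_filter, Finset.mem_univ, true_and] at h
    simp [h.2, h.1]
  · rintro ⟨x, y⟩ h ⟨x', y'⟩ h' e
    simp only [Finset.mem_sigma, Finset.mem_filter, Finset.mem_univ, true_and] at h h'
    obtain rfl : y = y' := e
    rw [← h.2, ← h'.2]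
  · intro y hy
    simp only [Finset.mem_filter, Finset.mem_univ, true_and] at hy
    exact ⟨⟨f y, y⟩, by simpa using hy, rfl⟩
  · intros; rfl

theorem linearMap_comp_sum {M N P ι : Type*} [AddCommMonoid M] [AddCommMonoid N] [AddCommMonoid P]
    [Module K M] [Module K N] [Module K P] (s : Finset ι) (g : N →ₗ[K] P) (f : ι → M →ₗ[K] N) :
    g ∘ₗ (∑ i ∈ s, f i) = ∑ i ∈ s, g ∘ₗ f i := by
  ext x; simp

theorem linearMap_sum_comp {M N P ι : Type*} [AddCommMonoid M] [AddCommMonoid N] [AddCommMonoid P]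
    [Module K M] [Module K N] [Module K P] (s : Finset ι) (g : ι → N →ₗ[K] P) (f : M →ₗ[K] N) :
    (∑ i ∈ s, g i) ∘ₗ f = ∑ i ∈ s, g i ∘ₗ f := by
  ext x; simp

/-- A permutation of the letters `a₁, …, aₙ`, extended to `a₀, …, aₙ` by fixing `a₀`. -/
def permMap {n : ℕ} (σ : Equiv.Perm (Fin n)) : Fin (n + 1) → Fin (n + 1) :=
  Fin.cases 0 fun i => (σ i).succ

@[simp] theorem permMap_zero {n : ℕ} (σ : Equiv.Perm (Fin n)) : permMap σ 0 = 0 := rfl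

@[simp] theorem permMap_succ {n : ℕ} (σ : Equiv.Perm (Fin n)) (i : Fin n) :
    permMap σ i.succ = (σ i).succ := rfl

theorem permMap_mul {n : ℕ} (σ τ : Equiv.Perm (Fin n)) :
    permMap (σ * τ) = permMap σ ∘ permMap τ := by
  funext i
  refine Fin.cases rfl (fun i => rfl) i

/-- The sign of a permutation as a scalar. -/
def sgn {n : ℕ} (σ : Equiv.Perm (Fin n)) : K := ((Equiv.Perm.sign σ : ℤˣ) : ℤ)

theorem sgn_mul {n : ℕ} (σ τ : Equiv.Perm (Fin n)) : sgn K (σ * τ) = sgn K σ * sgn K τ := by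
  simp [sgn]

/-- Antisymmetrization of the letters `a₁, …, aₙ`. -/
def antisymm (n : ℕ) : HochschildChain K R n →ₗ[K] HochschildChain K R n :=
  ∑ σ : Equiv.Perm (Fin n), sgn K σ • tensorMap K R (permMap σ)

theorem permMap_comp_antisymm {n : ℕ} (τ : Equiv.Perm (Fin n)) :
    sgn K τ • (tensorMap K R (permMap τ) ∘ₗ antisymm K R n) = antisymm K R n := by
  rw [antisymm, linearMap_comp_sum, Finset.smul_sum]
  refine Fintype.sum_equiv (Equiv.mulLeft τ) _ _ fun σ => ?_
  rw [LinearMap.comp_smul, tensorMap_comp, smul_smul, ← sgn_mul, ← permMap_mul]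
  rfl

theorem antisymm_comp_permMap {n : ℕ} (τ : Equiv.Perm (Fin n)) :
    sgn K τ • (antisymm K R n ∘ₗ tensorMap K R (permMap τ)) = antisymm K R n := by
  rw [antisymm, linearMap_sum_comp, Finset.smul_sum]
  refine Fintype.sum_equiv (Equiv.mulRight τ) _ _ fun σ => ?_
  rw [LinearMap.smul_comp, tensorMap_comp, smul_smul, mul_comm, ← sgn_mul, ← permMap_mul]
  rfl

theorem adamsPsi_eq (n m : ℕ) : adamsPsi K R n m =
    ∑ f : Fin n → Fin m, sgn K (Tuple.sort f) • tensorMap K R (permMap (Tuple.sort f)) := rfl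

/-- Each signed permutation in `ψ^m` is absorbed by the antisymmetrization, and there are `m ^ n`
maps `Fin n → Fin m`. Thus antisymmetrized chains are eigenvectors before passing to homology. -/
theorem adamsPsi_comp_antisymm (n m : ℕ) :
    adamsPsi K R n m ∘ₗ antisymm K R n = ((m : K) ^ n) • antisymm K R n := by
  rw [adamsPsi_eq, linearMap_sum_comp]
  simp_rw [LinearMap.smul_comp, permMap_comp_antisymm]
  simp [← Nat.cast_smul_eq_nsmul K]

/-- Stable sorting depends only on the relative order of the values. This lets maps omitting a set
of values be treated as maps into a smaller `Fin m`. -/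
theorem sort_comp_of_strictMono {n m m' : ℕ} (f : Fin n → Fin m) {e : Fin m → Fin m'}
    (he : StrictMono e) : Tuple.sort (e ∘ f) = Tuple.sort f := by
  symm
  rw [Tuple.eq_sort_iff]
  refine ⟨?_, fun i j hij h => ?_⟩
  · intro i j hij
    exact he.monotone (Tuple.monotone_sort f hij)
  · exact ((Tuple.eq_sort_iff (f := f) (σ := Tuple.sort f)).mp rfl).2 i j hij (he.injective h)

theorem sort_perm {n : ℕ} (σ : Equiv.Perm (Fin n)) : Tuple.sort σ = σ⁻¹ := by
  symm
  rw [Tuple.eq_sort_iff]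
  refine ⟨?_, fun i j hij h => ?_⟩
  · intro i j hij; simpa using hij
  · simp at h; exact absurd h hij.ne

/-- Inclusion-exclusion: the sum over all self-maps of `Fin n` of a finite set with prescribed
signs of omitted values is the sum over permutations. -/
theorem sum_perm_eq_alternating_sum {n : ℕ} {V : Type*} [AddCommGroup V] (w : (Fin n → Fin n) → V) :
    ∑ σ : Equiv.Perm (Fin n), w σ =
      ∑ T : Finset (Fin n), (-1 : ℤ) ^ T.card • ∑ f : Fin n → Fin n with ∀ i, f i ∉ T, w f := by
  simp_rw [Finset.smul_sum, Finset.sum_filter]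
  rw [Finset.sum_comm]
  have h1 : ∀ f : Fin n → Fin n,
      (∑ T : Finset (Fin n), if ∀ i, f i ∉ T then (-1 : ℤ) ^ T.card • w f else 0) =
        if Function.Bijective f then w f else 0 := by
    intro f
    have h2 : (Finset.univ.filter fun T : Finset (Fin n) => ∀ i, f i ∉ T) =
        ((Finset.univ.image f)ᶜ).powerset := by
      ext T
      simp only [Finset.mem_filter, Finset.mem_univ, true_and, Finset.mem_powerset,
        Finset.subset_iff, Finset.mem_compl, Finset.mem_image, not_exists]
      exact ⟨fun h x hx i hi => h i (hi ▸ hx), fun h i hi => h hi i rfl⟩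
    rw [← Finset.sum_filter, h2, ← Finset.sum_smul, Finset.sum_powerset_neg_one_pow_card]
    have h3 : (Finset.univ.image f)ᶜ = ∅ ↔ Function.Bijective f := by
      rw [Finset.compl_eq_empty_iff, ← Finite.surjective_iff_bijective, Finset.eq_univ_iff_forall]
      simp [Function.Surjective]
    by_cases h : Function.Bijective f
    · rw [if_pos (h3.mpr h), if_pos h, one_smul]
    · rw [if_neg (fun h' => h (h3.mp h')), if_neg h, zero_smul]
  simp_rw [h1]
  rw [← Finset.sum_filter]
  refine Finset.sum_bij (fun σ _ => ⇑σ) (fun σ _ => Finset.mem_filter.mpr ⟨Finset.mem_univ _, σ.bijective⟩)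
    (fun σ _ τ _ h => DFunLike.coe_injective h) (fun f hf => ?_) (fun _ _ => rfl)
  exact ⟨Equiv.ofBijective f (by simpa using hf), by simp, rfl⟩

theorem sum_avoiding {n : ℕ} (T : Finset (Fin n)) {V : Type*} [AddCommGroup V]
    (w : ∀ {m : ℕ}, (Fin n → Fin m) → V)
    (hw : ∀ {m m' : ℕ} (f : Fin n → Fin m) (e : Fin m → Fin m'), StrictMono e → w (e ∘ f) = w f) :
    ∑ f : Fin n → Fin n with ∀ i, f i ∉ T, w f = ∑ f : Fin n → Fin (Tᶜ.card), w f := by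
  symm
  let e := Tᶜ.orderEmbOfFin rfl
  refine Finset.sum_bij (fun f _ => e ∘ f) (fun f _ => ?_) (fun f _ g _ h => ?_)
    (fun f hf => ?_) (fun f _ => (hw f e e.strictMono).symm)
  · simp only [Finset.mem_filter, Finset.mem_univ, true_and, Function.comp_apply]
    intro i
    have := Finset.orderEmbOfFin_mem Tᶜ rfl (f i)
    exact Finset.mem_compl.mp this
  · funext i
    exact e.injective (congrFun h i)
  · simp only [Finset.mem_filter, Finset.mem_univ, true_and] at hf
    have : ∀ i, ∃ j, e j = f i := fun i => by
      have : f i ∈ Set.range e := by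
        rw [Finset.range_orderEmbOfFin]
        simpa using hf i
      exact this
    choose g hg using this
    exact ⟨g, Finset.mem_univ _, funext hg⟩

/-- Permutations are the self-maps of `Fin n` omitting no value. Inclusion-exclusion over the set
`T` of omitted values applies, and the maps avoiding `T` contribute exactly the Adams operation of
index the size of the complement. -/
theorem antisymm_eq_sum_adamsPsi (n : ℕ) : antisymm K R n =
    ∑ T : Finset (Fin n), (-1 : ℤ) ^ T.card • adamsPsi K R n (Tᶜ.card) := by
  have h := sum_perm_eq_alternating_sum (n := n)
    (fun f => sgn K (Tuple.sort f) • tensorMap K R (permMap (Tuple.sort f)))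
  have h' : antisymm K R n = ∑ σ : Equiv.Perm (Fin n),
      sgn K (Tuple.sort σ) • tensorMap K R (permMap (Tuple.sort σ)) := by
    rw [antisymm]
    -- Sorting a permutation returns its inverse, hence the reindexing by inversion.
    refine Fintype.sum_equiv (Equiv.inv _) _ _ fun σ => ?_
    rw [sort_perm]
    simp
  rw [h', h]
  refine Finset.sum_congr rfl fun T _ => ?_
  rw [adamsPsi_eq]
  congr 1
  refine sum_avoiding T (fun f => sgn K (Tuple.sort f) • tensorMap K R (permMap (Tuple.sort f))) ?_
  intro m m' f e he
  simp only [sort_comp_of_strictMono f he]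

theorem factorial_eq_alternating_sum (n : ℕ) : (n.factorial : K) =
    ∑ T : Finset (Fin n), (-1 : ℤ) ^ T.card • (Tᶜ.card : K) ^ n := by
  have h := sum_perm_eq_alternating_sum (n := n) (fun _ => (1 : K))
  rw [Finset.sum_const, Finset.card_univ, Fintype.card_perm, Fintype.card_fin,
    nsmul_eq_mul, mul_one] at h
  rw [h]
  refine Finset.sum_congr rfl fun T _ => ?_
  congr 1
  rw [sum_avoiding T (fun _ => (1 : K)) (fun _ _ _ => rfl)]
  simp

/-- In the expression of the antisymmetrization by Adams operations, each `ψ^m` may be replaced by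
`m ^ n` modulo boundaries. The same alternating sum with weight `1` evaluates the resulting scalar
as `n!`. -/
theorem antisymm_sub_mem_boundaries {n : ℕ} {x : HochschildChain K R n}
    (hx : x ∈ weightCycles K R n n) :
    antisymm K R n x - (n.factorial : K) • x ∈ hochschildBoundaries K R n := by
  rw [antisymm_eq_sum_adamsPsi, factorial_eq_alternating_sum, LinearMap.sum_apply,
    Finset.sum_smul, ← Finset.sum_sub_distrib]
  refine Submodule.sum_mem _ fun T _ => ?_
  rw [weightCycles, Submodule.mem_inf, Submodule.mem_iInf] at hx
  have h := hx.2 Tᶜ.card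
  rw [Submodule.mem_comap, LinearMap.sub_apply, LinearMap.smul_apply, LinearMap.id_apply] at h
  rw [smul_assoc]
  change (-1 : ℤ) ^ T.card • adamsPsi K R n Tᶜ.card x - _ ∈ _
  have h' := zsmul_mem h ((-1 : ℤ) ^ T.card)
  rw [zsmul_sub] at h'
  convert h' using 2

end Antisymmetrization

/-! ### Hochschild boundaries of antisymmetrized chains -/

section AntisymmetrizedBoundary

variable (K : Type v) [CommRing K] (R : Type u) [CommRing R] [Algebra K R]

theorem linearMap_neg_smul {m n : ℕ} (c : K) (f : HochschildChain K R m →ₗ[K] HochschildChain K R n) :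
    (-c) • f = -(c • f) :=
  neg_smul c f

theorem circleFace_val (n : ℕ) (i j : Fin (n + 2)) :
    (circleFace n i j : ℕ) = (if (j : ℕ) ≤ i then (j : ℕ) else (j : ℕ) - 1) % (n + 1) := by
  rw [circleFace, Fin.val_ofNat]
  simp only [Fin.le_def]

theorem circleFace_val_lt (n : ℕ) {i : Fin (n + 2)} (hi : (i : ℕ) ≤ n) (j : Fin (n + 2)) :
    (circleFace n i j : ℕ) = if (j : ℕ) ≤ i then (j : ℕ) else (j : ℕ) - 1 := by
  rw [circleFace_val, Nat.mod_eq_of_lt]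
  have := j.2
  split_ifs <;> omega

/-- The antisymmetrized sum, over a set of permutations of the letters, of a single face. -/
def faceSum (n : ℕ) (i : Fin (n + 2)) (s : Finset (Equiv.Perm (Fin (n + 1)))) :
    HochschildChain K R (n + 1) →ₗ[K] HochschildChain K R n :=
  ∑ σ ∈ s, sgn K σ • tensorMap K R (circleFace n i ∘ permMap σ)

theorem circleFace_interior_comp_swap (n : ℕ) (j : Fin n) :
    circleFace n j.castSucc.succ ∘ permMap (Equiv.swap j.castSucc j.succ) =
      circleFace n j.castSucc.succ := by
  funext a
  refine Fin.cases rfl (fun a => ?_) a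
  simp only [Function.comp_apply, permMap_succ]
  apply Fin.ext
  rw [circleFace_val_lt _ (by simp), circleFace_val_lt _ (by simp)]
  by_cases h1 : a = j.castSucc
  · subst h1; simp
  by_cases h2 : a = j.succ
  · subst h2; simp
  rw [Equiv.swap_apply_of_ne_of_ne h1 h2]

/-- An interior face multiplies two adjacent letters and, the algebra being commutative, does not
see their order. Terms differing by this transposition cancel. -/
theorem faceSum_interior (n : ℕ) (j : Fin n) (s : Finset (Equiv.Perm (Fin (n + 1))))
    (hs : ∀ σ ∈ s, Equiv.swap j.castSucc j.succ * σ ∈ s) :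
    faceSum K R n j.castSucc.succ s = 0 := by
  refine Finset.sum_involution (fun σ _ => Equiv.swap j.castSucc j.succ * σ) ?_ ?_ hs ?_
  · intro σ _
    rw [permMap_mul, ← Function.comp_assoc, circleFace_interior_comp_swap, sgn_mul]
    have : sgn K (Equiv.swap j.castSucc j.succ) = -1 := by
      rw [sgn, Equiv.Perm.sign_swap (by simp [Fin.ext_iff])]; simp
    rw [this, neg_one_mul, linearMap_neg_smul, add_neg_cancel]
  · intro σ _ _ h
    rw [mul_eq_right, Equiv.swap_eq_one_iff] at h
    simp [Fin.ext_iff] at h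
  · intro σ _
    rw [← mul_assoc, Equiv.swap_mul_self, one_mul]

theorem circleFace_last_eq (n : ℕ) :
    circleFace n (Fin.last (n + 1)) = circleFace n 0 ∘ permMap (finRotate (n + 1)) := by
  funext a
  refine Fin.cases rfl (fun a => ?_) a
  simp only [Function.comp_apply, permMap_succ]
  apply Fin.ext
  rw [circleFace_val, circleFace_val_lt _ (by simp)]
  have ha := a.2
  refine Fin.lastCases ?_ (fun b => ?_) a
  · simp
  · rw [finRotate_apply, Fin.coeSucc_eq_succ]
    have := b.2
    simp

/-- The last face is the zeroth face after a rotation of the letters. The rotation has sign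
`(-1)^n`, one factor off the sign `(-1)^(n+1)` of the face, which produces the minus sign. -/
theorem faceSum_last (n : ℕ) (s t : Finset (Equiv.Perm (Fin (n + 1))))
    (h : ∀ σ, finRotate (n + 1) * σ ∈ t ↔ σ ∈ s) :
    (-1 : K) ^ (n + 1) • faceSum K R n (Fin.last (n + 1)) s = - faceSum K R n 0 t := by
  rw [faceSum, faceSum, Finset.smul_sum, ← Finset.sum_neg_distrib]
  refine Finset.sum_bij (fun σ _ => finRotate (n + 1) * σ) (fun σ hσ => (h σ).mpr hσ)
    (fun σ _ τ _ e => mul_left_cancel e) (fun σ hσ => ?_) (fun σ _ => ?_)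
  · refine ⟨(finRotate (n + 1))⁻¹ * σ, ?_, by simp⟩
    rw [← h]
    simpa using hσ
  · rw [circleFace_last_eq, Function.comp_assoc, ← permMap_mul, sgn_mul, smul_smul, ← linearMap_neg_smul]
    congr 1
    have : sgn K (finRotate (n + 1)) = (-1) ^ n := by simp [sgn]
    rw [this]; ring

theorem hochschildB_comp_sum (n : ℕ) (s : Finset (Equiv.Perm (Fin (n + 1)))) :
    hochschildB K R n ∘ₗ (∑ σ ∈ s, sgn K σ • tensorMap K R (permMap σ)) =
      faceSum K R n 0 s +
        ∑ j : Fin n, (-1 : K) ^ ((j : ℕ) + 1) • faceSum K R n j.castSucc.succ s +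
        (-1 : K) ^ (n + 1) • faceSum K R n (Fin.last (n + 1)) s := by
  have h : ∀ i, faceSum K R n i s =
      tensorMap K R (circleFace n i) ∘ₗ (∑ σ ∈ s, sgn K σ • tensorMap K R (permMap σ)) := by
    intro i
    rw [linearMap_comp_sum, faceSum]
    refine Finset.sum_congr rfl fun σ _ => ?_
    rw [LinearMap.comp_smul, tensorMap_comp]
  rw [hochschildB, linearMap_sum_comp, Fin.sum_univ_succ, Fin.sum_univ_castSucc, ← add_assoc]
  simp_rw [LinearMap.smul_comp, ← h]
  simp

/-- The set of all permutations is stable under adjacent swaps and under rotation, so interior faces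
vanish and the two outer faces cancel. -/
theorem hochschildB_comp_antisymm (n : ℕ) :
    hochschildB K R n ∘ₗ antisymm K R (n + 1) = 0 := by
  rw [antisymm, hochschildB_comp_sum, faceSum_last K R n _ Finset.univ (by simp)]
  rw [Finset.sum_eq_zero]
  · abel
  · intro j _
    rw [faceSum_interior K R n j _ (by simp), smul_zero]

/-- The extension of a permutation of `Fin n` to `Fin (n + 1)` fixing `0`. -/
def extendPerm {n : ℕ} (σ : Equiv.Perm (Fin n)) : Equiv.Perm (Fin (n + 1)) :=
  Equiv.Perm.decomposeFin.symm (0, σ)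

@[simp] theorem extendPerm_zero {n : ℕ} (σ : Equiv.Perm (Fin n)) : extendPerm σ 0 = 0 := by
  simp [extendPerm]

@[simp] theorem extendPerm_succ {n : ℕ} (σ : Equiv.Perm (Fin n)) (i : Fin n) :
    extendPerm σ i.succ = (σ i).succ := by
  simp [extendPerm]

theorem sgn_extendPerm {n : ℕ} (σ : Equiv.Perm (Fin n)) : sgn K (extendPerm σ) = sgn K σ := by
  simp [sgn, extendPerm]

theorem extendPerm_injective {n : ℕ} :
    Function.Injective (extendPerm : Equiv.Perm (Fin n) → Equiv.Perm (Fin (n + 1))) := by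
  intro σ τ h
  simpa [extendPerm] using h

theorem exists_extendPerm {n : ℕ} (ρ : Equiv.Perm (Fin (n + 1))) (h : ρ 0 = 0) :
    ∃ σ, extendPerm σ = ρ := by
  refine ⟨(Equiv.Perm.decomposeFin ρ).2, ?_⟩
  have : (Equiv.Perm.decomposeFin ρ).1 = 0 := by
    have h' := Equiv.Perm.decomposeFin_symm_apply_zero (Equiv.Perm.decomposeFin ρ).1
      (Equiv.Perm.decomposeFin ρ).2
    rw [Prod.mk.eta, Equiv.symm_apply_apply, h] at h'
    exact h'.symm
  rw [extendPerm, ← this, Prod.mk.eta, Equiv.symm_apply_apply]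

/-- The permutations sending `0` to `a`. -/
theorem sum_perm_zero {n : ℕ} {V : Type*} [AddCommMonoid V] (a : Fin (n + 1))
    (s : Finset (Equiv.Perm (Fin (n + 1)))) (t : Finset (Equiv.Perm (Fin n)))
    (hs : ∀ τ ∈ s, τ 0 = a) (hst : ∀ σ, (Fin.cycleRange a).symm * extendPerm σ ∈ s ↔ σ ∈ t)
    (w : Equiv.Perm (Fin (n + 1)) → V) :
    ∑ τ ∈ s, w τ = ∑ σ ∈ t, w ((Fin.cycleRange a).symm * extendPerm σ) := by
  symm
  refine Finset.sum_bij (fun σ _ => (Fin.cycleRange a).symm * extendPerm σ)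
    (fun σ h => (hst σ).mpr h) (fun σ _ τ _ e => extendPerm_injective (mul_left_cancel e))
    (fun τ hτ => ?_) (fun _ _ => rfl)
  obtain ⟨σ, hσ⟩ := exists_extendPerm (Fin.cycleRange a * τ) (by simp [hs τ hτ])
  have h2 : (Fin.cycleRange a).symm * extendPerm σ = τ := by
    rw [hσ]
    ext x
    simp
  exact ⟨σ, by rw [← hst, h2]; exact hτ, h2⟩

/-- The permutation on the left puts the first two letters at the adjacent places `j` and `j + 1`,
in order. Multiplying them there is the same as multiplying them at the start and letting `σ` carry
the product to place `j`. -/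
theorem circleFace_cycleRange (n : ℕ) (j : Fin (n + 1)) (σ : Equiv.Perm (Fin (n + 1)))
    (hσ : σ 0 = j) :
    circleFace (n + 1) j.castSucc.succ ∘
        permMap ((Fin.cycleRange j.castSucc).symm * extendPerm σ) =
      permMap σ ∘ circleFace (n + 1) 1 := by
  funext a
  refine Fin.cases rfl (fun a => ?_) a
  refine Fin.cases ?_ (fun i => ?_) a
  · have h1 : circleFace (n + 1) 1 (Fin.succ 0) = Fin.succ 0 := by
      apply Fin.ext
      rw [circleFace_val_lt _ (by simp)]
      simp
    simp only [Function.comp_apply, h1, permMap_succ, Equiv.Perm.mul_apply, extendPerm_zero, hσ]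
    apply Fin.ext
    rw [circleFace_val_lt _ (by simp; omega)]
    simp
  · have h1 : circleFace (n + 1) 1 (i.succ.succ) = Fin.succ i := by
      apply Fin.ext
      rw [circleFace_val_lt _ (by simp)]
      simp
    simp only [Function.comp_apply, h1, permMap_succ, Equiv.Perm.mul_apply, extendPerm_succ]
    rw [Fin.cycleRange_symm_succ]
    apply Fin.ext
    rw [circleFace_val_lt _ (by simp; omega)]
    rcases lt_or_ge (σ i).castSucc j.castSucc with h | h
    · rw [Fin.succAbove_of_castSucc_lt _ _ h]
      have : ((σ i : Fin (n + 1)) : ℕ) < j := h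
      simp
      omega
    · rw [Fin.succAbove_of_le_castSucc _ _ h]
      have : (j : ℕ) ≤ (σ i : Fin (n + 1)) := h
      simp
      exact this

theorem circleFace_zero_extendPerm (n : ℕ) (σ : Equiv.Perm (Fin (n + 1))) :
    circleFace (n + 1) 0 ∘ permMap (extendPerm σ) = permMap σ ∘ circleFace (n + 1) 0 := by
  have h1 : ∀ i : Fin (n + 2), circleFace (n + 1) 0 i.succ = i := fun i => by
    apply Fin.ext
    rw [circleFace_val_lt _ (by simp)]
    simp
  funext a
  refine Fin.cases rfl (fun a => ?_) a
  simp only [Function.comp_apply, permMap_succ, h1]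
  refine Fin.cases ?_ (fun i => ?_) a <;> simp

/-- This is the Leibniz rule for antisymmetrized chains. On `a₀ ⊗ x ⊗ y ⊗ c` the three maps give
`a₀x ⊗ y ⊗ c`, `a₀y ⊗ x ⊗ c` and `a₀ ⊗ xy ⊗ c`. The bounding chain is the signed sum over those
permutations that keep `x` to the left of `y`. -/
theorem antisymm_comp_face_mem (n : ℕ) (w : HochschildChain K R (n + 2)) :
    antisymm K R (n + 1) ((tensorMap K R (circleFace (n + 1) 0) +
      tensorMap K R (circleFace (n + 1) 0 ∘ permMap (Equiv.swap 0 1)) -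
      tensorMap K R (circleFace (n + 1) 1)) w) ∈ hochschildBoundaries K R (n + 1) := by
  let s : Finset (Equiv.Perm (Fin (n + 2))) := {τ | τ 0 < τ 1}
  refine ⟨(∑ σ ∈ s, sgn K σ • tensorMap K R (permMap σ)) w, ?_⟩
  rw [← LinearMap.comp_apply, ← LinearMap.comp_apply, hochschildB_comp_sum]
  congr 1
  have hint : ∀ j : Fin (n + 1), (-1 : K) ^ ((j : ℕ) + 1) •
      faceSum K R (n + 1) j.castSucc.succ s = - ∑ σ : Equiv.Perm (Fin (n + 1)) with σ 0 = j,
        sgn K σ • (tensorMap K R (permMap σ) ∘ₗ tensorMap K R (circleFace (n + 1) 1)) := by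
    intro j
    -- Swapping the places `j` and `j + 1` preserves the condition `τ 0 < τ 1` unless the two
    -- distinguished letters occupy exactly these places. So only `s1` survives, and its sign
    -- `(-1)^j` against the face sign `(-1)^(j+1)` gives `-1`.
    let s1 := s.filter fun τ => τ 0 = j.castSucc ∧ τ 1 = j.succ
    let s2 := s.filter fun τ => ¬ (τ 0 = j.castSucc ∧ τ 1 = j.succ)
    have h12 : faceSum K R (n + 1) j.castSucc.succ s =
        faceSum K R (n + 1) j.castSucc.succ s1 + faceSum K R (n + 1) j.castSucc.succ s2 :=
      (Finset.sum_filter_add_sum_filter_not _ _ _).symm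
    have h2 : faceSum K R (n + 1) j.castSucc.succ s2 = 0 := by
      apply faceSum_interior
      intro σ hσ
      simp only [s2, s, Finset.mem_filter, Finset.mem_univ, true_and, Equiv.Perm.mul_apply]
        at hσ ⊢
      obtain ⟨hlt, hne⟩ := hσ
      have hj : j.castSucc ≠ j.succ := by simp [Fin.ext_iff]
      generalize σ 0 = a at hlt hne
      generalize σ 1 = b at hlt hne
      simp only [Equiv.swap_apply_def, Fin.ext_iff, Fin.lt_def] at *
      simp only [Fin.val_castSucc, Fin.val_succ] at *
      split_ifs <;> first | omega | (simp only [Fin.val_castSucc, Fin.val_succ] at *; omega)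
    have h1 : faceSum K R (n + 1) j.castSucc.succ s1 = (-1 : K) ^ (j : ℕ) •
        ∑ σ : Equiv.Perm (Fin (n + 1)) with σ 0 = j,
        sgn K σ • (tensorMap K R (permMap σ) ∘ₗ tensorMap K R (circleFace (n + 1) 1)) := by
      rw [faceSum, sum_perm_zero j.castSucc s1 {σ | σ 0 = j}, Finset.smul_sum]
      · refine Finset.sum_congr rfl fun σ hσ => ?_
        rw [circleFace_cycleRange n j σ (by simpa using hσ), sgn_mul, sgn_extendPerm,
          tensorMap_comp, smul_smul]
        congr 2
        simp [sgn]
      · intro τ hτ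
        simp only [s1, Finset.mem_filter] at hτ
        exact hτ.2.1
      · intro σ
        have e : (1 : Fin (n + 2)) = Fin.succ 0 := rfl
        simp only [s1, s, Finset.mem_filter, Finset.mem_univ, true_and, Equiv.Perm.mul_apply,
          extendPerm_zero, e, extendPerm_succ, Fin.cycleRange_symm_zero, Fin.cycleRange_symm_succ]
        rw [← Fin.succAbove_castSucc_self, Fin.succAbove_right_inj]
        constructor
        · exact fun h => h.2
        · intro h
          rw [h, Fin.succAbove_castSucc_self]
          simp [Fin.lt_def]
    rw [h12, h2, add_zero, h1, smul_smul, ← pow_add, Odd.neg_one_pow (by use (j : ℕ); ring),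
      linearMap_neg_smul, one_smul]
  have hcomp : ∀ g : Fin (n + 3) → Fin (n + 2), antisymm K R (n + 1) ∘ₗ tensorMap K R g =
      ∑ σ : Equiv.Perm (Fin (n + 1)), sgn K σ • (tensorMap K R (permMap σ) ∘ₗ tensorMap K R g) := by
    intro g
    rw [antisymm, linearMap_sum_comp]
    rfl
  have hint' : ∑ j : Fin (n + 1), (-1 : K) ^ ((j : ℕ) + 1) •
      faceSum K R (n + 1) j.castSucc.succ s =
        - (antisymm K R (n + 1) ∘ₗ tensorMap K R (circleFace (n + 1) 1)) := by
    rw [Finset.sum_congr rfl fun j _ => hint j, Finset.sum_neg_distrib, Finset.sum_fiberwise, hcomp]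
  -- The image of `s` under rotation. The outer faces contribute the difference of the zeroth face
  -- over `s` and over `t`. These sets differ only where one of the two distinguished letters stands
  -- at place `0`.
  let t : Finset (Equiv.Perm (Fin (n + 2))) :=
    {τ | (finRotate (n + 2)).symm (τ 0) < (finRotate (n + 2)).symm (τ 1)}
  have hrot : ∀ a : Fin (n + 2), ((finRotate (n + 2)).symm a : ℕ) =
      if (a : ℕ) = 0 then n + 1 else (a : ℕ) - 1 := by
    intro a
    obtain ⟨b, rfl⟩ := (finRotate (n + 2)).surjective a
    rw [Equiv.symm_apply_apply, finRotate_apply]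
    refine Fin.lastCases ?_ (fun b => ?_) b
    · simp
    · rw [Fin.coeSucc_eq_succ]; simp
  have hst : ∀ τ : Equiv.Perm (Fin (n + 2)), τ ∈ s \ t ↔ τ 0 = 0 := by
    intro τ
    have hne : τ 0 ≠ τ 1 := fun h => by simpa using τ.injective h
    simp only [s, t, Finset.mem_sdiff, Finset.mem_filter, Finset.mem_univ, true_and, Fin.lt_def,
      hrot, ne_eq, Fin.ext_iff, Fin.val_zero] at hne ⊢
    have h0 := (τ 0).2
    have h1 := (τ 1).2
    split_ifs <;> omega
  have hts : ∀ τ : Equiv.Perm (Fin (n + 2)), τ ∈ t \ s ↔ τ 1 = 0 := by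
    intro τ
    have hne : τ 0 ≠ τ 1 := fun h => by simpa using τ.injective h
    simp only [s, t, Finset.mem_sdiff, Finset.mem_filter, Finset.mem_univ, true_and, Fin.lt_def,
      hrot, ne_eq, Fin.ext_iff, Fin.val_zero] at hne ⊢
    have h0 := (τ 0).2
    have h1 := (τ 1).2
    split_ifs <;> omega
  have hS : faceSum K R (n + 1) 0 (s \ t) =
      antisymm K R (n + 1) ∘ₗ tensorMap K R (circleFace (n + 1) 0) := by
    rw [faceSum, sum_perm_zero 0 (s \ t) Finset.univ (fun τ h => (hst τ).mp h)
      (fun σ => by rw [hst, Equiv.Perm.mul_apply, extendPerm_zero, Fin.cycleRange_symm_zero]; simp), hcomp]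
    refine Finset.sum_congr rfl fun σ _ => ?_
    have : (Fin.cycleRange (0 : Fin (n + 2))).symm * extendPerm σ = extendPerm σ := by
      rw [Fin.cycleRange_zero]; exact one_mul _
    rw [this, sgn_extendPerm, circleFace_zero_extendPerm, tensorMap_comp]
  -- Exchanging the two distinguished letters identifies `t \ s` with `s \ t` and reverses the sign.
  have hT : faceSum K R (n + 1) 0 (t \ s) = - (antisymm K R (n + 1) ∘ₗ
      tensorMap K R (circleFace (n + 1) 0 ∘ permMap (Equiv.swap 0 1))) := by
    rw [← tensorMap_comp, ← LinearMap.comp_assoc, ← hS, faceSum, faceSum, linearMap_sum_comp,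
      ← Finset.sum_neg_distrib]
    refine Finset.sum_bij (fun τ _ => τ * Equiv.swap 0 1) (fun τ hτ => ?_)
      (fun σ _ τ _ e => mul_right_cancel e) (fun τ hτ => ?_) (fun τ _ => ?_)
    · rw [hts] at hτ; rw [hst]; simpa using hτ
    · refine ⟨τ * Equiv.swap 0 1, ?_, by simp⟩
      rw [hst] at hτ; rw [hts]; simpa using hτ
    · have h1 : sgn K (Equiv.swap (0 : Fin (n + 2)) 1) = -1 := by
        rw [sgn, Equiv.Perm.sign_swap (by simp)]; simp
      rw [LinearMap.smul_comp, tensorMap_comp, Function.comp_assoc, ← permMap_mul, mul_assoc,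
        Equiv.swap_mul_self, mul_one, sgn_mul, h1, mul_neg_one, linearMap_neg_smul, neg_neg]
  have hlast := faceSum_last K R (n + 1) s t (fun σ => by simp [s, t])
  have hsub : faceSum K R (n + 1) 0 s - faceSum K R (n + 1) 0 t =
      faceSum K R (n + 1) 0 (s \ t) - faceSum K R (n + 1) 0 (t \ s) :=
    Finset.sum_sdiff_sub_sum_sdiff.symm
  rw [hlast, hint', LinearMap.comp_sub, LinearMap.comp_add, ← hS, ← neg_neg (antisymm K R (n + 1) ∘ₗ
    tensorMap K R (circleFace (n + 1) 0 ∘ permMap (Equiv.swap 0 1))), ← hT]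
  have e : faceSum K R (n + 1) 0 s + -(antisymm K R (n + 1) ∘ₗ tensorMap K R (circleFace (n + 1) 1)) +
      - faceSum K R (n + 1) 0 t = (faceSum K R (n + 1) 0 s - faceSum K R (n + 1) 0 t) -
        antisymm K R (n + 1) ∘ₗ tensorMap K R (circleFace (n + 1) 1) := by abel
  rw [e, hsub]
  abel

end AntisymmetrizedBoundary

/-! ### From Hochschild chains to differential forms -/

section FormsOfChains

variable (K : Type v) [CommRing K] (R : Type u) [CommRing R] [Algebra K R]

/-- The `K`-multilinear map `(a₁, …, aₙ) ↦ da₁ ∧ ⋯ ∧ daₙ`. -/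
def dFormMulti (n : ℕ) : MultilinearMap K (fun _ : Fin n => R) (DiffForms K R n) :=
  ((exteriorPower.ιMulti R n (M := Ω[R⁄K])).toMultilinearMap.restrictScalars K).compLinearMap
    fun _ => (KaehlerDifferential.D K R).toLinearMap

/-- The map `a₀ ⊗ a₁ ⊗ ⋯ ⊗ aₙ ↦ a₀ da₁ ∧ ⋯ ∧ daₙ`. -/
def formOfChain (n : ℕ) : HochschildChain K R n →ₗ[K] DiffForms K R n :=
  PiTensorProduct.lift
    (LinearMap.uncurryLeft (R := K) (M := fun _ : Fin (n + 1) => R)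
      { toFun := fun r => r • dFormMulti K R n
        map_add' := fun r s => add_smul r s _
        map_smul' := fun c r => by
          ext a
          exact smul_assoc c r _ })

theorem formOfChain_tprod {n : ℕ} (a : Fin (n + 1) → R) :
    formOfChain K R n (PiTensorProduct.tprod K a) = a 0 • dForm K fun i : Fin n => a i.succ := by
  rw [formOfChain, PiTensorProduct.lift.tprod]
  rfl

theorem forms_neg_smul {n : ℕ} (c : K) (x : DiffForms K R n) : (-c) • x = -(c • x) :=
  neg_smul c x

variable {R} in
theorem chain_induction {n : ℕ} {p : HochschildChain K R n → Prop} (x : HochschildChain K R n)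
    (h : ∀ a, p (PiTensorProduct.tprod K a)) (hadd : ∀ x y, p x → p y → p (x + y)) : p x := by
  induction x using PiTensorProduct.induction_on with
  | add x y hx hy => exact hadd x y hx hy
  | smul_tprod r a =>
    have : r • PiTensorProduct.tprod K a = PiTensorProduct.tprod K (Function.update a 0 (r • a 0)) := by
      rw [MultilinearMap.map_update_smul, Function.update_eq_self]
    rw [this]
    exact h _

theorem tensorMap_face_tprod {n : ℕ} (f : Fin (n + 1) → Fin n) (p : Fin (n + 1))
    (hp : ∀ k, f (p.succAbove k) = k) (a : Fin (n + 1) → R) :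
    tensorMap K R f (PiTensorProduct.tprod K a) = PiTensorProduct.tprod K fun j =>
      (if f p = j then a p else 1) * a (p.succAbove j) := by
  rw [tensorMap_tprod]
  congr 1
  funext j
  rw [Finset.prod_filter, Fin.prod_univ_succAbove _ p]
  simp [hp]

theorem circleFace_succAbove (n : ℕ) (i k : Fin (n + 1)) :
    circleFace n i.castSucc (i.succ.succAbove k) = k := by
  apply Fin.ext
  rw [circleFace_val_lt _ (by simp; omega)]
  rcases le_or_gt k i with h | h
  · rw [Fin.succAbove_of_castSucc_lt _ _ (by rw [Fin.lt_def]; simp; omega)]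
    simp [h]
  · rw [Fin.succAbove_of_le_castSucc _ _ (by rw [Fin.le_def]; simp; omega)]
    simp
    omega

theorem circleFace_castSucc_succ (n : ℕ) (i : Fin (n + 1)) :
    circleFace n i.castSucc i.succ = i := by
  apply Fin.ext
  rw [circleFace_val_lt _ (by simp; omega)]
  simp

theorem circleFace_last_castSucc (n : ℕ) (k : Fin (n + 1)) :
    circleFace n (Fin.last (n + 1)) ((Fin.last (n + 1)).succAbove k) = k := by
  apply Fin.ext
  rw [circleFace_val]
  simp
  omega

theorem circleFace_last_last (n : ℕ) :
    circleFace n (Fin.last (n + 1)) (Fin.last (n + 1)) = 0 := by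
  apply Fin.ext
  rw [circleFace_val]
  simp

/-- Let `t j` be `a₀ bⱼ` times the wedge of the differentials of the other letters. By the Leibniz
rule an interior face gives the sum of two consecutive `t j`, while the outer faces give only the
first and the last. The alternating sum telescopes. -/
theorem formOfChain_hochschildB (n : ℕ) (x : HochschildChain K R (n + 1)) :
    formOfChain K R n (hochschildB K R n x) = 0 := by
  induction x using chain_induction with
  | hadd x y hx hy => rw [map_add, map_add, hx, hy, add_zero]
  | h a =>
    let b : Fin (n + 1) → R := fun i => a i.succ
    let t : Fin (n + 1) → DiffForms K R n := fun j => (a 0 * b j) • dForm K (b ∘ j.succAbove)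
    have h0 : formOfChain K R n (tensorMap K R (circleFace n (Fin.castSucc 0))
        (PiTensorProduct.tprod K a)) = t 0 := by
      rw [tensorMap_face_tprod K R _ (Fin.succ 0) (circleFace_succAbove n 0),
        circleFace_castSucc_succ, formOfChain_tprod]
      have h1 : (Fin.succ 0 : Fin (n + 2)).succAbove 0 = 0 := rfl
      have h2 : ∀ i : Fin n, (Fin.succ 0 : Fin (n + 2)).succAbove i.succ = i.succ.succ := fun i => by
        rw [Fin.succ_succAbove_succ, Fin.succAbove_zero]
      simp only [h1, h2, (Fin.succ_ne_zero _).symm, if_true, if_false, one_mul, t, b,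
        Function.comp_def, Fin.succAbove_zero, mul_comm]
    have hl : formOfChain K R n (tensorMap K R (circleFace n (Fin.last (n + 1)))
        (PiTensorProduct.tprod K a)) = t (Fin.last n) := by
      rw [tensorMap_face_tprod K R _ (Fin.last _) (circleFace_last_castSucc n),
        circleFace_last_last, formOfChain_tprod]
      simp only [(Fin.succ_ne_zero _).symm, if_true, if_false, one_mul, t, b,
        Function.comp_def, Fin.succAbove_last, mul_comm, Fin.succ_last, Fin.castSucc_zero,
        Fin.succ_castSucc]
    have hi : ∀ i : Fin n, formOfChain K R n (tensorMap K R (circleFace n (Fin.castSucc i.succ))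
        (PiTensorProduct.tprod K a)) = t i.castSucc + t i.succ := by
      intro i
      rw [tensorMap_face_tprod K R _ (Fin.succ _) (circleFace_succAbove n _),
        circleFace_castSucc_succ, formOfChain_tprod]
      have hz : (if i.succ = (0 : Fin (n + 1)) then a i.succ.succ else 1) = 1 :=
        if_neg (Fin.succ_ne_zero _)
      have hz' : (i.succ.succ : Fin (n + 2)).succAbove 0 = 0 := rfl
      rw [hz, hz', one_mul]
      -- Omitting either of the two neighbouring letters leaves the same word `c` except at place
      -- `i`. Leibniz is therefore applied in that single slot.
      let c : Fin n → R := b ∘ (i.castSucc).succAbove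
      have hc : ∀ z, (dForm K (Function.update c i z) : DiffForms K R n) =
          dFormMulti K R n (Function.update c i z) := fun z => rfl
      have e1 : b ∘ (i.castSucc).succAbove = Function.update c i (b i.succ) := by
        have : b i.succ = c i := by simp only [c, Function.comp_apply, Fin.succAbove_castSucc_self]
        rw [this, Function.update_eq_self]
      have hk : ∀ k, k ≠ i → i.succ.succAbove k = i.castSucc.succAbove k := by
        intro k hk
        rcases lt_or_gt_of_ne hk with h | h
        · rw [Fin.succAbove_of_castSucc_lt _ _ (Fin.castSucc_lt_castSucc_iff.mpr h),
            Fin.succAbove_of_castSucc_lt _ _ ((Fin.castSucc_lt_castSucc_iff.mpr h).trans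
              (Fin.castSucc_lt_succ (i := i)))]
        · rw [Fin.succAbove_of_le_castSucc _ _ (Fin.castSucc_lt_castSucc_iff.mpr h).le,
            Fin.succAbove_of_le_castSucc _ _ (Fin.succ_le_castSucc_iff.mpr h)]
      have e2 : b ∘ (i.succ).succAbove = Function.update c i (b i.castSucc) := by
        funext k
        by_cases h : k = i
        · subst h; simp
        · rw [Function.update_of_ne h]
          simp only [c, Function.comp_apply, hk k h]
      have e3 : (fun k : Fin n => (if i.succ = k.succ then a i.succ.succ else 1) *
          a ((i.succ.succ : Fin (n + 2)).succAbove k.succ)) =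
          Function.update c i (b i.castSucc * b i.succ) := by
        funext k
        rw [Fin.succ_succAbove_succ]
        by_cases h : k = i
        · subst h
          simp [b, mul_comm]
        · rw [Function.update_of_ne h, if_neg (fun h' => h (Fin.succ_injective _ h'.symm)), one_mul,
            hk k h]
          rfl
      rw [e3]
      simp only [t, e1, e2]
      have key : (dForm K (Function.update c i (b i.castSucc * b i.succ)) : DiffForms K R n) =
          b i.castSucc • dForm K (Function.update c i (b i.succ)) +
            b i.succ • dForm K (Function.update c i (b i.castSucc)) := by
        have hu : ∀ z : R, (fun k => KaehlerDifferential.D K R (Function.update c i z k)) =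
            Function.update (fun k => KaehlerDifferential.D K R (c k)) i
              (KaehlerDifferential.D K R z) := by
          intro z
          funext k
          by_cases hk : k = i
          · subst hk; simp
          · simp [Function.update_of_ne hk]
        simp only [dForm, hu]
        rw [Derivation.leibniz, AlternatingMap.map_update_add, AlternatingMap.map_update_smul,
          AlternatingMap.map_update_smul]
      rw [key, smul_add, smul_smul, smul_smul]
    rw [hochschildB, LinearMap.sum_apply, map_sum, Fin.sum_univ_castSucc, Fin.sum_univ_succ]
    simp only [LinearMap.smul_apply, map_smul, h0, hl, hi]
    let w : Fin (n + 1) → DiffForms K R n := fun j => (-1 : K) ^ (j : ℕ) • t j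
    have hw : ∀ i : Fin n, (-1 : K) ^ ((i.succ.castSucc : Fin (n + 2)) : ℕ) •
        (t i.castSucc + t i.succ) = w i.succ - w i.castSucc := by
      intro i
      have h1 : (-1 : K) ^ (i.castSucc : ℕ) • t i.castSucc =
          - ((-1 : K) ^ ((i : ℕ) + 1) • t i.castSucc) := by
        rw [← forms_neg_smul, Fin.val_castSucc, pow_succ]; simp
      simp only [w]
      rw [h1, sub_neg_eq_add, smul_add, add_comm]
      rfl
    rw [Finset.sum_congr rfl fun i _ => hw i, Finset.sum_sub_distrib]
    have e1 := Fin.sum_univ_succ w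
    have e2 := Fin.sum_univ_castSucc w
    have e3 : w 0 = t 0 := by simp [w]
    have e4 : (-1 : K) ^ ((Fin.last (n + 1) : Fin (n + 2)) : ℕ) • t (Fin.last n) =
        - w (Fin.last n) := by
      simp only [w]
      rw [← forms_neg_smul]; simp [pow_succ]
    rw [e4]
    rw [e1, e3] at e2
    simp only [Fin.castSucc_zero, Fin.val_zero, pow_zero, one_smul]
    rw [← sub_eq_zero] at e2
    rw [← e2]
    abel

/-- The sign with which a permutation acts on the wedge product cancels its sign in the
antisymmetrization, so all `n!` terms agree. -/
theorem formOfChain_antisymm (n : ℕ) (x : HochschildChain K R n) :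
    formOfChain K R n (antisymm K R n x) = (n.factorial : K) • formOfChain K R n x := by
  induction x using chain_induction with
  | hadd x y hx hy => simp only [map_add, hx, hy, smul_add]
  | h a =>
    rw [antisymm, LinearMap.sum_apply, map_sum]
    have h : ∀ σ : Equiv.Perm (Fin n), formOfChain K R n ((sgn K σ • tensorMap K R (permMap σ))
        (PiTensorProduct.tprod K a)) = formOfChain K R n (PiTensorProduct.tprod K a) := by
      intro σ
      have h1 : tensorMap K R (permMap σ) (PiTensorProduct.tprod K a) =
          PiTensorProduct.tprod K (a ∘ permMap σ⁻¹) := by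
        rw [tensorMap_tprod]
        congr 1
        funext j
        have h2 : ∀ i, permMap σ i = j ↔ permMap σ⁻¹ j = i := by
          have e1 : ∀ i, permMap σ (permMap σ⁻¹ i) = i := fun i => by
            refine Fin.cases rfl (fun i => ?_) i; simp
          have e2 : ∀ i, permMap σ⁻¹ (permMap σ i) = i := fun i => by
            refine Fin.cases rfl (fun i => ?_) i; simp
          exact fun i => ⟨fun h => by rw [← h, e2], fun h => by rw [← h, e1]⟩
        simp [h2, Finset.filter_eq]
      rw [LinearMap.smul_apply, map_smul, h1, formOfChain_tprod, formOfChain_tprod]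
      have h3 : (dForm K fun i : Fin n => (a ∘ permMap σ⁻¹) i.succ) =
          sgn K σ • dForm K fun i : Fin n => a i.succ := by
        have := (exteriorPower.ιMulti R n (M := Ω[R⁄K])).map_perm
          (fun i => KaehlerDifferential.D K R (a i.succ)) σ⁻¹
        rw [Equiv.Perm.sign_inv] at this
        refine this.trans ?_
        rw [sgn]
        exact (Int.cast_smul_eq_zsmul K _ _).symm
      rw [h3, smul_comm, smul_smul]
      have : sgn K σ * sgn K σ = 1 := by
        rw [sgn, ← Int.cast_mul, ← Units.val_mul, Int.units_mul_self]; simp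
      rw [smul_comm, this, one_smul]
      rfl
    rw [Finset.sum_congr rfl fun σ _ => h σ, Finset.sum_const, Finset.card_univ, Fintype.card_perm,
      Fintype.card_fin, Nat.cast_smul_eq_nsmul]

variable {R} {S : Type u} [CommRing S] [Algebra K S]

theorem formOfChain_chainMap (φ : R →ₐ[K] S) (n : ℕ) (x : HochschildChain K R n) :
    formOfChain K S n (chainMap K φ n x) = diffFormsMap K φ n (formOfChain K R n x) := by
  induction x using chain_induction with
  | hadd x y hx hy => simp only [map_add, hx, hy]
  | h a =>
    rw [formOfChain_tprod, diffFormsMap_smul_dForm, chainMap, PiTensorProduct.map_tprod,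
      formOfChain_tprod]
    rfl

end FormsOfChains

/-! ### Universal property of differential forms for multiderivations -/

section AlternatingDerivations

variable {K : Type v} [CommRing K] {R : Type u} [CommRing R] [Algebra K R]
  {N : Type*} [AddCommGroup N] [Module R N] [Module K N] [IsScalarTower K R N]

instance multilinearMap_isScalarTower {n : ℕ} :
    IsScalarTower K R (MultilinearMap R (fun _ : Fin n => Ω[R⁄K]) N) :=
  ⟨fun c r f => by ext v; exact smul_assoc c r (f v)⟩

/-- After currying, the difference is a linear map on `Ω` whose associated derivation vanishes by
induction, hence it is zero. -/
theorem multilinear_kaehler_ext {n : ℕ} {f g : MultilinearMap R (fun _ : Fin n => Ω[R⁄K]) N}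
    (h : ∀ a : Fin n → R, f (fun i => KaehlerDifferential.D K R (a i)) =
      g (fun i => KaehlerDifferential.D K R (a i))) : f = g := by
  induction n with
  | zero =>
    ext v
    rw [Subsingleton.elim v fun i => KaehlerDifferential.D K R (i.elim0)]
    exact h _
  | succ n ih =>
    have key : f.curryLeft = g.curryLeft := by
      rw [← sub_eq_zero]
      have hD : (f.curryLeft - g.curryLeft).compDer (KaehlerDifferential.D K R) =
          (0 : (Ω[R⁄K]) →ₗ[R] _).compDer (KaehlerDifferential.D K R) := by
        ext r : 1
        apply sub_eq_zero.mpr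
        refine ih fun a => ?_
        have h1 := h (Fin.cons r a)
        have h2 : (fun i : Fin (n + 1) => KaehlerDifferential.D K R (Fin.cons (α := fun _ => R) r a i)) =
            Fin.cons (α := fun _ => Ω[R⁄K]) (KaehlerDifferential.D K R r)
              (fun i => KaehlerDifferential.D K R (a i)) := by
          funext i
          refine Fin.cases rfl (fun _ => rfl) i
        rw [h2] at h1
        exact h1
      exact Derivation.liftKaehlerDifferential_unique _ _ hD
    exact (multilinearCurryLeftEquiv R (fun _ : Fin (n + 1) => Ω[R⁄K]) N).injective key

/-- With the first argument fixed, induction gives an extension in the other variables. Its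
uniqueness makes it additive and Leibniz in the first argument, that is, a derivation with values in
multilinear maps, which lifts to `Ω`. -/
theorem exists_multilinear_kaehler {n : ℕ} (m : MultilinearMap K (fun _ : Fin n => R) N)
    (hm : ∀ a i x y, m (Function.update a i (x * y)) =
      x • m (Function.update a i y) + y • m (Function.update a i x)) :
    ∃ M : MultilinearMap R (fun _ : Fin n => Ω[R⁄K]) N,
      ∀ a, M (fun i => KaehlerDifferential.D K R (a i)) = m a := by
  induction n with
  | zero =>
    refine ⟨MultilinearMap.constOfIsEmpty R _ (m 0), fun a => ?_⟩
    rw [MultilinearMap.constOfIsEmpty_apply, Subsingleton.elim a 0]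
    rfl
  | succ n ih =>
    have h1 : ∀ r : R, ∃ M : MultilinearMap R (fun _ : Fin n => Ω[R⁄K]) N,
        ∀ a, M (fun i => KaehlerDifferential.D K R (a i)) = m.curryLeft r a := by
      intro r
      refine ih _ fun a i x y => ?_
      simp only [MultilinearMap.curryLeft_apply, Fin.cons_update]
      exact hm _ _ _ _
    choose F hF using h1
    have hu : ∀ r (M : MultilinearMap R (fun _ : Fin n => Ω[R⁄K]) N),
        (∀ a, M (fun i => KaehlerDifferential.D K R (a i)) = m.curryLeft r a) → F r = M :=
      fun r M h => multilinear_kaehler_ext fun a => (hF r a).trans (h a).symm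
    let FL : R →ₗ[K] MultilinearMap R (fun _ : Fin n => Ω[R⁄K]) N :=
      { toFun := F
        map_add' := fun r s => hu _ _ fun a => by
          rw [add_apply, hF, hF, map_add, add_apply]
        map_smul' := fun c r => hu _ _ fun a => by
          rw [map_smul]
          exact congrArg (c • ·) (hF r a) }
    have hleib : ∀ x y, F (x * y) = x • F y + y • F x := fun x y => hu _ _ fun a => by
      rw [add_apply, smul_apply, smul_apply, hF, hF]
      simp only [MultilinearMap.curryLeft_apply]
      have := hm (Fin.cons 0 a) 0 x y
      simpa only [Fin.update_cons_zero] using this.symm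
    let δ : Derivation K R (MultilinearMap R (fun _ : Fin n => Ω[R⁄K]) N) :=
      Derivation.mk' FL hleib
    refine ⟨LinearMap.uncurryLeft δ.liftKaehlerDifferential, fun a => ?_⟩
    rw [LinearMap.uncurryLeft_apply, Derivation.liftKaehlerDifferential_comp_D]
    have := hF (a 0) (Fin.tail a)
    refine this.trans ?_
    rw [MultilinearMap.curryLeft_apply, Fin.cons_self_tail]

/-- Sign change under transpositions only yields `2 M(v) = 0` when two arguments coincide. The
absence of 2-torsion in `N` turns this into alternation. -/
theorem exists_linearMap_diffForms {n : ℕ} (h2 : ∀ x : N, x + x = 0 → x = 0)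
    (m : MultilinearMap K (fun _ : Fin n => R) N)
    (hm : ∀ a i x y, m (Function.update a i (x * y)) =
      x • m (Function.update a i y) + y • m (Function.update a i x))
    (halt : ∀ a i j, i ≠ j → m (a ∘ Equiv.swap i j) = - m a) :
    ∃ Ψ : DiffForms K R n →ₗ[R] N, ∀ a, Ψ (dForm K a) = m a := by
  obtain ⟨M, hM⟩ := exists_multilinear_kaehler m hm
  have hswap : ∀ v i j, i ≠ j → M (v ∘ Equiv.swap i j) = - M v := by
    intro v i j hij
    have : M.domDomCongr (Equiv.swap i j) = -M := by
      refine multilinear_kaehler_ext fun a => ?_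
      exact (hM (a ∘ Equiv.swap i j)).trans ((halt a i j hij).trans (congrArg Neg.neg (hM a).symm))
    exact congrArg (fun f => f v) this
  let ω : (Ω[R⁄K]) [⋀^Fin n]→ₗ[R] N :=
    { toMultilinearMap := M
      map_eq_zero_of_eq' := fun v i j hv hij => by
        apply h2
        have h1 := hswap v i j hij
        have h3 : v ∘ Equiv.swap i j = v := by
          funext k
          simp only [Function.comp_apply, Equiv.swap_apply_def]
          split_ifs with h h'
          · rw [h, hv]
          · rw [h', hv]
          · rfl
        rw [h3] at h1
        change M v + M v = 0
        nth_rewrite 1 [h1]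
        exact neg_add_cancel _ }
  refine ⟨exteriorPower.alternatingMapLinearEquiv ω, fun a => ?_⟩
  rw [dForm, exteriorPower.alternatingMapLinearEquiv_apply_ιMulti]
  exact hM a

end AlternatingDerivations

/-! ### Chains modulo boundaries as a module, and the comparison map -/

section HochschildForms

variable (K : Type v) [CommRing K] (R : Type u) [CommRing R] [Algebra K R]

/-- Multiplication by `r` in the factor `a₀` of Hochschild chains. -/
def coeffMul (n : ℕ) : R →ₐ[K] Module.End K (HochschildChain K R n) :=
  (Algebra.lmul K (HochschildChain K R n)).comp
    (PiTensorProduct.singleAlgHom (R := K) (A := fun _ : Fin (n + 1) => R) 0)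

theorem coeffMul_tprod {n : ℕ} (r : R) (a : Fin (n + 1) → R) :
    coeffMul K R n r (PiTensorProduct.tprod K a) =
      PiTensorProduct.tprod K (Fin.cons (r * a 0) fun i => a i.succ) := by
  change PiTensorProduct.singleAlgHom (R := K) (A := fun _ : Fin (n + 1) => R) 0 r *
    PiTensorProduct.tprod K a = _
  rw [PiTensorProduct.singleAlgHom_apply, PiTensorProduct.tprod_mul_tprod]
  congr 1
  funext i
  refine Fin.cases ?_ (fun i => ?_) i <;> simp

theorem tensorMap_coeffMul {n m : ℕ} (f : Fin (n + 1) → Fin (m + 1)) (hf : f 0 = 0) (r : R)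
    (x : HochschildChain K R n) :
    tensorMap K R f (coeffMul K R n r x) = coeffMul K R m r (tensorMap K R f x) := by
  induction x using chain_induction with
  | hadd x y hx hy => simp only [map_add, hx, hy]
  | h a =>
    rw [coeffMul_tprod, tensorMap_tprod, tensorMap_tprod, coeffMul_tprod]
    congr 1
    funext j
    refine Fin.cases ?_ (fun j => ?_) j
    · rw [Fin.cons_zero, ← Finset.mul_prod_erase _ _ (a := 0) (by simp [hf]),
        ← Finset.mul_prod_erase _ a (a := 0) (by simp [hf]), Fin.cons_zero, mul_assoc]
      congr 2
      refine Finset.prod_congr rfl fun i hi => ?_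
      obtain ⟨i, rfl⟩ := Fin.exists_succ_eq.mpr (Finset.ne_of_mem_erase hi)
      rw [Fin.cons_succ]
    · rw [Fin.cons_succ]
      refine Finset.prod_congr rfl fun i hi => ?_
      have h0 : i ≠ 0 := by
        rintro rfl
        simp only [Finset.mem_filter, Finset.mem_univ, true_and, hf] at hi
        exact Fin.succ_ne_zero _ hi.symm
      obtain ⟨i, rfl⟩ := Fin.exists_succ_eq.mpr h0
      rw [Fin.cons_succ]

theorem circleFace_zero (n : ℕ) (i : Fin (n + 2)) : circleFace n i 0 = 0 := by
  simp [circleFace]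

/-- Every circle face fixes the base point `0`, so the differential is linear in the coefficient
`a₀`. Hence chains modulo boundaries form an `R`-module, the target for the universal property of
forms. -/
theorem hochschildB_coeffMul (n : ℕ) (r : R) (x : HochschildChain K R (n + 1)) :
    hochschildB K R n (coeffMul K R (n + 1) r x) = coeffMul K R n r (hochschildB K R n x) := by
  rw [hochschildB, LinearMap.sum_apply, LinearMap.sum_apply, map_sum]
  refine Finset.sum_congr rfl fun i _ => ?_
  rw [LinearMap.smul_apply, LinearMap.smul_apply, map_smul,
    tensorMap_coeffMul K R _ (circleFace_zero n i)]

theorem antisymm_coeffMul (n : ℕ) (r : R) (x : HochschildChain K R n) :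
    antisymm K R n (coeffMul K R n r x) = coeffMul K R n r (antisymm K R n x) := by
  rw [antisymm, LinearMap.sum_apply, LinearMap.sum_apply, map_sum]
  refine Finset.sum_congr rfl fun i _ => ?_
  rw [LinearMap.smul_apply, LinearMap.smul_apply, map_smul, tensorMap_coeffMul K R _ rfl]

/-- Hochschild chains modulo boundaries. -/
def ChainQuot (n : ℕ) : Type (max u v) := HochschildChain K R n ⧸ hochschildBoundaries K R n

instance (n : ℕ) : AddCommGroup (ChainQuot K R n) :=
  inferInstanceAs (AddCommGroup (HochschildChain K R n ⧸ hochschildBoundaries K R n))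

instance (n : ℕ) : Module K (ChainQuot K R n) :=
  inferInstanceAs (Module K (HochschildChain K R n ⧸ hochschildBoundaries K R n))

/-- The class of a chain modulo boundaries. -/
def chainClass (n : ℕ) : HochschildChain K R n →ₗ[K] ChainQuot K R n :=
  (hochschildBoundaries K R n).mkQ

theorem chainClass_eq_zero {n : ℕ} {x : HochschildChain K R n} :
    chainClass K R n x = 0 ↔ x ∈ hochschildBoundaries K R n :=
  Submodule.Quotient.mk_eq_zero _

theorem chainClass_surjective (n : ℕ) : Function.Surjective (chainClass K R n) :=
  Submodule.Quotient.mk_surjective _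

/-- The action of `R` on chains modulo boundaries. -/
def chainQuotAction (n : ℕ) (r : R) : ChainQuot K R n →ₗ[K] ChainQuot K R n :=
  Submodule.mapQ _ _ (coeffMul K R n r) (by
    rintro _ ⟨y, rfl⟩
    exact ⟨coeffMul K R (n + 1) r y, hochschildB_coeffMul K R n r y⟩)

instance (n : ℕ) : Module R (ChainQuot K R n) where
  smul r x := chainQuotAction K R n r x
  one_smul x := by
    obtain ⟨x, rfl⟩ := chainClass_surjective K R n x
    exact congrArg (chainClass K R n) (LinearMap.congr_fun (map_one (coeffMul K R n)) x)
  mul_smul r s x := by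
    obtain ⟨x, rfl⟩ := chainClass_surjective K R n x
    exact congrArg (chainClass K R n) (LinearMap.congr_fun (map_mul (coeffMul K R n) r s) x)
  smul_zero r := map_zero (chainQuotAction K R n r)
  smul_add r := map_add (chainQuotAction K R n r)
  add_smul r s x := by
    obtain ⟨x, rfl⟩ := chainClass_surjective K R n x
    exact congrArg (chainClass K R n) (LinearMap.congr_fun (map_add (coeffMul K R n) r s) x)
  zero_smul x := by
    obtain ⟨x, rfl⟩ := chainClass_surjective K R n x
    exact congrArg (chainClass K R n) (LinearMap.congr_fun (map_zero (coeffMul K R n)) x)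

theorem smul_chainClass {n : ℕ} (r : R) (x : HochschildChain K R n) :
    r • chainClass K R n x = chainClass K R n (coeffMul K R n r x) := rfl

instance (n : ℕ) : IsScalarTower K R (ChainQuot K R n) := ⟨fun c r x => by
  obtain ⟨x, rfl⟩ := chainClass_surjective K R n x
  exact congrArg (chainClass K R n) (LinearMap.congr_fun (map_smul (coeffMul K R n) c r) x)⟩

/-- `(a₁, …, aₙ) ↦ [∑ sgn(σ) 1 ⊗ a_{σ 1} ⊗ ⋯ ⊗ a_{σ n}]`. -/
def antisymmMulti (n : ℕ) : MultilinearMap K (fun _ : Fin n => R) (ChainQuot K R n) :=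
  (chainClass K R n ∘ₗ antisymm K R n).compMultilinearMap
    (MultilinearMap.curryLeft (PiTensorProduct.tprod K : MultilinearMap K (fun _ : Fin (n + 1) => R)
      (HochschildChain K R n)) 1)

variable {R}

theorem antisymmMulti_apply {n : ℕ} (a : Fin n → R) : antisymmMulti K R n a =
    chainClass K R n (antisymm K R n (PiTensorProduct.tprod K (Fin.cons 1 a))) := rfl

theorem smul_antisymmMulti {n : ℕ} (r : R) (a : Fin n → R) : r • antisymmMulti K R n a =
    chainClass K R n (antisymm K R n (PiTensorProduct.tprod K (Fin.cons r a))) := by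
  rw [antisymmMulti_apply, smul_chainClass, ← antisymm_coeffMul, coeffMul_tprod]
  simp

theorem tensorMap_permMap_cons {n : ℕ} (σ : Equiv.Perm (Fin n)) (r : R) (a : Fin n → R) :
    tensorMap K R (permMap σ) (PiTensorProduct.tprod K (Fin.cons r a)) =
      PiTensorProduct.tprod K (Fin.cons r (a ∘ σ.symm)) := by
  rw [tensorMap_tprod]
  congr 1
  funext j
  refine Fin.cases ?_ (fun j => ?_) j
  · rw [Finset.prod_eq_single 0]
    · rfl
    · intro b hb hne
      obtain ⟨i, rfl⟩ := Fin.exists_succ_eq.mpr hne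
      simp only [Finset.mem_filter, Finset.mem_univ, true_and] at hb
      exact absurd hb (Fin.succ_ne_zero _)
    · simp
  · rw [Finset.prod_eq_single (σ.symm j).succ]
    · rfl
    · intro b hb hne
      simp only [Finset.mem_filter, Finset.mem_univ, true_and] at hb
      revert hb hne
      refine Fin.cases ?_ (fun i => ?_) b
      · intro _ h; exact absurd h.symm (Fin.succ_ne_zero _)
      · intro hne h
        have h' : σ i = j := Fin.succ_injective _ h
        exact absurd (by rw [← h', Equiv.symm_apply_apply]) hne
    · intro h
      refine absurd ?_ h
      simp only [Finset.mem_filter, Finset.mem_univ, true_and]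
      change (σ (σ.symm j)).succ = _
      rw [Equiv.apply_symm_apply]

theorem antisymmMulti_swap {n : ℕ} (a : Fin n → R) (i j : Fin n) (hij : i ≠ j) :
    antisymmMulti K R n (a ∘ Equiv.swap i j) = - antisymmMulti K R n a := by
  rw [antisymmMulti_apply, antisymmMulti_apply, ← map_neg]
  congr 1
  have h := LinearMap.congr_fun (antisymm_comp_permMap K R (Equiv.swap i j))
    (PiTensorProduct.tprod K (Fin.cons 1 a))
  rw [LinearMap.smul_apply, LinearMap.comp_apply, tensorMap_permMap_cons, Equiv.symm_swap, sgn,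
    Equiv.Perm.sign_swap hij] at h
  rw [← h]
  simp

/-- This is the relation of `antisymm_comp_face_mem` evaluated on `1 ⊗ x ⊗ y ⊗ c`, read modulo
boundaries. -/
theorem antisymmMulti_leibniz_zero {n : ℕ} (x y : R) (c : Fin n → R) :
    antisymmMulti K R (n + 1) (Fin.cons (x * y) c) =
      x • antisymmMulti K R (n + 1) (Fin.cons y c) +
        y • antisymmMulti K R (n + 1) (Fin.cons x c) := by
  have h := antisymm_comp_face_mem K R n
    (PiTensorProduct.tprod K (Fin.cons 1 (Fin.cons x (Fin.cons y c))))
  rw [← chainClass_eq_zero, LinearMap.sub_apply, LinearMap.add_apply, ← tensorMap_comp,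
    LinearMap.comp_apply, tensorMap_permMap_cons, map_sub, map_sub, sub_eq_zero] at h
  rw [antisymmMulti_apply, smul_antisymmMulti, smul_antisymmMulti]
  have e1 : ∀ r s t : R, tensorMap K R (circleFace (n + 1) 0) (PiTensorProduct.tprod K
      (Fin.cons r (Fin.cons s (Fin.cons t c)) : Fin (n + 3) → R)) =
      PiTensorProduct.tprod K (Fin.cons (r * s) (Fin.cons t c)) := by
    intro r s t
    refine (tensorMap_face_tprod K R _ (Fin.succ 0) (circleFace_succAbove (n + 1) 0) _).trans ?_
    congr 1
    funext j
    refine Fin.cases ?_ (fun j => ?_) j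
    · change (if circleFace (n + 1) 0 (Fin.succ 0) = _ then _ else _) * _ = _
      rw [show circleFace (n + 1) 0 (Fin.succ 0) = 0 from circleFace_castSucc_succ (n + 1) 0]
      simp [mul_comm]
    · change (if circleFace (n + 1) 0 (Fin.succ 0) = _ then _ else _) * _ = _
      rw [show circleFace (n + 1) 0 (Fin.succ 0) = 0 from circleFace_castSucc_succ (n + 1) 0]
      rw [if_neg (Fin.succ_ne_zero _).symm, one_mul, Fin.succ_succAbove_succ]
      simp
  have e2 : tensorMap K R (circleFace (n + 1) 1) (PiTensorProduct.tprod K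
      (Fin.cons 1 (Fin.cons x (Fin.cons y c)) : Fin (n + 3) → R)) =
      PiTensorProduct.tprod K (Fin.cons 1 (Fin.cons (x * y) c)) := by
    refine (tensorMap_face_tprod K R _ (Fin.succ 1) (circleFace_succAbove (n + 1) 1) _).trans ?_
    congr 1
    have hf : circleFace (n + 1) 1 (Fin.succ 1) = 1 := circleFace_castSucc_succ (n + 1) 1
    funext j
    change (if circleFace (n + 1) 1 (Fin.succ 1) = j then _ else _) * _ = _
    rw [hf]
    refine Fin.cases ?_ (fun j => ?_) j
    · rw [if_neg (by simp), one_mul]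
      rfl
    · rw [Fin.succ_succAbove_succ]
      refine Fin.cases ?_ (fun j => ?_) j
      · rw [if_pos Fin.succ_zero_eq_one.symm]
        exact mul_comm y x
      · rw [if_neg (by simp [Fin.ext_iff]), one_mul]
        rfl
  have e3 : (Fin.cons x (Fin.cons y c) : Fin (n + 2) → R) ∘ (Equiv.swap 0 1).symm =
      Fin.cons y (Fin.cons x c) := by
    funext j
    rw [Equiv.symm_swap]
    refine Fin.cases ?_ (fun j => ?_) j
    · simp
    · refine Fin.cases ?_ (fun j => ?_) j
      · simp
      · rw [Function.comp_apply, Equiv.swap_apply_of_ne_of_ne (Fin.succ_ne_zero _) (by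
          simp [Fin.ext_iff])]
        simp
  rw [e3, e1, e1, e2, one_mul, one_mul, map_add, map_add] at h
  exact h.symm

theorem update_comp_swap {n : ℕ} {T : Type*} (a : Fin (n + 1) → T) (i : Fin (n + 1)) (z : T) :
    Function.update a i z ∘ Equiv.swap 0 i =
      Fin.cons z fun k : Fin n => a (Equiv.swap 0 i k.succ) := by
  funext k
  refine Fin.cases ?_ (fun k => ?_) k
  · simp
  · rw [Function.comp_apply, Function.update_of_ne, Fin.cons_succ]
    intro h
    have := (Equiv.swap 0 i).injective (h.trans (Equiv.swap_apply_left 0 i).symm)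
    exact Fin.succ_ne_zero _ this

/-- Transposing the `i`-th argument to the front changes all three terms by the same sign, which
reduces to the first slot. -/
theorem antisymmMulti_leibniz {n : ℕ} (a : Fin n → R) (i : Fin n) (x y : R) :
    antisymmMulti K R n (Function.update a i (x * y)) =
      x • antisymmMulti K R n (Function.update a i y) +
        y • antisymmMulti K R n (Function.update a i x) := by
  cases n with
  | zero => exact i.elim0
  | succ n =>
    have h := antisymmMulti_leibniz_zero K x y fun k : Fin n => a (Equiv.swap 0 i k.succ)
    rw [← update_comp_swap, ← update_comp_swap, ← update_comp_swap] at h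
    rcases eq_or_ne 0 i with rfl | hi
    · simpa only [Equiv.swap_self, Equiv.coe_refl, Function.comp_id] using h
    · rw [antisymmMulti_swap K _ _ _ hi, antisymmMulti_swap K _ _ _ hi,
        antisymmMulti_swap K _ _ _ hi, smul_neg, smul_neg, ← neg_add, neg_inj] at h
      exact h

variable (R)

theorem formOfChain_surjective (n : ℕ) : Function.Surjective (formOfChain K R n) := by
  have h : (QuotientAddGroup.mk' (formOfChain K R n).range.toAddSubgroup : DiffForms K R n →+ _) =
      0 := diffForms_ext K R fun r a => by
    rw [AddMonoidHom.zero_apply, QuotientAddGroup.mk'_apply, QuotientAddGroup.eq_zero_iff]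
    refine ⟨PiTensorProduct.tprod K (Fin.cons r a), ?_⟩
    rw [formOfChain_tprod]
    simp
  intro x
  have := DFunLike.congr_fun h x
  rw [AddMonoidHom.zero_apply, QuotientAddGroup.mk'_apply, QuotientAddGroup.eq_zero_iff] at this
  exact this

theorem antisymm_mem_weightCycles (n : ℕ) (x : HochschildChain K R n) :
    antisymm K R n x ∈ weightCycles K R n n := by
  rw [weightCycles, Submodule.mem_inf, Submodule.mem_iInf]
  constructor
  · cases n with
    | zero => exact Submodule.mem_top
    | succ n => exact LinearMap.congr_fun (hochschildB_comp_antisymm K R n) x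
  · intro m
    rw [Submodule.mem_comap, LinearMap.sub_apply, ← LinearMap.comp_apply, adamsPsi_comp_antisymm]
    simp

/-- The comparison map from the top weight part of Hochschild homology to differential forms. -/
def hodgeHHToForms (n : ℕ) : HodgeHH K R n n →ₗ[K] DiffForms K R n :=
  Submodule.liftQ _ (formOfChain K R n ∘ₗ (weightCycles K R n n).subtype) (by
    rintro x ⟨y, hy⟩
    change formOfChain K R n x.1 = 0
    have : x.1 = hochschildB K R n y := hy.symm
    rw [this, formOfChain_hochschildB])

end HochschildForms

/-! ### The isomorphism of the top weight part with forms -/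

section CharZero

variable (K : Type v) [Field K] [CharZero K] (R : Type u) [CommRing R] [Algebra K R]

variable {R} in
-- The universal property of forms applies to the antisymmetrized multilinear map. It gives a linear
-- map from forms to chains modulo boundaries through which antisymmetrization factors.
theorem antisymm_mem_boundaries_of_formOfChain_eq_zero {n : ℕ} {x : HochschildChain K R n}
    (hx : formOfChain K R n x = 0) : antisymm K R n x ∈ hochschildBoundaries K R n := by
  obtain ⟨Ψ, hΨ⟩ := exists_linearMap_diffForms
    (fun x hx => by
      rw [← two_smul K] at hx
      exact (smul_eq_zero.mp hx).resolve_left two_ne_zero)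
    (antisymmMulti K R n) (antisymmMulti_leibniz K) (antisymmMulti_swap K)
  have key : ∀ x, Ψ (formOfChain K R n x) = chainClass K R n (antisymm K R n x) := by
    intro x
    induction x using chain_induction with
    | hadd x y hx hy => simp only [map_add, hx, hy]
    | h a =>
      rw [formOfChain_tprod, map_smul, hΨ, smul_antisymmMulti]
      congr 3
      exact Fin.cons_self_tail a
  rw [← chainClass_eq_zero, ← key, hx, map_zero]

/-- Antisymmetrization divided by `n!` provides the inverse. If a weight `n` cycle maps to the zero
form, its antisymmetrization is a boundary, and that is congruent to `n!` times the cycle. -/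
theorem hodgeHHToForms_bijective (n : ℕ) : Function.Bijective (hodgeHHToForms K R n) := by
  have hn : (n.factorial : K) ≠ 0 := Nat.cast_ne_zero.mpr n.factorial_ne_zero
  constructor
  · rw [injective_iff_map_eq_zero]
    intro x hx
    obtain ⟨x, rfl⟩ := Submodule.Quotient.mk_surjective _ x
    have h1 := antisymm_mem_boundaries_of_formOfChain_eq_zero K (x := x.1) hx
    have h2 := Submodule.sub_mem _ h1 (antisymm_sub_mem_boundaries K R x.2)
    rw [sub_sub_cancel] at h2
    rw [Submodule.Quotient.mk_eq_zero]
    exact (Submodule.smul_mem_iff _ hn).mp h2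
  · intro y
    obtain ⟨x, rfl⟩ := formOfChain_surjective K R n y
    refine ⟨Submodule.Quotient.mk ((n.factorial : K)⁻¹ • ⟨_, antisymm_mem_weightCycles K R n x⟩), ?_⟩
    change formOfChain K R n ((n.factorial : K)⁻¹ • antisymm K R n x) = _
    rw [map_smul, formOfChain_antisymm, smul_smul, inv_mul_cancel₀ hn, one_smul]

end CharZero

/-- `HH_p^{(p)}` is isomorphic to `Ω^p`, naturally in the algebra. -/
def hodgeHHIso (K : Type) [Field K] [CharZero K] (p : ℕ) :
    hodgeHHFunctor.{u} K p p ≅ diffFormsFunctor.{u} K p :=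
  NatIso.ofComponents (fun R => AddEquiv.toAddCommGrpIso
    (AddEquiv.ofBijective (hodgeHHToForms K R p) (hodgeHHToForms_bijective K R p)))
    fun {R S} φ => by
      ext x
      obtain ⟨x, rfl⟩ := Submodule.Quotient.mk_surjective _ x
      exact formOfChain_chainMap K φ.hom p x.1

/-! ### Vanishing of right derived functors by dimension shifting -/

section DimensionShift

universe v₁ u₁ w

variable {C : Type u₁} [Category.{v₁} C] [Abelian C]

/-- The monomorphism from an object to the first term of an injective resolution. -/
def resIota {Z : C} (J : InjectiveResolution Z) : Z ⟶ J.cocomplex.X 0 := J.ι.f 0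

instance {Z : C} (J : InjectiveResolution Z) : Mono (resIota J) := inferInstanceAs (Mono (J.ι.f 0))

@[simp]
theorem resIota_comp_d {Z : C} (J : InjectiveResolution Z) : resIota J ≫ J.cocomplex.d 0 1 = 0 :=
  J.ι_f_zero_comp_complex_d

theorem exact_resIota {Z : C} (J : InjectiveResolution Z) :
    (ShortComplex.mk _ _ (resIota_comp_d J)).Exact := J.exact₀

theorem comp_resIota (S : ShortComplex C) (J : InjectiveResolution S.X₃) :
    S.f ≫ S.g ≫ resIota J = 0 := by
  rw [S.zero_assoc, zero_comp]

/-- Splicing a monomorphism into an injective object with an injective resolution of the quotient. -/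
def spliceResolution {S : ShortComplex C} (hS : S.ShortExact) [hI : Injective S.X₂]
    (J : InjectiveResolution S.X₃) : InjectiveResolution S.X₁ where
  cocomplex := CochainComplex.augment J.cocomplex (S.g ≫ resIota J) (by
    rw [Category.assoc, resIota_comp_d, comp_zero])
  injective n := by
    cases n with
    | zero => exact hI
    | succ n => exact J.injective n
  ι := (CochainComplex.fromSingle₀Equiv _ _).symm ⟨S.f, by
    rw [CochainComplex.augment_d_zero_one]
    exact comp_resIota S J⟩
  quasiIso := ⟨fun n => by
    have := hS.mono_f
    have := hS.epi_g
    rcases n with _ | _ | n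
    · rw [CochainComplex.quasiIsoAt₀_iff, ShortComplex.quasiIso_iff_of_zeros]
      -- In degree zero, composing `S.g` with a monomorphism does not change its kernel.
      · have e : (ShortComplex.mk S.f (S.g ≫ resIota J)
            (by rw [S.zero_assoc, zero_comp])).Exact ∧ Mono S.f := by
          refine ⟨?_, hS.mono_f⟩
          let α : S ⟶ ShortComplex.mk S.f (S.g ≫ resIota J) (by rw [S.zero_assoc, zero_comp]) :=
            { τ₁ := 𝟙 _
              τ₂ := 𝟙 _
              τ₃ := resIota J }
          have : Mono α.τ₃ := inferInstanceAs (Mono (resIota J))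
          rw [← ShortComplex.exact_iff_of_epi_of_isIso_of_mono α]
          exact hS.exact
        refine (ShortComplex.exact_and_mono_f_iff_of_iso ?_).2 e
        exact ShortComplex.isoMk (Iso.refl _) (Iso.refl _) (Iso.refl _)
          (by
            refine (Category.id_comp _).trans (Eq.trans ?_ (Category.comp_id _).symm)
            exact (CochainComplex.fromSingle₀Equiv_symm_apply_f_zero (C :=
              CochainComplex.augment J.cocomplex (S.g ≫ resIota J) (by simp)) S.f (by
                rw [CochainComplex.augment_d_zero_one]
                exact comp_resIota S J)).symm)
          ((Category.id_comp _).trans (Category.comp_id _).symm)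
      all_goals rfl
    · rw [quasiIsoAt_iff_exactAt _ _ (CochainComplex.exactAt_succ_single_obj _ _),
        HomologicalComplex.exactAt_iff' _ 0 1 2 (by simp) (by simp)]
      -- In degree one, precomposing with the epimorphism `S.g` does not change the image.
      have e := exact_resIota J
      let α : ShortComplex.mk (S.g ≫ resIota J) (J.cocomplex.d 0 1) (by simp) ⟶
          ShortComplex.mk _ _ (resIota_comp_d J) :=
        { τ₁ := S.g
          τ₂ := 𝟙 _
          τ₃ := 𝟙 _ }
      have : Epi α.τ₁ := inferInstanceAs (Epi S.g)
      exact (ShortComplex.exact_iff_of_epi_of_isIso_of_mono α).mpr e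
    · rw [quasiIsoAt_iff_exactAt _ _ (CochainComplex.exactAt_succ_single_obj _ _),
        HomologicalComplex.exactAt_iff' _ (n + 1) (n + 2) (n + 3) (by simp) (by simp)]
      exact J.exact_succ n⟩

variable (T : C ⥤ AddCommGrpCat.{w})

theorem map_comp_apply {F G H : C} (f : F ⟶ G) (g : G ⟶ H) (x : T.obj F) :
    T.map (f ≫ g) x = T.map g (T.map f x) := by
  rw [T.map_comp]; rfl

variable [T.Additive]

theorem map_apply_eq_zero {F G H : C} (f : F ⟶ G) (g : G ⟶ H) (h : f ≫ g = 0) (x : T.obj F) :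
    T.map g (T.map f x) = 0 := by
  rw [← map_comp_apply, h, T.map_zero]; rfl

section LeftExact

variable [PreservesFiniteLimits T]

theorem map_exact_of_mono {S : ShortComplex C} (hS : S.Exact) [Mono S.f] :
    (S.map T).Exact := hS.map_of_mono_of_preservesKernel T inferInstance inferInstance

theorem exists_of_map_eq_zero {S : ShortComplex C} (hS : S.Exact) [Mono S.f] (x : T.obj S.X₂)
    (hx : T.map S.g x = 0) : ∃ y, T.map S.f y = x :=
  (ShortComplex.ab_exact_iff _).mp (map_exact_of_mono T hS) x hx

theorem map_injective_of_mono {F G : C} (f : F ⟶ G) [Mono f] : Function.Injective (T.map f) :=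
  (AddCommGrpCat.mono_iff_injective _).mp inferInstance

end LeftExact

variable [EnoughInjectives C]

/-- The vanishing of the `i`-th right derived functor. -/
def RZero (i : ℕ) (F : C) : Prop := IsZero ((T.rightDerived i).obj F)

theorem RZero.of_iso {i : ℕ} {F G : C} (e : F ≅ G) (h : RZero T i F) : RZero T i G :=
  IsZero.of_iso h ((T.rightDerived i).mapIso e.symm)

theorem RZero.of_retract {i : ℕ} {F G : C} (s : F ⟶ G) (r : G ⟶ F) (hsr : s ≫ r = 𝟙 F)
    (h : RZero T i G) : RZero T i F := by
  rw [RZero, IsZero.iff_id_eq_zero]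
  have := h.eq_of_src ((T.rightDerived i).map r) 0
  rw [← (T.rightDerived i).map_id, ← hsr, Functor.map_comp, this, comp_zero]

theorem rZero_iff_exact {F : C} (J : InjectiveResolution F) (i : ℕ) :
    RZero T (i + 1) F ↔ (ShortComplex.mk (T.map (J.cocomplex.d i (i + 1)))
      (T.map (J.cocomplex.d (i + 1) (i + 2)))
        (by rw [← T.map_comp, J.complex_d_comp, T.map_zero])).Exact := by
  rw [RZero, (J.isoRightDerivedObj T (i + 1)).isZero_iff]
  refine Iff.trans ?_ (HomologicalComplex.exactAt_iff' ((T.mapHomologicalComplex _).obj J.cocomplex)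
    i (i + 1) (i + 2) (by simp) (by simp))
  exact (HomologicalComplex.exactAt_iff_isZero_homology _ _).symm

/-- With the spliced resolution of `S.X₁`, both sides are exactness of the same short complex at the
same place, up to the shift of index. -/
theorem rZero_succ_succ_iff {S : ShortComplex C} (hS : S.ShortExact) [Injective S.X₂] (i : ℕ) :
    RZero T (i + 2) S.X₁ ↔ RZero T (i + 1) S.X₃ := by
  let J : InjectiveResolution S.X₃ := InjectiveResolution.of _
  rw [rZero_iff_exact T J, rZero_iff_exact T (spliceResolution hS J)]
  rfl

variable [PreservesFiniteLimits T]

theorem rZero_zero_iff (F : C) : RZero T 0 F ↔ IsZero (T.obj F) :=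
  (T.rightDerivedZeroIsoSelf.app F).isZero_iff

/-- Left exactness identifies the kernel of `T(d⁰)` on a resolution of `S.X₃` with `T(S.X₃)`. The
first cohomology of the spliced resolution is then the cokernel of `T(S.g)`. -/
theorem rZero_one_iff {S : ShortComplex C} (hS : S.ShortExact) [Injective S.X₂] :
    RZero T 1 S.X₁ ↔ Function.Surjective (T.map S.g) := by
  let J : InjectiveResolution S.X₃ := InjectiveResolution.of _
  rw [rZero_iff_exact T (spliceResolution hS J), ShortComplex.ab_exact_iff]
  have hJ := exists_of_map_eq_zero T (exact_resIota J)
  have hd : ∀ y : T.obj S.X₃, T.map (J.cocomplex.d 0 1) (T.map (resIota J) y) = 0 :=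
    map_apply_eq_zero T _ _ (resIota_comp_d J)
  have hc := map_comp_apply T S.g (resIota J)
  constructor
  · intro h y
    obtain ⟨x, hx⟩ := h (T.map (resIota J) y) (hd y)
    exact ⟨x, map_injective_of_mono T (resIota J) ((hc x).symm.trans hx)⟩
  · intro h x hx
    obtain ⟨y, rfl⟩ := hJ x hx
    obtain ⟨z, rfl⟩ := h y
    exact ⟨z, hc z⟩

end DimensionShift

/-! ### Vanishing consequences of the long exact sequence -/

section LongExact

universe v₁ u₁ w

variable {C : Type u₁} [Category.{v₁} C] [Abelian C] [EnoughInjectives C]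

/-- One step of a simultaneous injective resolution of a short exact sequence
`0 ⟶ F ⟶ G ⟶ H ⟶ 0`. -/
structure HorseshoeStep (S : ShortComplex C) where
  /-- the sequence of quotients -/
  Q : ShortComplex C
  shortExact : Q.ShortExact
  /-- the injective object receiving the subobject -/
  I : C
  /-- the injective object receiving the quotient object -/
  K : C
  [injI : Injective I]
  [injK : Injective K]
  i : S.X₁ ⟶ I
  j : S.X₂ ⟶ I ⊞ K
  k : S.X₃ ⟶ K
  p : I ⟶ Q.X₁
  q : I ⊞ K ⟶ Q.X₂
  r : K ⟶ Q.X₃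
  ip : i ≫ p = 0
  jq : j ≫ q = 0
  kr : k ≫ r = 0
  exI : (ShortComplex.mk i p ip).ShortExact
  exG : (ShortComplex.mk j q jq).ShortExact
  exK : (ShortComplex.mk k r kr).ShortExact
  comm₁ : S.f ≫ j = i ≫ biprod.inl
  comm₂ : S.g ≫ k = j ≫ biprod.snd
  comm₃ : biprod.inl ≫ q = p ≫ Q.f
  comm₄ : q ≫ Q.g = biprod.snd ≫ r

theorem shortExact_cokernel {F G : C} (i : F ⟶ G) [Mono i] :
    (ShortComplex.mk i (cokernel.π i) (cokernel.condition i)).ShortExact where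
  exact := ShortComplex.exact_of_g_is_cokernel _ (cokernelIsCokernel i)
  mono_f := inferInstance
  epi_g := inferInstanceAs (Epi (cokernel.π i))

/-- The outer terms are embedded into injectives, and the map on the subobject is extended to the
middle by injectivity, giving an embedding into the biproduct. The snake lemma makes the cokernels
short exact: the kernel of the right column is zero, so the connecting map vanishes. -/
theorem exists_horseshoeStep {S : ShortComplex C} (hS : S.ShortExact) :
    Nonempty (HorseshoeStep S) := by
  have := hS.mono_f
  have := hS.epi_g
  let i : S.X₁ ⟶ Injective.under S.X₁ := Injective.ι S.X₁
  let k : S.X₃ ⟶ Injective.under S.X₃ := Injective.ι S.X₃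
  let u : S.X₂ ⟶ Injective.under S.X₁ := Injective.factorThru i S.f
  have hu : S.f ≫ u = i := Injective.comp_factorThru i S.f
  let j : S.X₂ ⟶ Injective.under S.X₁ ⊞ Injective.under S.X₃ := biprod.lift u (S.g ≫ k)
  have c1 : S.f ≫ j = i ≫ biprod.inl := by
    ext <;> simp [j, hu]
  have c2 : S.g ≫ k = j ≫ biprod.snd := by simp [j]
  have hj : Mono j := by
    refine Preadditive.mono_of_cancel_zero _ fun {P} x hx => ?_
    have h1 : x ≫ S.g = 0 := by
      have : (x ≫ j) ≫ biprod.snd = 0 := by rw [hx, zero_comp]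
      rw [Category.assoc, ← c2, ← Category.assoc] at this
      exact zero_of_comp_mono k this
    have h2 : hS.exact.lift x h1 ≫ S.f = x := hS.exact.lift_f x h1
    have h3 : hS.exact.lift x h1 = 0 := by
      apply zero_of_comp_mono i
      rw [← hu, ← Category.assoc, h2]
      have : (x ≫ j) ≫ biprod.fst = 0 := by rw [hx, zero_comp]
      simpa [j] using this
    rw [← h2, h3, zero_comp]
  let L₂ : ShortComplex C := ShortComplex.mk (biprod.inl : Injective.under S.X₁ ⟶ _ ⊞ Injective.under S.X₃)
    biprod.snd biprod.inl_snd
  have hL₂ : L₂.ShortExact := (ShortComplex.Splitting.ofHasBinaryBiproduct _ _).shortExact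
  let φ : S ⟶ L₂ := { τ₁ := i, τ₂ := j, τ₃ := k, comm₁₂ := c1.symm, comm₂₃ := c2.symm }
  let N : ShortComplex.SnakeInput C :=
    { L₀ := kernel φ
      L₁ := S
      L₂ := L₂
      L₃ := cokernel φ
      v₀₁ := kernel.ι φ
      v₁₂ := φ
      v₂₃ := cokernel.π φ
      w₀₂ := kernel.condition φ
      w₁₃ := cokernel.condition φ
      h₀ := kernelIsKernel φ
      h₃ := cokernelIsCokernel φ
      L₁_exact := hS.exact
      epi_L₁_g := hS.epi_g
      L₂_exact := hL₂.exact
      mono_L₂_f := hL₂.mono_f }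
  have e₂ : Epi N.L₂.g := hL₂.epi_g
  have hv : Mono N.v₀₁.τ₃ := N.mono_v₀₁_τ₃
  have hq : Epi N.L₃.g := N.epi_L₃_g
  have h0 : N.v₀₁.τ₃ = 0 := zero_of_comp_mono k N.w₀₂_τ₃
  have hδ : N.δ = 0 := by
    refine IsZero.eq_of_src ?_ _ _
    rw [IsZero.iff_id_eq_zero, ← cancel_mono N.v₀₁.τ₃, h0, comp_zero, comp_zero]
  have hm : Mono N.L₃.f := (ShortComplex.exact_iff_mono _ hδ).mp N.L₂'_exact
  exact ⟨{
    Q := N.L₃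
    shortExact := { exact := N.L₃_exact, mono_f := hm, epi_g := hq }
    I := Injective.under S.X₁
    K := Injective.under S.X₃
    i := i
    j := j
    k := k
    p := N.v₂₃.τ₁
    q := N.v₂₃.τ₂
    r := N.v₂₃.τ₃
    ip := N.w₁₃_τ₁
    jq := N.w₁₃_τ₂
    kr := N.w₁₃_τ₃
    exI := { exact := N.exact_C₁_down, mono_f := inferInstanceAs (Mono i), epi_g := N.epi_v₂₃_τ₁ }
    exG := { exact := N.exact_C₂_down, mono_f := hj, epi_g := N.epi_v₂₃_τ₂ }
    exK := { exact := N.exact_C₃_down, mono_f := inferInstanceAs (Mono k), epi_g := N.epi_v₂₃_τ₃ }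
    comm₁ := c1
    comm₂ := c2
    comm₃ := N.v₂₃.comm₁₂.symm
    comm₄ := N.v₂₃.comm₂₃ }⟩

variable (T : C ⥤ AddCommGrpCat.{w}) [T.Additive] [PreservesFiniteLimits T]

theorem HorseshoeStep.rZero_succ_succ₁ {S : ShortComplex C} (D : HorseshoeStep S) (i : ℕ) :
    RZero T (i + 2) S.X₁ ↔ RZero T (i + 1) D.Q.X₁ :=
  have := D.injI
  rZero_succ_succ_iff T D.exI i

theorem HorseshoeStep.rZero_succ_succ₂ {S : ShortComplex C} (D : HorseshoeStep S) (i : ℕ) :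
    RZero T (i + 2) S.X₂ ↔ RZero T (i + 1) D.Q.X₂ :=
  have := D.injI
  have := D.injK
  have : Injective (ShortComplex.mk D.j D.q D.jq).X₂ := inferInstanceAs (Injective (D.I ⊞ D.K))
  rZero_succ_succ_iff T D.exG i

theorem HorseshoeStep.rZero_succ_succ₃ {S : ShortComplex C} (D : HorseshoeStep S) (i : ℕ) :
    RZero T (i + 2) S.X₃ ↔ RZero T (i + 1) D.Q.X₃ :=
  have := D.injK
  rZero_succ_succ_iff T D.exK i

theorem HorseshoeStep.rZero_one₁ {S : ShortComplex C} (D : HorseshoeStep S) :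
    RZero T 1 S.X₁ ↔ Function.Surjective (T.map D.p) :=
  have := D.injI
  rZero_one_iff T D.exI

theorem HorseshoeStep.rZero_one₂ {S : ShortComplex C} (D : HorseshoeStep S) :
    RZero T 1 S.X₂ ↔ Function.Surjective (T.map D.q) :=
  have := D.injI
  have := D.injK
  have : Injective (ShortComplex.mk D.j D.q D.jq).X₂ := inferInstanceAs (Injective (D.I ⊞ D.K))
  rZero_one_iff T D.exG

theorem HorseshoeStep.rZero_one₃ {S : ShortComplex C} (D : HorseshoeStep S) :
    RZero T 1 S.X₃ ↔ Function.Surjective (T.map D.r) :=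
  have := D.injK
  rZero_one_iff T D.exK

theorem HorseshoeStep.map_comm {S : ShortComplex C} (D : HorseshoeStep S) :
    (∀ x, T.map D.j (T.map S.f x) = T.map biprod.inl (T.map D.i x)) ∧
    (∀ x, T.map D.k (T.map S.g x) = T.map biprod.snd (T.map D.j x)) ∧
    (∀ x, T.map D.q (T.map biprod.inl x) = T.map D.Q.f (T.map D.p x)) ∧
    (∀ x, T.map D.Q.g (T.map D.q x) = T.map D.r (T.map biprod.snd x)) := by
  refine ⟨fun x => ?_, fun x => ?_, fun x => ?_, fun x => ?_⟩
  · rw [← map_comp_apply, ← map_comp_apply, D.comm₁]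
  · rw [← map_comp_apply, ← map_comp_apply, D.comm₂]
  · rw [← map_comp_apply, ← map_comp_apply, D.comm₃]
  · rw [← map_comp_apply, ← map_comp_apply, D.comm₄]

theorem map_snd_inr {I K : C} (x : T.obj K) :
    T.map (biprod.snd : I ⊞ K ⟶ K) (T.map (biprod.inr : K ⟶ I ⊞ K) x) = x := by
  rw [← map_comp_apply, biprod.inr_snd, T.map_id]; rfl

theorem exists_inl_of_map_snd_eq_zero {I K : C} (x : T.obj (I ⊞ K))
    (hx : T.map (biprod.snd : I ⊞ K ⟶ K) x = 0) : ∃ y, T.map (biprod.inl : I ⟶ I ⊞ K) y = x :=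
  exists_of_map_eq_zero T (S := ShortComplex.mk (biprod.inl : I ⟶ I ⊞ K) biprod.snd biprod.inl_snd)
    (ShortComplex.Splitting.ofHasBinaryBiproduct _ _).shortExact.exact x hx

/-- If `R¹T F = 0` then `T G ⟶ T H` is surjective. -/
theorem surjective_of_rZero_one {S : ShortComplex C} (hS : S.ShortExact) (h : RZero T 1 S.X₁) :
    Function.Surjective (T.map S.g) := by
  obtain ⟨D⟩ := exists_horseshoeStep hS
  obtain ⟨c₁, c₂, c₃, c₄⟩ := D.map_comm T
  have := D.exK.mono_f
  have := D.exG.mono_f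
  have := D.shortExact.mono_f
  rw [D.rZero_one₁ T] at h
  intro y
  have h1 : T.map D.Q.g (T.map D.q (T.map biprod.inr (T.map D.k y))) = 0 := by
    rw [c₄, map_snd_inr]
    exact map_apply_eq_zero T _ _ D.kr y
  obtain ⟨a, ha⟩ := exists_of_map_eq_zero T D.shortExact.exact _ h1
  obtain ⟨b, rfl⟩ := h a
  have h2 : T.map D.q (T.map biprod.inr (T.map D.k y) - T.map biprod.inl b) = 0 := by
    rw [map_sub, c₃]
    exact sub_eq_zero.mpr ha.symm
  obtain ⟨x, hx⟩ := exists_of_map_eq_zero T D.exG.exact _ h2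
  refine ⟨x, map_injective_of_mono T D.k ?_⟩
  have hx' : T.map D.j x = T.map biprod.inr (T.map D.k y) - T.map biprod.inl b := hx
  rw [c₂, hx', map_sub, map_snd_inr, map_apply_eq_zero T _ _ biprod.inl_snd, sub_zero]

/-- If `T G ⟶ T H` is surjective and `R¹T G = 0` then `R¹T F = 0`. -/
theorem rZero_one_of_surjective {S : ShortComplex C} (hS : S.ShortExact)
    (h : Function.Surjective (T.map S.g)) (hG : RZero T 1 S.X₂) : RZero T 1 S.X₁ := by
  obtain ⟨D⟩ := exists_horseshoeStep hS
  obtain ⟨c₁, c₂, c₃, c₄⟩ := D.map_comm T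
  have := D.exK.mono_f
  have := D.shortExact.mono_f
  rw [D.rZero_one₁ T]
  rw [D.rZero_one₂ T] at hG
  intro y
  obtain ⟨z, hz⟩ := hG (T.map D.Q.f y)
  have h1 : T.map D.r (T.map biprod.snd z) = 0 := by
    rw [← c₄, hz]
    exact map_apply_eq_zero T _ _ D.Q.zero y
  obtain ⟨a, ha⟩ := exists_of_map_eq_zero T D.exK.exact _ h1
  obtain ⟨b, rfl⟩ := h a
  have ha' : T.map D.k (T.map S.g b) = T.map biprod.snd z := ha
  have h2 : T.map biprod.snd (z - T.map D.j b) = 0 := by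
    rw [map_sub, ← c₂, ha', sub_self]
  obtain ⟨w, hw⟩ := exists_inl_of_map_snd_eq_zero T _ h2
  refine ⟨w, map_injective_of_mono T D.Q.f ?_⟩
  rw [← c₃, hw, map_sub, hz, map_apply_eq_zero T _ _ D.jq, sub_zero]

theorem HorseshoeStep.surjective_of_rZero {S : ShortComplex C} (D : HorseshoeStep S)
    (hG : RZero T 1 S.X₃) : Function.Surjective (T.map D.Q.g) := by
  obtain ⟨c₁, c₂, c₃, c₄⟩ := D.map_comm T
  rw [D.rZero_one₃ T] at hG
  intro y
  obtain ⟨z, rfl⟩ := hG y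
  exact ⟨T.map D.q (T.map biprod.inr z), by rw [c₄, map_snd_inr]⟩

theorem rZero_one_middle {S : ShortComplex C} (hS : S.ShortExact) (hF : RZero T 1 S.X₁)
    (hH : RZero T 1 S.X₃) : RZero T 1 S.X₂ := by
  obtain ⟨D⟩ := exists_horseshoeStep hS
  obtain ⟨c₁, c₂, c₃, c₄⟩ := D.map_comm T
  have := D.shortExact.mono_f
  rw [D.rZero_one₁ T] at hF
  rw [D.rZero_one₃ T] at hH
  rw [D.rZero_one₂ T]
  intro y
  obtain ⟨z, hz⟩ := hH (T.map D.Q.g y)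
  have h1 : T.map D.Q.g (y - T.map D.q (T.map biprod.inr z)) = 0 := by
    rw [map_sub, c₄, map_snd_inr, hz, sub_self]
  obtain ⟨a, ha⟩ := exists_of_map_eq_zero T D.shortExact.exact _ h1
  obtain ⟨b, rfl⟩ := hF a
  refine ⟨T.map biprod.inr z + T.map biprod.inl b, ?_⟩
  rw [map_add, c₃, ha, add_sub_cancel]

/-- Vanishing of `RⁱT` is stable under extensions. -/
theorem RZero.middle {S : ShortComplex C} (hS : S.ShortExact) {i : ℕ} (hF : RZero T i S.X₁)
    (hH : RZero T i S.X₃) : RZero T i S.X₂ := by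
  rcases i with _ | i
  · rw [rZero_zero_iff] at hF hH ⊢
    have := hS.mono_f
    have hF' := AddCommGrpCat.subsingleton_of_isZero hF
    have hH' := AddCommGrpCat.subsingleton_of_isZero hH
    have : Subsingleton (T.obj S.X₂) := by
      refine subsingleton_of_forall_eq 0 fun x => ?_
      obtain ⟨y, rfl⟩ := exists_of_map_eq_zero T hS.exact x (Subsingleton.elim _ _)
      rw [Subsingleton.elim y 0, map_zero]
    exact AddCommGrpCat.isZero_of_subsingleton _
  · induction i generalizing S with
    | zero => exact rZero_one_middle T hS hF hH
    | succ i ih =>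
      obtain ⟨D⟩ := exists_horseshoeStep hS
      rw [D.rZero_succ_succ₁ T] at hF
      rw [D.rZero_succ_succ₃ T] at hH
      rw [D.rZero_succ_succ₂ T]
      exact ih D.shortExact hF hH

/-- This reflects exactness of `RⁱT H → Rⁱ⁺¹T F → Rⁱ⁺¹T G`. A horseshoe step lowers all degrees by
one until the statement concerns surjectivity of `T` on the quotients. -/
theorem RZero.left {S : ShortComplex C} (hS : S.ShortExact) {i : ℕ} (hH : RZero T i S.X₃)
    (hG : RZero T (i + 1) S.X₂) : RZero T (i + 1) S.X₁ := by
  induction i generalizing S with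
  | zero =>
    refine rZero_one_of_surjective T hS ?_ hG
    rw [rZero_zero_iff] at hH
    have hH' := AddCommGrpCat.subsingleton_of_isZero hH
    exact fun y => ⟨0, Subsingleton.elim _ _⟩
  | succ i ih =>
    obtain ⟨D⟩ := exists_horseshoeStep hS
    rw [D.rZero_succ_succ₂ T] at hG
    rw [D.rZero_succ_succ₁ T]
    -- At the bottom, vanishing of `R¹T S.X₃` does not make `T(Q.X₃)` vanish. It only makes `T(Q.X₂)
    -- → T(Q.X₃)` surjective, which is all that is required.
    rcases i with _ | i
    · exact rZero_one_of_surjective T D.shortExact (D.surjective_of_rZero T hH) hG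
    · rw [D.rZero_succ_succ₃ T] at hH
      exact ih D.shortExact hH hG

theorem RZero.right {S : ShortComplex C} (hS : S.ShortExact) {i : ℕ} (hG : RZero T i S.X₂)
    (hF : RZero T (i + 1) S.X₁) : RZero T i S.X₃ := by
  rcases i with _ | i
  · have h := surjective_of_rZero_one T hS hF
    rw [rZero_zero_iff] at hG ⊢
    have := AddCommGrpCat.subsingleton_of_isZero hG
    have : Subsingleton (T.obj S.X₃) := h.subsingleton
    exact AddCommGrpCat.isZero_of_subsingleton _
  · induction i generalizing S with
    | zero =>
      obtain ⟨D⟩ := exists_horseshoeStep hS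
      obtain ⟨c₁, c₂, c₃, c₄⟩ := D.map_comm T
      rw [D.rZero_succ_succ₁ T] at hF
      rw [D.rZero_one₂ T] at hG
      rw [D.rZero_one₃ T]
      intro y
      obtain ⟨z, rfl⟩ := surjective_of_rZero_one T D.shortExact hF y
      obtain ⟨x, rfl⟩ := hG z
      exact ⟨T.map biprod.snd x, (c₄ x).symm⟩
    | succ i ih =>
      obtain ⟨D⟩ := exists_horseshoeStep hS
      rw [D.rZero_succ_succ₁ T] at hF
      rw [D.rZero_succ_succ₂ T] at hG
      rw [D.rZero_succ_succ₃ T]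
      exact ih D.shortExact hG hF

end LongExact

/-! ### Elementwise language for sections and stalks of abelian sheaves -/

section Sections

variable {X : TopCat.{u}}

/-- Abelian sheaves on a space. -/
abbrev AbSheaf (X : TopCat.{u}) := TopCat.Sheaf AddCommGrpCat.{u} X

/-- Restriction of sections. -/
def res (F : AbSheaf X) {U V : Opens X} (h : V ≤ U) : F.presheaf.obj (op U) →+ F.presheaf.obj (op V) :=
  (F.presheaf.map (homOfLE h).op).hom

/-- The action of a morphism on sections. -/
def sec {F G : AbSheaf X} (α : F ⟶ G) (U : Opens X) : F.presheaf.obj (op U) →+ G.presheaf.obj (op U) :=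
  (α.hom.app (op U)).hom

/-- The germ of a section. -/
def gm (F : AbSheaf X) {U : Opens X} {z : X} (hz : z ∈ U) :
    F.presheaf.obj (op U) →+ F.presheaf.stalk z :=
  (F.presheaf.germ U z hz).hom

/-- The action of a morphism on stalks. -/
def sm {F G : AbSheaf X} (α : F ⟶ G) (z : X) : F.presheaf.stalk z →+ G.presheaf.stalk z :=
  ((TopCat.Presheaf.stalkFunctor AddCommGrpCat.{u} z).map α.hom).hom

variable {F G H : AbSheaf X}

theorem res_res {U V W : Opens X} (h : V ≤ U) (h' : W ≤ V) (s : F.presheaf.obj (op U)) :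
    res F h' (res F h s) = res F (h'.trans h) s := by
  change (F.presheaf.map _ ≫ F.presheaf.map _) s = _
  rw [← F.presheaf.map_comp]
  rfl

theorem res_self {U : Opens X} (h : U ≤ U) (s : F.presheaf.obj (op U)) : res F h s = s :=
  ConcreteCategory.congr_hom (F.presheaf.map_id (op U)) s

theorem sec_res (α : F ⟶ G) {U V : Opens X} (h : V ≤ U) (s : F.presheaf.obj (op U)) :
    sec α V (res F h s) = res G h (sec α U s) :=
  ConcreteCategory.congr_hom (α.hom.naturality (homOfLE h).op) s

theorem sec_comp (α : F ⟶ G) (β : G ⟶ H) (U : Opens X) (s : F.presheaf.obj (op U)) :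
    sec (α ≫ β) U s = sec β U (sec α U s) := rfl

theorem sec_id (U : Opens X) (s : F.presheaf.obj (op U)) : sec (𝟙 F) U s = s := rfl

theorem sec_zero (U : Opens X) (s : F.presheaf.obj (op U)) : sec (0 : F ⟶ G) U s = 0 := rfl

theorem sheafHom_ext {α β : F ⟶ G} (h : ∀ U s, sec α U s = sec β U s) : α = β := by
  apply CategoryTheory.Sheaf.hom_ext
  ext U s
  exact h U.unop s

theorem gm_res {U V : Opens X} {z : X} (h : V ≤ U) (hz : z ∈ V) (s : F.presheaf.obj (op U)) :
    gm F hz (res F h s) = gm F (h hz) s :=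
  F.presheaf.germ_res_apply (homOfLE h) z hz s

theorem sm_gm (α : F ⟶ G) {U : Opens X} {z : X} (hz : z ∈ U) (s : F.presheaf.obj (op U)) :
    sm α z (gm F hz s) = gm G hz (sec α U s) :=
  TopCat.Presheaf.stalkFunctor_map_germ_apply U z hz α.hom s

theorem sm_comp (α : F ⟶ G) (β : G ⟶ H) (z : X) (s : F.presheaf.stalk z) :
    sm (α ≫ β) z s = sm β z (sm α z s) :=
  ConcreteCategory.congr_hom
    ((TopCat.Presheaf.stalkFunctor AddCommGrpCat.{u} z).map_comp α.hom β.hom) s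

theorem exists_gm_eq {z : X} (t : F.presheaf.stalk z) :
    ∃ (U : Opens X) (hz : z ∈ U) (s : F.presheaf.obj (op U)), gm F hz s = t :=
  F.presheaf.exists_germ_eq t

theorem exists_le_gm_eq {z : X} {W : Opens X} (hW : z ∈ W) (t : F.presheaf.stalk z) :
    ∃ (U : Opens X) (_ : U ≤ W) (hz : z ∈ U) (s : F.presheaf.obj (op U)), gm F hz s = t := by
  obtain ⟨U, hz, s, rfl⟩ := exists_gm_eq t
  exact ⟨U ⊓ W, inf_le_right, ⟨hz, hW⟩, res F inf_le_left s, gm_res _ _ _⟩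

theorem gm_eq {U V : Opens X} {z : X} (hU : z ∈ U) (hV : z ∈ V) (s : F.presheaf.obj (op U))
    (t : F.presheaf.obj (op V)) (h : gm F hU s = gm F hV t) :
    ∃ (W : Opens X) (hWU : W ≤ U) (hWV : W ≤ V), z ∈ W ∧ res F hWU s = res F hWV t := by
  obtain ⟨W, hz, i, j, e⟩ := F.presheaf.germ_eq z hU hV s t h
  exact ⟨W, i.le, j.le, hz, e⟩

theorem sections_ext {U : Opens X} {s t : F.presheaf.obj (op U)}
    (h : ∀ z (hz : z ∈ U), gm F hz s = gm F hz t) : s = t :=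
  TopCat.Presheaf.section_ext F U s t h

theorem sm_injective (α : F ⟶ G) [Mono α] (z : X) : Function.Injective (sm α z) :=
  (AddCommGrpCat.mono_iff_injective _).mp (TopCat.Presheaf.stalk_mono_of_mono α z)

theorem sec_injective_of_sm_injective (α : F ⟶ G) (U : Opens X)
    (h : ∀ z ∈ U, Function.Injective (sm α z)) : Function.Injective (sec α U) :=
  TopCat.Presheaf.app_injective_of_stalkFunctor_map_injective α.hom U h

theorem sec_injective (α : F ⟶ G) [Mono α] (U : Opens X) : Function.Injective (sec α U) :=
  sec_injective_of_sm_injective α U fun z _ => sm_injective α z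

theorem mono_of_sec_injective (α : F ⟶ G) (h : ∀ U, Function.Injective (sec α U)) : Mono α :=
  (TopCat.Presheaf.mono_iff_stalk_mono α).mpr fun z => (AddCommGrpCat.mono_iff_injective _).mpr
    (TopCat.Presheaf.stalkFunctor_map_injective_of_app_injective h z)

theorem epi_iff_sm_surjective (α : F ⟶ G) : Epi α ↔ ∀ z, Function.Surjective (sm α z) := by
  rw [← TopCat.Sheaf.isLocallySurjective_iff_epi,
    TopCat.Presheaf.locally_surjective_iff_surjective_on_stalks]
  rfl

theorem sm_surjective (α : F ⟶ G) [h : Epi α] (z : X) : Function.Surjective (sm α z) :=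
  (epi_iff_sm_surjective α).mp h z

theorem exists_sec_eq_res (α : F ⟶ G) {U : Opens X} {z : X} (hz : z ∈ U)
    (h : Function.Surjective (sm α z)) (t : G.presheaf.obj (op U)) :
    ∃ (V : Opens X) (hV : V ≤ U) (s : F.presheaf.obj (op V)), z ∈ V ∧ sec α V s = res G hV t := by
  obtain ⟨x, hx⟩ := h (gm G hz t)
  obtain ⟨V, hzV, s, rfl⟩ := exists_gm_eq x
  rw [sm_gm] at hx
  obtain ⟨W, h1, h2, hzW, e⟩ := gm_eq _ _ _ _ hx
  exact ⟨W, h2, res F h1 s, hzW, by rw [sec_res, e]⟩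

theorem sec_exact {S : ShortComplex (AbSheaf X)} (hS : S.Exact) [Mono S.f] {U : Opens X}
    (s : S.X₂.presheaf.obj (op U)) (h : sec S.g U s = 0) : ∃ t, sec S.f U t = s :=
  TopCat.Sheaf.sections_exact_of_left_exact hS inferInstance s h

theorem sm_exact {S : ShortComplex (AbSheaf X)} (hS : S.Exact) {z : X}
    (s : S.X₂.presheaf.stalk z) (h : sm S.g z s = 0) : ∃ t, sm S.f z t = s :=
  (ShortComplex.ab_exact_iff _).mp
    ((TopCat.Sheaf.exact_iff_stalkFunctor_map_exact S).mp hS z) s h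

theorem sec_zero_comp {S : ShortComplex (AbSheaf X)} {U : Opens X} (s : S.X₁.presheaf.obj (op U)) :
    sec S.g U (sec S.f U s) = 0 := by
  rw [← sec_comp, S.zero, sec_zero]

theorem sm_zero_comp {S : ShortComplex (AbSheaf X)} {z : X} (s : S.X₁.presheaf.stalk z) :
    sm S.g z (sm S.f z s) = 0 := by
  obtain ⟨U, hz, s, rfl⟩ := exists_gm_eq s
  rw [sm_gm, sm_gm, sec_zero_comp, map_zero]

theorem glue₂ {U₁ U₂ V : Opens X} (h₁ : U₁ ≤ V) (h₂ : U₂ ≤ V) (hV : V ≤ U₁ ⊔ U₂)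
    (s₁ : F.presheaf.obj (op U₁)) (s₂ : F.presheaf.obj (op U₂))
    (h : res F inf_le_left s₁ = res F (inf_le_right : U₁ ⊓ U₂ ≤ U₂) s₂) :
    ∃ s, res F h₁ s = s₁ ∧ res F h₂ s = s₂ := by
  let W : Bool → Opens X := fun b => bif b then U₁ else U₂
  let sf : ∀ b, F.presheaf.obj (op (W b)) := fun b => match b with
    | true => s₁
    | false => s₂
  obtain ⟨s, hs, -⟩ := F.existsUnique_gluing' W V
    (fun b => match b with
      | true => homOfLE h₁
      | false => homOfLE h₂)
    (hV.trans (sup_le (le_iSup W true) (le_iSup W false))) sf (by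
      rintro (_ | _) (_ | _)
      · rfl
      · have := congrArg (res F (le_inf inf_le_right inf_le_left : U₂ ⊓ U₁ ≤ U₁ ⊓ U₂)) h
        rw [res_res, res_res] at this
        exact this.symm
      · exact h
      · rfl)
  exact ⟨s, hs true, hs false⟩

end Sections

/-! ### Left exactness of `Γ_y` and its acyclicity on flasque sheaves -/

section Flasque

variable {X : TopCat.{u}}

theorem germsWithSupportFunctor_map_coe (y : X) {F G : AbSheaf X} (α : F ⟶ G)
    (t : germsWithSupport y F.presheaf) :
    ((germsWithSupportFunctor y).map α t : germsWithSupport y G.presheaf).1 = sm α y t.1 := rfl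

theorem mem_germsWithSupport {y : X} {F : AbSheaf X} {t : F.presheaf.stalk y} :
    t ∈ germsWithSupport y F.presheaf ↔ ∃ (U : Opens X) (hy : y ∈ U) (s : F.presheaf.obj (op U)),
      gm F hy s = t ∧ ∀ (z : X) (hz : z ∈ U), z ∉ closure {y} → gm F hz s = 0 := Iff.rfl

/-- Lifting a germ along a monomorphism keeps its support inside the closure of `y`, because the
monomorphism is injective on every nearby stalk. -/
instance (y : X) : PreservesFiniteLimits (germsWithSupportFunctor y) := by
  refine ((Functor.preservesFiniteLimits_tfae (germsWithSupportFunctor y)).out 0 3 rfl rfl).mp ?_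
  intro S hS
  have := hS.mono_f
  constructor
  · rw [ShortComplex.ab_exact_iff]
    rintro ⟨x, hx⟩ h0
    have h0' : sm S.g y x = 0 := congrArg Subtype.val h0
    obtain ⟨t, rfl⟩ := sm_exact hS.exact x h0'
    obtain ⟨V, hV, s, rfl⟩ := exists_gm_eq t
    obtain ⟨U, hU, r, hr, hs⟩ := mem_germsWithSupport.mp hx
    rw [sm_gm] at hr
    obtain ⟨W, h1, h2, hW, e⟩ := gm_eq _ _ _ _ hr
    refine ⟨⟨gm S.X₁ hV s, mem_germsWithSupport.mpr ⟨W, hW, res _ h2 s, gm_res _ _ _,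
      fun z hz hzy => ?_⟩⟩, Subtype.ext rfl⟩
    apply sm_injective S.f z
    rw [sm_gm, sec_res, ← e, gm_res, hs z _ hzy, map_zero]
  · rw [AddCommGrpCat.mono_iff_injective]
    intro a b h
    exact Subtype.ext (sm_injective S.f y (congrArg Subtype.val h))

theorem res_surjective (F : AbSheaf X) [F.IsFlasque] {U V : Opens X} (h : V ≤ U) :
    Function.Surjective (res F h) :=
  (AddCommGrpCat.epi_iff_surjective _).mp (TopCat.Presheaf.IsFlasque.epi (F := F.presheaf) _)

theorem isFlasque_of_surjective (F : AbSheaf X)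
    (h : ∀ U V : Opens X, ∀ h : V ≤ U, Function.Surjective (res F h)) : F.IsFlasque :=
  ⟨fun i => (AddCommGrpCat.epi_iff_surjective _).mpr (h _ _ i.unop.le)⟩

theorem isFlasque_of_retract {F G : AbSheaf X} [G.IsFlasque] (i : F ⟶ G) (r : G ⟶ F)
    (h : i ≫ r = 𝟙 F) : F.IsFlasque :=
  isFlasque_of_surjective F fun U V hVU s => by
    obtain ⟨t, ht⟩ := res_surjective G hVU (sec i V s)
    refine ⟨sec r U t, ?_⟩
    rw [← sec_res, ht, ← sec_comp, h, sec_id]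

/-- The sheaf of discontinuous sections `U ↦ ∏_{z ∈ U} F_z`. -/
def godement (F : AbSheaf X) : AbSheaf X where
  obj :=
    { obj := fun U => AddCommGrpCat.of (∀ z : U.unop, F.presheaf.stalk z.1)
      map := fun i => AddCommGrpCat.ofHom
        { toFun := fun g z => g (i.unop z)
          map_zero' := rfl
          map_add' := fun _ _ => rfl }
      map_id := fun _ => rfl
      map_comp := fun _ _ => rfl }
  property := (TopCat.Presheaf.isSheaf_iff_isSheaf_comp (CategoryTheory.forget AddCommGrpCat.{u}) _).mpr
    (TopCat.Presheaf.toTypes_isSheaf X fun z => F.presheaf.stalk z)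

/-- The embedding of a sheaf into its sheaf of discontinuous sections. -/
def toGodement (F : AbSheaf X) : F ⟶ godement F where
  hom :=
    { app := fun U => AddCommGrpCat.ofHom
        { toFun := fun s z => gm F z.2 s
          map_zero' := funext fun z => map_zero _
          map_add' := fun s t => funext fun z => map_add _ s t }
      naturality := fun U V i => by
        ext s
        exact funext fun z => gm_res (F := F) i.unop.le z.2 s }

instance (F : AbSheaf X) : Mono (toGodement F) :=
  mono_of_sec_injective _ fun _ _ _ h => sections_ext fun z hz => congrFun h ⟨z, hz⟩

instance (F : AbSheaf X) : (godement F).IsFlasque :=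
  isFlasque_of_surjective _ fun U V h s => by
    classical
    let s' : ∀ z : V, F.presheaf.stalk z.1 := s
    refine ⟨fun z : U => if hz : z.1 ∈ V then s' ⟨z.1, hz⟩ else 0, ?_⟩
    funext z
    exact dif_pos z.2

/-- An injective sheaf is a retract of its sheaf of discontinuous sections, which is flasque. -/
instance isFlasque_of_injective (I : AbSheaf X) [Injective I] : I.IsFlasque :=
  isFlasque_of_retract (toGodement I) (Injective.factorThru (𝟙 I) (toGodement I))
    (Injective.comp_factorThru _ _)

theorem sec_surjective_of_isFlasque {S : ShortComplex (AbSheaf X)} (hS : S.ShortExact)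
    [S.X₁.IsFlasque] (U : Opens X) : Function.Surjective (sec S.g U) :=
  (AddCommGrpCat.epi_iff_surjective _).mp (TopCat.Sheaf.IsFlasque.epi_of_shortExact hS)

theorem isFlasque_quotient {S : ShortComplex (AbSheaf X)} (hS : S.ShortExact) [S.X₁.IsFlasque]
    [S.X₂.IsFlasque] : S.X₃.IsFlasque :=
  TopCat.Sheaf.IsFlasque.of_shortExact_of_isFlasque₁₂ hS

theorem under_shortExact (F : AbSheaf X) : (ShortComplex.mk (Injective.ι F)
    (cokernel.π (Injective.ι F)) (cokernel.condition _)).ShortExact :=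
  shortExact_cokernel _

/-- A section of the quotient supported in the closure of `y` lifts to the injective sheaf. Off the
closure the lift comes from `F`, and flasqueness extends that section of `F` to all of `U`.
Subtracting it corrects the support of the lift. -/
theorem rZero_one_of_isFlasque (y : X) (F : AbSheaf X) [hF : F.IsFlasque] :
    RZero (germsWithSupportFunctor y) 1 F := by
  have hS := under_shortExact F
  refine (rZero_one_iff _ hS).mpr ?_
  have h1 : (ShortComplex.mk (Injective.ι F)
    (cokernel.π (Injective.ι F)) (cokernel.condition _)).X₁.IsFlasque := hF
  set S := ShortComplex.mk (Injective.ι F) (cokernel.π (Injective.ι F)) (cokernel.condition _)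
  have := hS.mono_f
  rintro ⟨q, hq⟩
  obtain ⟨U, hU, t, rfl, ht⟩ := mem_germsWithSupport.mp hq
  obtain ⟨s, rfl⟩ := sec_surjective_of_isFlasque hS U t
  let V : Opens X := U ⊓ ⟨(closure {y})ᶜ, isClosed_closure.isOpen_compl⟩
  have hV : V ≤ U := inf_le_left
  have h0 : sec S.g V (res _ hV s) = 0 := sections_ext fun z hz => by
    rw [sec_res, gm_res, ht z hz.1 hz.2, map_zero]
  obtain ⟨f, hf⟩ := sec_exact hS.exact _ h0
  obtain ⟨f', rfl⟩ := res_surjective S.X₁ hV f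
  have e : sec S.g U (s - sec S.f U f') = sec S.g U s := by
    rw [map_sub, sec_zero_comp, sub_zero]
  refine ⟨⟨gm S.X₂ hU (s - sec S.f U f'), mem_germsWithSupport.mpr ⟨U, hU, _, rfl, fun z hz hzy => ?_⟩⟩,
    Subtype.ext ?_⟩
  · have hzV : z ∈ V := ⟨hz, hzy⟩
    have : res S.X₂ hV (s - sec S.f U f') = 0 := by
      rw [map_sub, ← hf, sec_res, sub_self]
    rw [← gm_res hV hzV, this, map_zero]
  · rw [germsWithSupportFunctor_map_coe]
    exact (sm_gm S.g hU _).trans (congrArg _ e)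

theorem rZero_succ_of_isFlasque (y : X) (i : ℕ) (F : AbSheaf X) [hF : F.IsFlasque] :
    RZero (germsWithSupportFunctor y) (i + 1) F := by
  induction i generalizing F with
  | zero => exact rZero_one_of_isFlasque y F
  | succ i ih =>
    have hS := under_shortExact F
    have : (ShortComplex.mk (Injective.ι F)
      (cokernel.π (Injective.ι F)) (cokernel.condition _)).X₁.IsFlasque := hF
    have : (ShortComplex.mk (Injective.ι F)
      (cokernel.π (Injective.ι F)) (cokernel.condition _)).X₂.IsFlasque :=
      isFlasque_of_injective (Injective.under F)
    have := isFlasque_quotient hS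
    exact (rZero_succ_succ_iff _ hS i).mpr (ih _)

end Flasque

/-! ### The sheaves `V ↦ F(V ∩ D)` and sections vanishing on `D` -/

section Restriction

variable {X : TopCat.{u}}

/-- The sheaf `V ↦ F(V ∩ D)`. -/
def restrictTo (D : Opens X) (F : AbSheaf X) : AbSheaf X where
  obj :=
    { obj := fun V => F.presheaf.obj (op (V.unop ⊓ D))
      map := fun i => F.presheaf.map (homOfLE (inf_le_inf_right D i.unop.le)).op
      map_id := fun V => F.presheaf.map_id _
      map_comp := fun i j => by rw [← F.presheaf.map_comp]; rfl }
  property := by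
    refine (TopCat.Presheaf.isSheaf_iff_isSheafUniqueGluing _).mpr ?_
    intro ι V sf hsf
    have hc : (⨆ i, V i) ⊓ D ≤ ⨆ i, V i ⊓ D := (iSup_inf_eq V D).le
    obtain ⟨s, hs, hu⟩ := F.existsUnique_gluing' (fun i => V i ⊓ D) ((⨆ i, V i) ⊓ D)
      (fun i => homOfLE (inf_le_inf_right D (le_iSup V i))) hc sf (by
        intro i j
        have h : (V i ⊓ D) ⊓ (V j ⊓ D) ≤ V i ⊓ V j ⊓ D :=
          le_inf (inf_le_inf inf_le_left inf_le_left) (inf_le_left.trans inf_le_right)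
        have := congrArg (res F h) (hsf i j)
        erw [res_res (F := F) (inf_le_inf_right D inf_le_left) h,
          res_res (F := F) (inf_le_inf_right D inf_le_right) h] at this
        exact this)
    exact ⟨s, hs, hu⟩

/-- Functoriality of `V ↦ F(V ∩ D)`. -/
def restrictToMap (D : Opens X) {F G : AbSheaf X} (α : F ⟶ G) : restrictTo D F ⟶ restrictTo D G where
  hom :=
    { app := fun V => α.hom.app (op (V.unop ⊓ D))
      naturality := fun _ _ _ => α.hom.naturality _ }

/-- The restriction morphism from `F` to `V ↦ F(V ∩ D)`. -/
def toRestrictTo (D : Opens X) (F : AbSheaf X) : F ⟶ restrictTo D F where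
  hom :=
    { app := fun V => F.presheaf.map (homOfLE inf_le_left).op
      naturality := fun _ _ _ => by
        change F.presheaf.map _ ≫ F.presheaf.map _ = F.presheaf.map _ ≫ F.presheaf.map _
        rw [← F.presheaf.map_comp, ← F.presheaf.map_comp]
        rfl }

variable (D : Opens X) {F G : AbSheaf X}

theorem sec_toRestrictTo (U : Opens X) (s : F.presheaf.obj (op U)) :
    sec (toRestrictTo D F) U s = res F inf_le_left s := rfl

instance [F.IsFlasque] : (restrictTo D F).IsFlasque :=
  isFlasque_of_surjective _ fun _ _ h => res_surjective F (inf_le_inf_right D h)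

/-- The subsheaf of sections vanishing on `D`. -/
def vanishingOn (D : Opens X) (F : AbSheaf X) : AbSheaf X := kernel (toRestrictTo D F)

/-- The inclusion of the subsheaf of sections vanishing on `D`. -/
def vanishingOnι (D : Opens X) (F : AbSheaf X) : vanishingOn D F ⟶ F := kernel.ι (toRestrictTo D F)

instance : Mono (vanishingOnι D F) := inferInstanceAs (Mono (kernel.ι _))

theorem vanishingOn_exact : (ShortComplex.mk (vanishingOnι D F) (toRestrictTo D F)
    (kernel.condition _)).Exact := ShortComplex.exact_of_f_is_kernel _ (kernelIsKernel _)

theorem res_sec_vanishingOnι {U : Opens X} (s : (vanishingOn D F).presheaf.obj (op U)) :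
    res F inf_le_left (sec (vanishingOnι D F) U s) = (0 : F.presheaf.obj (op (U ⊓ D))) :=
  sec_zero_comp (S := ShortComplex.mk (vanishingOnι D F) (toRestrictTo D F)
    (kernel.condition _)) s

theorem exists_vanishingOn {U : Opens X} (s : F.presheaf.obj (op U))
    (h : res F inf_le_left s = (0 : F.presheaf.obj (op (U ⊓ D)))) :
    ∃ t, sec (vanishingOnι D F) U t = s :=
  haveI : Mono (ShortComplex.mk (vanishingOnι D F) (toRestrictTo D F)
    (kernel.condition _)).f := inferInstanceAs (Mono (vanishingOnι D F))
  sec_exact (vanishingOn_exact D) s h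

/-- A section over `V` vanishing on `V ∩ D` glues with zero on `U ∩ D`, and the result extends to
`U` by flasqueness of `F`. -/
instance [F.IsFlasque] : (vanishingOn D F).IsFlasque :=
  isFlasque_of_surjective _ fun U V h s => by
    have hs := res_sec_vanishingOnι D s
    obtain ⟨t, ht, ht'⟩ := glue₂ (F := F) (U₁ := V) (U₂ := U ⊓ D) (V := V ⊔ U ⊓ D) le_sup_left
      le_sup_right le_rfl (sec (vanishingOnι D F) V s) 0 (by
        have := congrArg (res F (le_inf inf_le_left (inf_le_right.trans inf_le_right) :
          V ⊓ (U ⊓ D) ≤ V ⊓ D)) hs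
        rw [res_res, map_zero] at this
        rw [this, map_zero])
    obtain ⟨t, rfl⟩ := res_surjective F (sup_le h inf_le_left : V ⊔ U ⊓ D ≤ U) t
    rw [res_res] at ht ht'
    obtain ⟨r, hr⟩ := exists_vanishingOn D t ht'
    refine ⟨r, sec_injective (vanishingOnι D F) V ?_⟩
    rw [sec_res, hr, ht]

/-- A sheaf with zero stalks on `D` embeds into the sections vanishing on `D` of any sheaf that it
embeds into. -/
theorem exists_lift_vanishingOn (α : F ⟶ G) [Mono α]
    (h : ∀ z ∈ D, ∀ t : F.presheaf.stalk z, t = 0) :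
    ∃ β : F ⟶ vanishingOn D G, Mono β ∧ β ≫ vanishingOnι D G = α := by
  have e : α ≫ toRestrictTo D G = 0 := by
    refine sheafHom_ext fun U s => ?_
    rw [sec_comp, sec_toRestrictTo, sec_zero]
    rw [← sec_res]
    have : res F (inf_le_left : U ⊓ D ≤ U) s = 0 :=
      sections_ext fun z hz => (h z hz.2 _).trans (h z hz.2 _).symm
    rw [this]
    exact map_zero _
  refine ⟨kernel.lift _ α e,
    mono_of_mono_fac (kernel.lift_ι _ _ e), kernel.lift_ι _ _ _⟩

theorem vanishingOn_stalk {z : X} (hz : z ∈ D) (t : (vanishingOn D F).presheaf.stalk z) : t = 0 := by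
  obtain ⟨U, hU, s, rfl⟩ := exists_gm_eq t
  apply sm_injective (vanishingOnι D F) z
  rw [sm_gm, map_zero, ← gm_res (inf_le_left : U ⊓ D ≤ U) ⟨hU, hz⟩, res_sec_vanishingOnι, map_zero]

end Restriction

/-! ### Sheaves supported on a closure, and invariance under changes away from `y` -/

section Support

variable {X : TopCat.{u}} {y : X} {U D : Opens X}

theorem map_surjective_of_support (hy : y ∈ U) (hD : ∀ z ∈ U, z ∉ closure {y} → z ∈ D)
    {F G : AbSheaf X} (α : F ⟶ G) [Epi α] (h : ∀ z ∈ D, ∀ t : F.presheaf.stalk z, t = 0) :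
    Function.Surjective ((germsWithSupportFunctor y).map α) := by
  rintro ⟨t, ht⟩
  obtain ⟨x, rfl⟩ := sm_surjective α y t
  obtain ⟨V, hVU, hV, s, rfl⟩ := exists_le_gm_eq hy x
  exact ⟨⟨gm F hV s, mem_germsWithSupport.mpr ⟨V, hV, s, rfl, fun z hz hzy =>
    h z (hD z (hVU hz) hzy) _⟩⟩, Subtype.ext rfl⟩

/-- A sheaf whose stalks on a neighbourhood of `y` are supported on the closure of `y` has no
higher local cohomology at `y`. -/
theorem rZero_succ_of_support (hy : y ∈ U) (hD : ∀ z ∈ U, z ∉ closure {y} → z ∈ D) (i : ℕ)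
    (F : AbSheaf X) (h : ∀ z ∈ D, ∀ t : F.presheaf.stalk z, t = 0) :
    RZero (germsWithSupportFunctor y) (i + 1) F := by
  induction i generalizing F with
  | zero =>
    -- The injective hull is replaced by its subsheaf of sections vanishing on `D`. This is flasque,
    -- still contains `F`, and has zero stalks on `D`, so the quotient satisfies the same
    -- hypothesis.
    obtain ⟨β, hβ, -⟩ := exists_lift_vanishingOn D (Injective.ι F) h
    have hS := shortExact_cokernel β
    refine rZero_one_of_surjective _ hS ?_ (rZero_one_of_isFlasque y _)
    have := hS.epi_g
    exact map_surjective_of_support hy hD (ShortComplex.mk β _ (cokernel.condition β)).g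
      fun z hz => vanishingOn_stalk D hz
  | succ i ih =>
    obtain ⟨β, hβ, -⟩ := exists_lift_vanishingOn D (Injective.ι F) h
    have hS := shortExact_cokernel β
    have := hS.epi_g
    refine RZero.left _ hS (ih _ fun z hz t => ?_) (rZero_succ_of_isFlasque y _ _)
    obtain ⟨x, rfl⟩ := sm_surjective (ShortComplex.mk β _ (cokernel.condition β)).g z t
    rw [vanishingOn_stalk D hz x, map_zero]

theorem rZero_of_stalk_eq_zero (hy : y ∈ U) (i : ℕ) (F : AbSheaf X)
    (h : ∀ z ∈ U, ∀ t : F.presheaf.stalk z, t = 0) : RZero (germsWithSupportFunctor y) i F := by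
  rcases i with _ | i
  · rw [rZero_zero_iff]
    have : Subsingleton ((germsWithSupportFunctor y).obj F) :=
      subsingleton_of_forall_eq 0 fun t => Subtype.ext (h y hy _)
    exact AddCommGrpCat.isZero_of_subsingleton _
  · exact rZero_succ_of_support hy (fun z hz _ => hz) i F h

variable {F G : AbSheaf X}

theorem rZero_iff_of_mono (hy : y ∈ U) (α : F ⟶ G) [Mono α]
    (h : ∀ z ∈ U, Function.Surjective (sm α z)) (i : ℕ) :
    RZero (germsWithSupportFunctor y) i F ↔ RZero (germsWithSupportFunctor y) i G := by
  have hS := shortExact_cokernel α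
  have := hS.epi_g
  have hQ : ∀ i, RZero (germsWithSupportFunctor y) i (cokernel α) := fun i =>
    rZero_of_stalk_eq_zero hy i _ fun z hz t => by
      obtain ⟨x, rfl⟩ := sm_surjective (ShortComplex.mk α _ (cokernel.condition α)).g z t
      obtain ⟨w, rfl⟩ := h z hz x
      exact sm_zero_comp (S := ShortComplex.mk α _ (cokernel.condition α)) w
  refine ⟨fun hF => RZero.middle _ hS hF (hQ i), fun hG => ?_⟩
  rcases i with _ | i
  · rw [rZero_zero_iff] at hG ⊢
    have := AddCommGrpCat.subsingleton_of_isZero hG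
    have : Subsingleton ((germsWithSupportFunctor y).obj F) :=
      (map_injective_of_mono (germsWithSupportFunctor y) α).subsingleton
    exact AddCommGrpCat.isZero_of_subsingleton _
  · exact RZero.left _ hS (hQ i) hG

theorem rZero_iff_of_epi (hy : y ∈ U) (α : F ⟶ G) [Epi α]
    (h : ∀ z ∈ U, Function.Injective (sm α z)) (i : ℕ) :
    RZero (germsWithSupportFunctor y) i F ↔ RZero (germsWithSupportFunctor y) i G := by
  have hS : (ShortComplex.mk (kernel.ι α) α (kernel.condition α)).ShortExact :=
    { exact := ShortComplex.exact_of_f_is_kernel _ (kernelIsKernel α)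
      mono_f := inferInstanceAs (Mono (kernel.ι α))
      epi_g := inferInstance }
  have := hS.mono_f
  have hK : ∀ i, RZero (germsWithSupportFunctor y) i (kernel α) := fun i =>
    rZero_of_stalk_eq_zero hy i _ fun z hz t => by
      apply sm_injective (ShortComplex.mk (kernel.ι α) α (kernel.condition α)).f z
      apply h z hz
      rw [map_zero, map_zero]
      exact sm_zero_comp (S := ShortComplex.mk (kernel.ι α) α (kernel.condition α)) t
  exact ⟨fun hF => RZero.right _ hS hF (hK _), fun hG => RZero.middle _ hS (hK i) hG⟩

/-- A morphism that is bijective on stalks near `y` preserves the vanishing of local cohomology. -/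
theorem rZero_iff_of_bijective (hy : y ∈ U) (α : F ⟶ G)
    (h : ∀ z ∈ U, Function.Bijective (sm α z)) (i : ℕ) :
    RZero (germsWithSupportFunctor y) i F ↔ RZero (germsWithSupportFunctor y) i G := by
  have hc : ∀ z (t : F.presheaf.stalk z),
      sm (image.ι α) z (sm (factorThruImage α) z t) = sm α z t := fun z t => by
    rw [← sm_comp, image.fac]
  have h1 : ∀ z ∈ U, Function.Injective (sm (factorThruImage α) z) := fun z hz a b hab =>
    (h z hz).1 (by rw [← hc, ← hc, hab])
  have h2 : ∀ z ∈ U, Function.Surjective (sm (image.ι α) z) := fun z hz b => by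
    obtain ⟨a, rfl⟩ := (h z hz).2 b
    exact ⟨_, hc z a⟩
  exact (rZero_iff_of_epi hy (factorThruImage α) h1 i).trans (rZero_iff_of_mono hy (image.ι α) h2 i)

/-- A complex of sheaves is short exact on the stalks over `U`. -/
structure ShortExactOn (U : Opens X) (S : ShortComplex (AbSheaf X)) : Prop where
  inj : ∀ z ∈ U, Function.Injective (sm S.f z)
  exact : ∀ z ∈ U, ∀ t, sm S.g z t = 0 → ∃ r, sm S.f z r = t
  surj : ∀ z ∈ U, Function.Surjective (sm S.g z)

/-- The kernel of `S.g` and the quotient by it replace the outer terms. The comparison maps are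
bijective on stalks over `U`, so local cohomology at `y` is unaffected. -/
theorem ShortExactOn.exists_shortExact {S : ShortComplex (AbSheaf X)} (hS : ShortExactOn U S)
    (hy : y ∈ U) : ∃ S' : ShortComplex (AbSheaf X), S'.ShortExact ∧
      (∀ i, RZero (germsWithSupportFunctor y) i S.X₁ ↔ RZero (germsWithSupportFunctor y) i S'.X₁) ∧
      S'.X₂ = S.X₂ ∧
      (∀ i, RZero (germsWithSupportFunctor y) i S.X₃ ↔
        RZero (germsWithSupportFunctor y) i S'.X₃) := by
  have hS' := shortExact_cokernel (kernel.ι S.g)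
  set S' := ShortComplex.mk (kernel.ι S.g) (cokernel.π (kernel.ι S.g)) (cokernel.condition _) with hSe
  have := hS'.mono_f
  have := hS'.epi_g
  let a : S.X₁ ⟶ S'.X₁ := kernel.lift S.g S.f S.zero
  have ha : a ≫ S'.f = S.f := kernel.lift_ι _ _ _
  let b : S'.X₃ ⟶ S.X₃ := cokernel.desc (kernel.ι S.g) S.g (kernel.condition _)
  have hb : S'.g ≫ b = S.g := cokernel.π_desc _ _ _
  have hfg : S'.f ≫ S.g = 0 := kernel.condition _
  have ha' : ∀ z t, sm S'.f z (sm a z t) = sm S.f z t := fun z t => by rw [← sm_comp, ha]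
  have hb' : ∀ z t, sm b z (sm S'.g z t) = sm S.g z t := fun z t => by rw [← sm_comp, hb]
  have hz0 : ∀ z t, sm S.g z (sm S'.f z t) = 0 := fun z t =>
    sm_zero_comp (S := ShortComplex.mk S'.f S.g hfg) t
  refine ⟨S', hS', rZero_iff_of_bijective hy a fun z hz => ⟨fun p q hpq => ?_, fun p => ?_⟩, rfl,
    fun i => (rZero_iff_of_bijective hy b (fun z hz => ⟨?_, fun p => ?_⟩) i).symm⟩
  · exact hS.inj z hz (by rw [← ha', ← ha', hpq])
  · obtain ⟨r, hr⟩ := hS.exact z hz _ (hz0 z p)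
    exact ⟨r, sm_injective S'.f z ((ha' z r).trans hr)⟩
  · rw [injective_iff_map_eq_zero]
    intro t ht
    obtain ⟨t, rfl⟩ := sm_surjective S'.g z t
    rw [hb'] at ht
    obtain ⟨r, rfl⟩ := hS.exact z hz _ ht
    rw [← ha']
    exact sm_zero_comp _
  · obtain ⟨r, rfl⟩ := hS.surj z hz p
    exact ⟨_, hb' z r⟩

theorem ShortExactOn.zero {S : ShortComplex (AbSheaf X)} (hS : ShortExactOn U S) (hy : y ∈ U)
    (h₂ : RZero (germsWithSupportFunctor y) 0 S.X₂) :
    RZero (germsWithSupportFunctor y) 0 S.X₁ := by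
  rw [rZero_zero_iff] at h₂ ⊢
  have := AddCommGrpCat.subsingleton_of_isZero h₂
  have : Subsingleton ((germsWithSupportFunctor y).obj S.X₁) := by
    refine subsingleton_of_forall_eq 0 fun t => Subtype.ext (hS.inj y hy ?_)
    have h : (germsWithSupportFunctor y).map S.f t = (germsWithSupportFunctor y).map S.f 0 :=
      Subsingleton.elim _ _
    exact congrArg Subtype.val h
  exact AddCommGrpCat.isZero_of_subsingleton _

theorem ShortExactOn.left {S : ShortComplex (AbSheaf X)} (hS : ShortExactOn U S) (hy : y ∈ U)
    {i : ℕ} (h₃ : RZero (germsWithSupportFunctor y) i S.X₃)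
    (h₂ : RZero (germsWithSupportFunctor y) (i + 1) S.X₂) :
    RZero (germsWithSupportFunctor y) (i + 1) S.X₁ := by
  obtain ⟨S', hS', e₁, e₂, e₃⟩ := hS.exists_shortExact hy
  rw [e₁]
  exact RZero.left _ hS' ((e₃ _).mp h₃) (e₂ ▸ h₂)

end Support

/-! ### Gluing over basic opens of an affine open subset -/

section BasicGluing

variable {X : Scheme.{u}} {U : X.Opens}

theorem exists_point_of_isAffineOpen (hU : IsAffineOpen U) (p : PrimeSpectrum Γ(X, U)) :
    ∃ z : X, z ∈ U ∧ ∀ f : Γ(X, U), z ∈ X.basicOpen f ↔ f ∉ p.asIdeal := by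
  refine ⟨hU.fromSpec p, ?_, fun f => ?_⟩
  · have : hU.fromSpec p ∈ Set.range hU.fromSpec := ⟨p, rfl⟩
    rwa [hU.range_fromSpec] at this
  · change p ∈ hU.fromSpec ⁻¹ᵁ X.basicOpen f ↔ _
    rw [hU.fromSpec_preimage_basicOpen]
    exact Iff.rfl

theorem mem_basicOpen_add {f g : Γ(X, U)} {z : X} (hz : z ∈ X.basicOpen (f + g)) :
    z ∈ X.basicOpen f ∨ z ∈ X.basicOpen g := by
  have hzU : z ∈ U := X.basicOpen_le _ hz
  rw [X.mem_basicOpen _ z hzU] at hz ⊢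
  rw [X.mem_basicOpen _ z hzU]
  rw [map_add] at hz
  exact IsLocalRing.isUnit_or_isUnit_of_isUnit_add hz

variable (U) in
/-- The sections over the intersection of two basic open subsets whose union is basic are
differences of sections over these subsets. -/
def BasicGluing (F : AbSheaf X) : Prop :=
  ∀ f g h : Γ(X, U), X.basicOpen f ⊔ X.basicOpen g = X.basicOpen h →
    ∀ s : F.presheaf.obj (op (X.basicOpen f ⊓ X.basicOpen g)),
      ∃ (a : F.presheaf.obj (op (X.basicOpen f))) (b : F.presheaf.obj (op (X.basicOpen g))),
        s = res F inf_le_left a - res F inf_le_right b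

theorem basicGluing_of_epi {F G : AbSheaf X} [F.IsFlasque] (α : F ⟶ G)
    (h : ∀ f : Γ(X, U), Function.Surjective (sec α (X.basicOpen f))) : BasicGluing U G := by
  intro f g _ _ s
  have key : ∀ (V : X.Opens) (_ : V = X.basicOpen (f * g)) (s : G.presheaf.obj (op V)),
      ∃ t, sec α V t = s := by
    rintro V rfl s
    exact h _ s
  obtain ⟨t, rfl⟩ := key _ (X.basicOpen_mul f g).symm s
  obtain ⟨t, rfl⟩ := res_surjective F (inf_le_left : X.basicOpen f ⊓ X.basicOpen g ≤ _) t
  exact ⟨sec α _ t, 0, by rw [map_zero, sub_zero, sec_res]⟩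

/-- Two local lifts of `t` differ on the overlap by a section of the subsheaf. Writing that section
as a difference corrects both lifts so that they agree. -/
theorem BasicGluing.exists_glue {S : ShortComplex (AbSheaf X)} (hS : S.ShortExact)
    (hF : BasicGluing U S.X₁) {f g h : Γ(X, U)}
    (e : X.basicOpen f ⊔ X.basicOpen g = X.basicOpen h) (t : S.X₃.presheaf.obj (op (X.basicOpen h)))
    (hf : ∃ s, sec S.g _ s = res S.X₃ (le_sup_left.trans e.le : X.basicOpen f ≤ _) t)
    (hg : ∃ s, sec S.g _ s = res S.X₃ (le_sup_right.trans e.le : X.basicOpen g ≤ _) t) :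
    ∃ s, sec S.g _ s = t := by
  have := hS.mono_f
  obtain ⟨a, ha⟩ := hf
  obtain ⟨b, hb⟩ := hg
  have h0 : sec S.g _ (res S.X₂ inf_le_left a -
      res S.X₂ (inf_le_right : X.basicOpen f ⊓ X.basicOpen g ≤ _) b) = 0 := by
    rw [map_sub, sec_res, sec_res, ha, hb, res_res, res_res, sub_self]
  obtain ⟨c, hc⟩ := sec_exact hS.exact _ h0
  obtain ⟨p, q, rfl⟩ := hF f g h e c
  obtain ⟨s, hs, hs'⟩ := glue₂ (F := S.X₂) (le_sup_left.trans e.le) (le_sup_right.trans e.le) e.ge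
    (a - sec S.f _ p) (b - sec S.f _ q) (by
      rw [map_sub, map_sub, ← sec_res, ← sec_res]
      rw [map_sub] at hc
      rw [sub_eq_sub_iff_sub_eq_sub, ← hc])
  refine ⟨s, sections_ext fun z hz => ?_⟩
  rcases (e ▸ hz : z ∈ X.basicOpen f ⊔ X.basicOpen g) with hz' | hz'
  · rw [← gm_res (le_sup_left.trans e.le) hz', ← gm_res (le_sup_left.trans e.le) hz', ← sec_res, hs,
      map_sub, sec_zero_comp, sub_zero, ha]
  · rw [← gm_res (le_sup_right.trans e.le) hz', ← gm_res (le_sup_right.trans e.le) hz', ← sec_res,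
      hs', map_sub, sec_zero_comp, sub_zero, hb]

/-- The functions `a` such that `t` lifts over `D(ah)` form an ideal, closed under addition by
gluing. Since `t` lifts locally, no prime avoiding `h` contains this ideal, so a power of `h` lies
in it. The argument replaces the vanishing of first cohomology on affine opens. -/
theorem BasicGluing.sec_surjective (hU : IsAffineOpen U) {S : ShortComplex (AbSheaf X)}
    (hS : S.ShortExact) (hF : BasicGluing U S.X₁) (h : Γ(X, U)) :
    Function.Surjective (sec S.g (X.basicOpen h)) := by
  intro t
  have := hS.epi_g
  have hle : ∀ a : Γ(X, U), X.basicOpen (a * h) ≤ X.basicOpen h := fun a => by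
    rw [X.basicOpen_mul]; exact inf_le_right
  have mono : ∀ {V W : X.Opens} (hV : V ≤ W) (hW : W ≤ X.basicOpen h),
      (∃ s, sec S.g W s = res S.X₃ hW t) → ∃ s, sec S.g V s = res S.X₃ (hV.trans hW) t := by
    rintro V W hV hW ⟨s, hs⟩
    exact ⟨res _ hV s, by rw [sec_res, hs, res_res]⟩
  let J : Ideal Γ(X, U) :=
    { carrier := {a | ∃ s, sec S.g (X.basicOpen (a * h)) s = res S.X₃ (hle a) t}
      zero_mem' := by
        refine ⟨0, sections_ext fun z hz => ?_⟩
        rw [zero_mul, X.basicOpen_zero] at hz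
        exact hz.elim
      add_mem' := by
        intro a b ha hb
        have hla : X.basicOpen (a * ((a + b) * h)) ≤ X.basicOpen (a * h) := by
          simp only [X.basicOpen_mul]
          exact inf_le_inf le_rfl inf_le_right
        have hlb : X.basicOpen (b * ((a + b) * h)) ≤ X.basicOpen (b * h) := by
          simp only [X.basicOpen_mul]
          exact inf_le_inf le_rfl inf_le_right
        -- The multiples of `(a + b)h` by `a` and by `b` are used so that the two basic opens cover
        -- exactly `D((a + b)h)`. Where `a + b` is a unit in the local ring, `a` or `b` is.
        refine hF.exists_glue hS (f := a * ((a + b) * h)) (g := b * ((a + b) * h)) ?_ _ ?_ ?_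
        · apply le_antisymm
          · rw [X.basicOpen_mul a, X.basicOpen_mul b]
            exact sup_le inf_le_right inf_le_right
          · intro z hz
            have hz1 : z ∈ X.basicOpen (a + b) := by
              rw [X.basicOpen_mul] at hz
              exact hz.1
            rw [X.basicOpen_mul a, X.basicOpen_mul b]
            rcases mem_basicOpen_add hz1 with h1 | h1
            · exact Or.inl ⟨h1, hz⟩
            · exact Or.inr ⟨h1, hz⟩
        · rw [res_res]
          exact mono hla (hle a) ha
        · rw [res_res]
          exact mono hlb (hle b) hb
      smul_mem' := by
        intro c a ha
        refine mono (V := X.basicOpen (c * a * h)) ?_ (hle a) ha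
        rw [mul_assoc, X.basicOpen_mul]
        exact inf_le_right }
  have hJ : h ∈ J.radical := by
    rw [Ideal.radical_eq_sInf, Submodule.mem_sInf]
    rintro P ⟨hJP, hP⟩
    by_contra hh
    obtain ⟨z, hzU, hz⟩ := exists_point_of_isAffineOpen hU ⟨P, hP⟩
    have hzh : z ∈ X.basicOpen h := (hz h).mpr hh
    obtain ⟨V, hV, s, hzV, hs⟩ := exists_sec_eq_res S.g hzh (sm_surjective S.g z) t
    obtain ⟨a, haV, hza⟩ := hU.exists_basicOpen_le ⟨z, hzV⟩ hzU
    refine (hz a).mp hza (hJP ?_)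
    exact mono ((by rw [X.basicOpen_mul]; exact inf_le_left.trans haV)) hV ⟨s, hs⟩
  obtain ⟨n, hn⟩ := hJ
  have hD : X.basicOpen h ≤ X.basicOpen (h ^ n * h) := by
    rw [← pow_succ, X.basicOpen_pow _ n.succ_pos]
  obtain ⟨s, hs⟩ := mono hD (hle _) hn
  exact ⟨s, by rw [hs, res_self]⟩

theorem restrictTo_comp_zero {Y : TopCat.{u}} {S : ShortComplex (AbSheaf Y)} (D : Opens Y) :
    restrictToMap D S.f ≫ restrictToMap D S.g = 0 :=
  sheafHom_ext fun V s => sec_zero_comp (S := S) (U := V ⊓ D) s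

theorem restrictTo_mono {Y : TopCat.{u}} {F G : AbSheaf Y} (α : F ⟶ G) [Mono α] (D : Opens Y) :
    Mono (restrictToMap D α) :=
  mono_of_sec_injective _ fun V => sec_injective α (V ⊓ D)

theorem restrictTo_exact {Y : TopCat.{u}} {S : ShortComplex (AbSheaf Y)} (hS : S.Exact) [Mono S.f]
    (D : Opens Y) (z : Y) (t : (restrictTo D S.X₂).presheaf.stalk z)
    (ht : sm (restrictToMap D S.g) z t = 0) : ∃ r, sm (restrictToMap D S.f) z r = t := by
  obtain ⟨V, hV, s, rfl⟩ := exists_gm_eq t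
  have h0 : gm (restrictTo D S.X₃) hV (sec (restrictToMap D S.g) V s) =
      gm (restrictTo D S.X₃) hV 0 := (sm_gm _ hV s).symm.trans (ht.trans (map_zero _).symm)
  obtain ⟨W, hWV, _, hW, e⟩ := gm_eq _ _ _ _ h0
  have e' : sec S.g (W ⊓ D) (res S.X₂ (inf_le_inf_right D hWV) s) = 0 :=
    (sec_res (restrictToMap D S.g) hWV s).trans (e.trans (map_zero _))
  obtain ⟨r, hr⟩ := sec_exact hS _ e'
  have hr' : sec (restrictToMap D S.f) W r = res (restrictTo D S.X₂) hWV s := hr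
  exact ⟨gm (restrictTo D S.X₁) hW r, (sm_gm _ hW _).trans ((congrArg _ hr').trans (gm_res hWV hW s))⟩

theorem restrictTo_surjective {F G : AbSheaf X} (α : F ⟶ G) (hU : IsAffineOpen U)
    (h : ∀ g : Γ(X, U), Function.Surjective (sec α (X.basicOpen g))) (f : Γ(X, U)) (z : X)
    (hz : z ∈ U) : Function.Surjective (sm (restrictToMap (X.basicOpen f) α) z) := by
  intro t
  obtain ⟨V, hV, s, rfl⟩ := exists_gm_eq t
  obtain ⟨g, hgV, hg⟩ := hU.exists_basicOpen_le ⟨z, hV⟩ hz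
  have key : ∀ (W : X.Opens) (_ : W = X.basicOpen (g * f)) (s : G.presheaf.obj (op W)),
      ∃ t, sec α W t = s := by
    rintro W rfl s
    exact h _ s
  obtain ⟨r, hr⟩ := key _ (X.basicOpen_mul g f).symm
    (res (restrictTo (X.basicOpen f) G) hgV s)
  exact ⟨gm (restrictTo (X.basicOpen f) F) hg r,
    (sm_gm _ hg _).trans ((congrArg _ hr).trans (gm_res _ hg s))⟩

/-- Only surjectivity needs an argument: stalks over `U` are computed on basic opens `D(g)`, where
the sections involved live on `D(gf)` and lift by `BasicGluing.sec_surjective`. -/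
theorem restrictTo_shortExactOn (hU : IsAffineOpen U) {S : ShortComplex (AbSheaf X)}
    (hS : S.ShortExact) (hF : BasicGluing U S.X₁) (f : Γ(X, U)) :
    ShortExactOn U (ShortComplex.mk (restrictToMap (X.basicOpen f) S.f)
      (restrictToMap (X.basicOpen f) S.g) (restrictTo_comp_zero _)) :=
  have := hS.mono_f
  have := restrictTo_mono S.f (X.basicOpen f)
  { inj := fun z _ => sm_injective (restrictToMap (X.basicOpen f) S.f) z
    exact := fun z _ => restrictTo_exact hS.exact _ z
    surj := restrictTo_surjective S.g hU (fun _ => hF.sec_surjective hU hS _) f }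

/-- If sections of `F` on basic open subsets of an affine neighbourhood of `y` glue, then
the sections of `F` away from the zeros of a function vanishing at `y` have no local cohomology. -/
theorem BasicGluing.rZero_restrictTo (hU : IsAffineOpen U) {y : X} (hy : y ∈ U) (f : Γ(X, U))
    (hf : y ∉ X.basicOpen f) (i : ℕ) {F : AbSheaf X} (hF : BasicGluing U F) :
    RZero (germsWithSupportFunctor y) i (restrictTo (X.basicOpen f) F) := by
  induction i generalizing F with
  | zero =>
    rw [rZero_zero_iff]
    have : Subsingleton ((germsWithSupportFunctor y).obj (restrictTo (X.basicOpen f) F)) := by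
      refine subsingleton_of_forall_eq 0 ?_
      rintro ⟨t, ht⟩
      obtain ⟨V, hV, s, rfl, hs⟩ := mem_germsWithSupport.mp ht
      refine Subtype.ext ?_
      have h0 : s = 0 := by
        -- The closure of `y` does not meet `D(f)`, because `y` lies outside this open set. A
        -- section supported there vanishes at every point where it is defined.
        refine sections_ext (F := F) (U := V ⊓ X.basicOpen f) fun z hz => ?_
        have hzy : z ∉ closure {y} := fun h =>
          hf ((specializes_iff_mem_closure.mpr h).mem_open (X.basicOpen f).isOpen hz.2)
        have h1 := hs z hz.1 hzy
        rw [← map_zero (gm (restrictTo (X.basicOpen f) F) hz.1)] at h1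
        obtain ⟨W, hW, _, hzW, e⟩ := gm_eq _ _ _ _ h1
        rw [map_zero] at e
        have h2 := gm_res (F := F) (inf_le_inf_right (X.basicOpen f) hW) ⟨hzW, hz.2⟩ s
        exact h2.symm.trans ((congrArg (gm F _) e).trans ((map_zero _).trans (map_zero _).symm))
      exact (congrArg (gm (restrictTo (X.basicOpen f) F) hV) h0).trans (map_zero _)
    exact AddCommGrpCat.isZero_of_subsingleton _
  | succ i ih =>
    have hS := under_shortExact F
    set S := ShortComplex.mk (Injective.ι F) (cokernel.π (Injective.ι F)) (cokernel.condition _)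
    have h1 : S.X₂.IsFlasque := isFlasque_of_injective (Injective.under F)
    have hR := restrictTo_shortExactOn hU hS hF f
    -- The middle term stays flasque after restriction, so the degree drops by one; gluing passes to
    -- the quotient because sections of the flasque sheaf surject on basic opens.
    refine hR.left hy (ih ?_) (rZero_succ_of_isFlasque y i (restrictTo (X.basicOpen f) S.X₂))
    exact basicGluing_of_epi S.g fun h => hF.sec_surjective hU hS h

end BasicGluing

/-! ### Quasi-coherent sheaves on an affine open subset -/

section QuasiCoherent

variable {X : Scheme.{u}} {U : X.Opens} (hU : IsAffineOpen U)

/-- The extension to `X` of the quasi-coherent sheaf on an affine open subset `U` attached to a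
module over the functions on `U`. -/
def qcSheaf (M : ModuleCat.{u} Γ(X, U)) : AbSheaf X :=
  (TopCat.Sheaf.pushforward AddCommGrpCat.{u} hU.fromSpec.base).obj
    ((sheafCompose _ (forget₂ (ModuleCat.{u} Γ(X, U)) AddCommGrpCat.{u})).obj
      (modulesSpecToSheaf.obj (tilde M)))

variable {hU} {M N P : ModuleCat.{u} Γ(X, U)}

instance (V : X.Opens) : Module Γ(X, U) ((qcSheaf hU M).presheaf.obj (op V)) :=
  inferInstanceAs (Module Γ(X, U)
    ((modulesSpecToSheaf.obj (tilde M)).obj.obj (op (hU.fromSpec ⁻¹ᵁ V))))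

theorem res_smul {V W : X.Opens} (h : W ≤ V) (r : Γ(X, U))
    (s : (qcSheaf hU M).presheaf.obj (op V)) :
    res (qcSheaf hU M) h (r • s) = r • res (qcSheaf hU M) h s :=
  ((modulesSpecToSheaf.obj (tilde M)).obj.map
    (homOfLE (hU.fromSpec.preimage_mono h)).op).hom.map_smul r s

variable (M) in
/-- The section over `V` given by an element of the module. -/
def toSec (V : X.Opens) : M →ₗ[Γ(X, U)] (qcSheaf hU M).presheaf.obj (op V) :=
  (tilde.toOpen M (hU.fromSpec ⁻¹ᵁ V)).hom

theorem res_toSec {V W : X.Opens} (h : W ≤ V) (m : M) :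
    res (qcSheaf hU M) h (toSec M V m) = toSec M W m := rfl

instance (g : Γ(X, U)) : IsLocalizedModule.Away g (toSec (hU := hU) M (X.basicOpen g)) := by
  have key : ∀ (W : (Spec Γ(X, U)).Opens) (_ : W = PrimeSpectrum.basicOpen g),
      IsLocalizedModule.Away g (tilde.toOpen M W).hom := by
    rintro W rfl
    infer_instance
  exact key _ (hU.fromSpec_preimage_basicOpen g)

theorem smul_bijective {V : X.Opens} {g : Γ(X, U)} (h : V ≤ X.basicOpen g) :
    Function.Bijective fun s : (qcSheaf hU M).presheaf.obj (op V) => g • s := by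
  have h1 := hU.fromSpec.preimage_mono h
  rw [hU.fromSpec_preimage_basicOpen] at h1
  exact (Module.End.isUnit_iff _).mp
    (Scheme.Modules.isUnit_algebraMap_end_of_le_basicOpen (M := tilde M) g h1)

theorem smul_pow_bijective {V : X.Opens} {g : Γ(X, U)} (h : V ≤ X.basicOpen g) (n : ℕ) :
    Function.Bijective fun s : (qcSheaf hU M).presheaf.obj (op V) => g ^ n • s := by
  induction n with
  | zero => simp only [pow_zero, one_smul]; exact Function.bijective_id
  | succ n ih =>
    have : (fun s : (qcSheaf hU M).presheaf.obj (op V) => g ^ (n + 1) • s) =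
        (fun s => g • s) ∘ fun s => g ^ n • s := by
      funext s
      simp only [Function.comp_apply, smul_smul, pow_succ']
    rw [this]
    exact (smul_bijective h).comp ih

theorem exists_toSec_eq {g : Γ(X, U)} (s : (qcSheaf hU M).presheaf.obj (op (X.basicOpen g))) :
    ∃ (n : ℕ) (m : M), g ^ n • s = toSec M _ m := by
  obtain ⟨⟨m, ⟨_, n, rfl⟩⟩, h⟩ := IsLocalizedModule.surj (Submonoid.powers g)
    (toSec M (X.basicOpen g)) s
  exact ⟨n, m, h⟩

theorem exists_of_toSec_eq_zero {g : Γ(X, U)} {m : M}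
    (h : (toSec M (X.basicOpen g) m : (qcSheaf hU M).presheaf.obj _) = 0) :
    ∃ n : ℕ, g ^ n • m = 0 := by
  obtain ⟨⟨_, n, rfl⟩, h⟩ := (IsLocalizedModule.eq_zero_iff (Submonoid.powers g)
    (toSec M (X.basicOpen g))).mp h
  exact ⟨n, h⟩

variable (hU) in
/-- Functoriality of the quasi-coherent sheaf attached to a module. -/
def qcMap (φ : M ⟶ N) : qcSheaf hU M ⟶ qcSheaf hU N :=
  (TopCat.Sheaf.pushforward AddCommGrpCat.{u} hU.fromSpec.base).map
    ((sheafCompose _ (forget₂ (ModuleCat.{u} Γ(X, U)) AddCommGrpCat.{u})).map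
      (modulesSpecToSheaf.map (tilde.map φ)))

theorem sec_qcMap_smul (φ : M ⟶ N) (V : X.Opens) (r : Γ(X, U))
    (s : (qcSheaf hU M).presheaf.obj (op V)) :
    sec (qcMap hU φ) V (r • s) = r • sec (qcMap hU φ) V s :=
  ((modulesSpecToSheaf.map (tilde.map φ)).hom.app (op (hU.fromSpec ⁻¹ᵁ V))).hom.map_smul r s

theorem sec_qcMap_toSec (φ : M ⟶ N) (V : X.Opens) (m : M) :
    sec (qcMap hU φ) V (toSec M V m) = toSec N V (φ.hom m) :=
  ConcreteCategory.congr_hom (tilde.toOpen_map_app φ (hU.fromSpec ⁻¹ᵁ V)) m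

/-- Sections over `D(g)` become elements of the module after multiplication by a power of `g`, which
acts bijectively. The same clearing of denominators gives surjectivity and exactness below. -/
theorem sec_qcMap_injective (φ : M ⟶ N) (hφ : Function.Injective φ.hom) (g : Γ(X, U)) :
    Function.Injective (sec (qcMap hU φ) (X.basicOpen g)) := by
  rw [injective_iff_map_eq_zero]
  intro s hs
  obtain ⟨n, m, h⟩ := exists_toSec_eq s
  have h1 := congrArg (sec (qcMap hU φ) (X.basicOpen g)) h
  rw [sec_qcMap_smul, hs, smul_zero, sec_qcMap_toSec] at h1
  obtain ⟨k, hk⟩ := exists_of_toSec_eq_zero h1.symm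
  rw [← map_smul, map_eq_zero_iff _ hφ] at hk
  apply (smul_pow_bijective (le_refl (X.basicOpen g)) (k + n)).1
  simp only [smul_zero, pow_add, mul_smul]
  rw [h, ← map_smul, hk, map_zero]

theorem sec_qcMap_surjective (φ : M ⟶ N) (hφ : Function.Surjective φ.hom) (g : Γ(X, U)) :
    Function.Surjective (sec (qcMap hU φ) (X.basicOpen g)) := by
  intro s
  obtain ⟨n, m, h⟩ := exists_toSec_eq s
  obtain ⟨m, rfl⟩ := hφ m
  obtain ⟨t, ht⟩ := (smul_pow_bijective (le_refl (X.basicOpen g)) n).2 (toSec (hU := hU) M _ m)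
  refine ⟨t, (smul_pow_bijective (le_refl (X.basicOpen g)) n).1 ?_⟩
  change g ^ n • sec (qcMap hU φ) (X.basicOpen g) t = g ^ n • s
  rw [← sec_qcMap_smul, h, ← sec_qcMap_toSec]
  exact congrArg _ ht

theorem sec_qcMap_exact (φ : M ⟶ N) (ψ : N ⟶ P) (h : Function.Exact φ.hom ψ.hom) (g : Γ(X, U))
    (s : (qcSheaf hU N).presheaf.obj (op (X.basicOpen g)))
    (hs : sec (qcMap hU ψ) (X.basicOpen g) s = 0) :
    ∃ t, sec (qcMap hU φ) (X.basicOpen g) t = s := by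
  obtain ⟨n, m, e⟩ := exists_toSec_eq s
  have h1 := congrArg (sec (qcMap hU ψ) (X.basicOpen g)) e
  rw [sec_qcMap_smul, hs, smul_zero, sec_qcMap_toSec] at h1
  obtain ⟨k, hk⟩ := exists_of_toSec_eq_zero h1.symm
  rw [← map_smul] at hk
  obtain ⟨r, hr⟩ := (h _).mp hk
  obtain ⟨t, ht⟩ := (smul_pow_bijective (le_refl (X.basicOpen g)) (k + n)).2 (toSec (hU := hU) M _ r)
  refine ⟨t, (smul_pow_bijective (le_refl (X.basicOpen g)) (k + n)).1 ?_⟩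
  change g ^ (k + n) • sec (qcMap hU φ) (X.basicOpen g) t = g ^ (k + n) • s
  rw [← sec_qcMap_smul, pow_add, mul_smul (g ^ k) (g ^ n) s, e, ← map_smul, ← hr, ← sec_qcMap_toSec,
    ← pow_add]
  exact congrArg _ ht

/-- Short exactness near the points of an affine open subset can be checked on basic opens. -/
theorem shortExactOn_of_basicOpen (hU : IsAffineOpen U) {S : ShortComplex (AbSheaf X)}
    (h₁ : ∀ g : Γ(X, U), Function.Injective (sec S.f (X.basicOpen g)))
    (h₂ : ∀ (g : Γ(X, U)) t, sec S.g (X.basicOpen g) t = 0 → ∃ r, sec S.f (X.basicOpen g) r = t)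
    (h₃ : ∀ g : Γ(X, U), Function.Surjective (sec S.g (X.basicOpen g))) : ShortExactOn U S := by
  have key : ∀ (F : AbSheaf X) (z : X) (_ : z ∈ U) (t : F.presheaf.stalk z),
      ∃ (g : Γ(X, U)) (hg : z ∈ X.basicOpen g) (s : F.presheaf.obj (op (X.basicOpen g))),
        gm F hg s = t := by
    intro F z hz t
    obtain ⟨V, hV, s, rfl⟩ := exists_gm_eq t
    obtain ⟨g, hgV, hg⟩ := hU.exists_basicOpen_le ⟨z, hV⟩ hz
    exact ⟨g, hg, res F hgV s, gm_res _ _ _⟩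
  have key0 : ∀ (F : AbSheaf X) (z : X) (_ : z ∈ U) (V : X.Opens) (hV : z ∈ V)
      (s : F.presheaf.obj (op V)), gm F hV s = 0 →
      ∃ (g : Γ(X, U)) (_ : z ∈ X.basicOpen g) (hgV : X.basicOpen g ≤ V), res F hgV s = 0 := by
    intro F z hz V hV s hs
    rw [← map_zero (gm F hV)] at hs
    obtain ⟨W, hWV, _, hzW, e⟩ := gm_eq _ _ _ _ hs
    obtain ⟨g, hgW, hg⟩ := hU.exists_basicOpen_le ⟨z, hzW⟩ hz
    refine ⟨g, hg, hgW.trans hWV, ?_⟩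
    rw [← res_res hWV hgW, e, map_zero, map_zero]
  refine ⟨fun z hz => ?_, fun z hz t ht => ?_, fun z hz t => ?_⟩
  · rw [injective_iff_map_eq_zero]
    intro t ht
    obtain ⟨V, hV, s, rfl⟩ := exists_gm_eq t
    rw [sm_gm] at ht
    obtain ⟨g, hg, hgV, e⟩ := key0 _ z hz _ _ _ ht
    rw [← sec_res] at e
    have := (injective_iff_map_eq_zero _).mp (h₁ g) _ e
    rw [← gm_res hgV hg, this, map_zero]
  · obtain ⟨V, hV, s, rfl⟩ := exists_gm_eq t
    rw [sm_gm] at ht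
    obtain ⟨g, hg, hgV, e⟩ := key0 _ z hz _ _ _ ht
    rw [← sec_res] at e
    obtain ⟨r, hr⟩ := h₂ g _ e
    exact ⟨gm _ hg r, by rw [sm_gm, hr, gm_res]⟩
  · obtain ⟨g, hg, s, rfl⟩ := key _ z hz t
    obtain ⟨r, rfl⟩ := h₃ g s
    exact ⟨gm _ hg r, sm_gm _ _ _⟩

/-- A morphism of presheaves bijective on sections over basic opens of `U` is bijective on stalks
over `U`. -/
theorem stalk_bijective_of_basicOpen (hU : IsAffineOpen U)
    {P Q : TopCat.Presheaf AddCommGrpCat.{u} X} (γ : P ⟶ Q)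
    (h : ∀ g : Γ(X, U), Function.Bijective (γ.app (op (X.basicOpen g)))) (z : X) (hz : z ∈ U) :
    Function.Bijective ((TopCat.Presheaf.stalkFunctor AddCommGrpCat.{u} z).map γ) := by
  constructor
  · refine (injective_iff_map_eq_zero
      ((TopCat.Presheaf.stalkFunctor AddCommGrpCat.{u} z).map γ).hom).mpr fun t ht => ?_
    obtain ⟨V, hV, s, rfl⟩ := P.exists_germ_eq t
    have ht' : Q.germ V z hV (γ.app (op V) s) = Q.germ V z hV 0 := by
      rw [map_zero, ← TopCat.Presheaf.stalkFunctor_map_germ_apply]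
      exact ht
    obtain ⟨W, hzW, iV, _, e⟩ := Q.germ_eq z hV hV _ _ ht'
    obtain ⟨g, hgW, hg⟩ := hU.exists_basicOpen_le ⟨z, hzW⟩ hz
    have e' : γ.app (op (X.basicOpen g)) (P.map (homOfLE hgW ≫ iV).op s) = 0 := by
      have := congrArg (Q.map (homOfLE hgW).op) e
      rw [map_zero, map_zero] at this
      rw [← this, ← CategoryTheory.comp_apply, γ.naturality, CategoryTheory.comp_apply, op_comp,
        Q.map_comp]
      rfl
    have h0 := (h g).1 (e'.trans (map_zero (γ.app (op (X.basicOpen g))).hom).symm)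
    rw [← P.germ_res_apply (homOfLE hgW ≫ iV) z hg s, h0]
    exact map_zero _
  · intro t
    obtain ⟨V, hV, s, rfl⟩ := Q.exists_germ_eq t
    obtain ⟨g, hgV, hg⟩ := hU.exists_basicOpen_le ⟨z, hV⟩ hz
    obtain ⟨r, hr⟩ := (h g).2 (Q.map (homOfLE hgV).op s)
    refine ⟨P.germ _ z hg r, ?_⟩
    rw [TopCat.Presheaf.stalkFunctor_map_germ_apply, hr]
    exact Q.germ_res_apply (homOfLE hgV) z hg s

theorem sm_bijective_of_basicOpen (hU : IsAffineOpen U) {F G : AbSheaf X} (α : F ⟶ G)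
    (h : ∀ g : Γ(X, U), Function.Bijective (sec α (X.basicOpen g))) (z : X) (hz : z ∈ U) :
    Function.Bijective (sm α z) :=
  stalk_bijective_of_basicOpen hU α.hom h z hz

theorem qcMap_shortExactOn (φ : M ⟶ N) (ψ : N ⟶ P) (hφ : Function.Injective φ.hom)
    (h : Function.Exact φ.hom ψ.hom) (hψ : Function.Surjective ψ.hom)
    (w : qcMap hU φ ≫ qcMap hU ψ = 0) : ShortExactOn U (ShortComplex.mk _ _ w) :=
  shortExactOn_of_basicOpen hU (sec_qcMap_injective φ hφ) (sec_qcMap_exact φ ψ h)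
    (sec_qcMap_surjective ψ hψ)

theorem qcMap_comp (φ : M ⟶ N) (ψ : N ⟶ P) :
    qcMap hU (φ ≫ ψ) = qcMap hU φ ≫ qcMap hU ψ := by
  refine sheafHom_ext fun V s => ?_
  rw [sec_comp]
  exact ConcreteCategory.congr_hom (congrArg (fun α : tilde M ⟶ tilde P =>
    (modulesSpecToSheaf.map α).hom.app (op (hU.fromSpec ⁻¹ᵁ V))) (tilde.map_comp φ ψ)) s

theorem qcMap_comp_eq_zero (φ : M ⟶ N) (ψ : N ⟶ P) (w : φ ≫ ψ = 0) :
    qcMap hU φ ≫ qcMap hU ψ = 0 := by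
  rw [← qcMap_comp, w]
  refine sheafHom_ext fun V s => ?_
  rw [sec_zero]
  exact ConcreteCategory.congr_hom (congrArg (fun α : tilde M ⟶ tilde P =>
    (modulesSpecToSheaf.map α).hom.app (op (hU.fromSpec ⁻¹ᵁ V))) tilde.map_zero) s

theorem exists_pow_eq_of_basicOpen_sup (hU : IsAffineOpen U) {f g h : Γ(X, U)}
    (e : X.basicOpen f ⊔ X.basicOpen g = X.basicOpen h) (n : ℕ) :
    ∃ (k : ℕ) (a b : Γ(X, U)), a * f ^ n + b * g ^ n = h ^ k := by
  have : h ∈ (Ideal.span {f ^ n, g ^ n}).radical := by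
    rw [Ideal.radical_eq_sInf, Submodule.mem_sInf]
    rintro Q ⟨hQ, hQp⟩
    by_contra hh
    obtain ⟨z, hzU, hz⟩ := exists_point_of_isAffineOpen hU ⟨Q, hQp⟩
    have hzh : z ∈ X.basicOpen h := (hz h).mpr hh
    have hmem : ∀ a ∈ ({f ^ n, g ^ n} : Set Γ(X, U)), a ∈ Q := fun a ha =>
      hQ (Ideal.subset_span ha)
    rcases (e.symm ▸ hzh : z ∈ X.basicOpen f ⊔ X.basicOpen g) with h1 | h1
    · exact (hz f).mp h1 (hQp.mem_of_pow_mem n (hmem _ (by simp)))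
    · exact (hz g).mp h1 (hQp.mem_of_pow_mem n (hmem _ (by simp)))
  obtain ⟨k, hk⟩ := this
  obtain ⟨a, b, hab⟩ := Ideal.mem_span_pair.mp hk
  exact ⟨k, a, b, hab⟩

/-- A partition of unity splits a section `m / (fg)ⁿ`: some power of `h` is a combination of `fⁿ`
and `gⁿ`, and `h` is invertible on both opens. -/
theorem qcSheaf_basicGluing (M : ModuleCat.{u} Γ(X, U)) : BasicGluing U (qcSheaf hU M) := by
  intro f g h e s
  have hs : ∃ (n : ℕ) (m : M), (f * g) ^ n • s = toSec M _ m := by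
    have key : ∀ (V : X.Opens) (_ : V = X.basicOpen (f * g))
        (s : (qcSheaf hU M).presheaf.obj (op V)), ∃ (n : ℕ) (m : M), (f * g) ^ n • s = toSec M _ m := by
      rintro V rfl s
      exact exists_toSec_eq s
    exact key _ (X.basicOpen_mul f g).symm s
  obtain ⟨n, m, hm⟩ := hs
  obtain ⟨k, a, b, hab⟩ := exists_pow_eq_of_basicOpen_sup hU e n
  -- With `a fⁿ + b gⁿ = hᵏ`, the two pieces are `p = a m / (hᵏ gⁿ)` on `D(g)` and `q = b m / (hᵏ
  -- fⁿ)` on `D(f)`, with `p + q = m / (fg)ⁿ` on the overlap.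
  obtain ⟨p, hp⟩ := (smul_pow_bijective (hU := hU) (M := M) (le_sup_right.trans e.le) k).2
    (a • toSec M (X.basicOpen g) m)
  obtain ⟨p, rfl⟩ := (smul_pow_bijective (hU := hU) (M := M) (le_refl (X.basicOpen g)) n).2 p
  obtain ⟨q, hq⟩ := (smul_pow_bijective (hU := hU) (M := M) (le_sup_left.trans e.le) k).2
    (b • toSec M (X.basicOpen f) m)
  obtain ⟨q, rfl⟩ := (smul_pow_bijective (hU := hU) (M := M) (le_refl (X.basicOpen f)) n).2 q
  refine ⟨q, -p, ?_⟩
  have hp' := congrArg (res (qcSheaf hU M) (inf_le_right : X.basicOpen f ⊓ X.basicOpen g ≤ _)) hp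
  have hq' := congrArg (res (qcSheaf hU M) (inf_le_left : X.basicOpen f ⊓ X.basicOpen g ≤ _)) hq
  simp only [res_smul, res_toSec] at hp' hq'
  rw [map_neg, sub_neg_eq_add]
  apply (smul_pow_bijective (hU := hU) (M := M)
    (inf_le_left.trans (le_sup_left.trans e.le) : X.basicOpen f ⊓ X.basicOpen g ≤ X.basicOpen h) k).1
  apply (smul_pow_bijective (hU := hU) (M := M)
    ((X.basicOpen_mul f g).ge : X.basicOpen f ⊓ X.basicOpen g ≤ X.basicOpen (f * g)) n).1
  change (f * g) ^ n • h ^ k • s = (f * g) ^ n • h ^ k • (_ + _)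
  have e1 : ∀ p : (qcSheaf hU M).presheaf.obj (op (X.basicOpen f ⊓ X.basicOpen g)),
      (f * g) ^ n • h ^ k • p = f ^ n • h ^ k • g ^ n • p := fun p => by
    simp only [smul_smul]; ring_nf
  have e2 : ∀ q : (qcSheaf hU M).presheaf.obj (op (X.basicOpen f ⊓ X.basicOpen g)),
      (f * g) ^ n • h ^ k • q = g ^ n • h ^ k • f ^ n • q := fun q => by
    simp only [smul_smul]; ring_nf
  rw [smul_comm, hm, smul_add, smul_add, e2, e1 (res _ _ p), ← hab, add_smul, hab, hp', hq', smul_smul,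
    smul_smul, add_comm, mul_comm a, mul_comm b]

/-- If `f` acts bijectively on `M`, the sheaf attached to `M` only depends on its restriction to
`D(f)`. -/
theorem toRestrictTo_bijective (M : ModuleCat.{u} Γ(X, U)) (f : Γ(X, U))
    (hf : Function.Bijective fun m : M => f • m) (g : Γ(X, U)) :
    Function.Bijective (sec (toRestrictTo (X.basicOpen f) (qcSheaf hU M)) (X.basicOpen g)) := by
  have hfn : ∀ n : ℕ, Function.Bijective fun m : M => f ^ n • m := by
    intro n
    induction n with
    | zero => simp only [pow_zero, one_smul]; exact Function.bijective_id
    | succ n ih =>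
      have : (fun m : M => f ^ (n + 1) • m) = (fun m => f • m) ∘ fun m => f ^ n • m := by
        funext s
        simp only [Function.comp_apply, smul_smul, pow_succ']
      rw [this]
      exact hf.comp ih
  have key : ∀ (V : X.Opens) (_ : V = X.basicOpen (g * f)) (hV : V ≤ X.basicOpen g),
      Function.Bijective (res (qcSheaf hU M) hV) := by
    rintro V rfl hV
    constructor
    · rw [injective_iff_map_eq_zero]
      intro s hs
      obtain ⟨n, m, h⟩ := exists_toSec_eq s
      have h1 := congrArg (res (qcSheaf hU M) hV) h
      rw [res_smul, hs, smul_zero, res_toSec] at h1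
      obtain ⟨k, hk⟩ := exists_of_toSec_eq_zero h1.symm
      rw [mul_pow, mul_comm, mul_smul] at hk
      have hk' : g ^ k • m = 0 := (hfn k).1 (by
        change f ^ k • (g ^ k • m) = f ^ k • (0 : M)
        rw [smul_zero]; exact hk)
      apply (smul_pow_bijective (le_refl (X.basicOpen g)) (k + n)).1
      simp only [smul_zero, pow_add, mul_smul]
      rw [h, ← map_smul, hk', map_zero]
    · intro s
      obtain ⟨n, m, h⟩ := exists_toSec_eq s
      obtain ⟨m, rfl⟩ := (hfn n).2 m
      obtain ⟨t, ht⟩ := (smul_pow_bijective (le_refl (X.basicOpen g)) n).2 (toSec (hU := hU) M _ m)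
      refine ⟨t, (smul_pow_bijective (le_refl (X.basicOpen (g * f))) n).1 ?_⟩
      have ht' := congrArg (res (qcSheaf hU M) hV) ht
      simp only [res_smul, res_toSec] at ht'
      change (g * f) ^ n • res (qcSheaf hU M) hV t = (g * f) ^ n • s
      rw [h, mul_pow, mul_comm (g ^ n) (f ^ n), mul_smul, ht']
      exact (map_smul _ _ _).symm
  exact key _ (X.basicOpen_mul g f).symm _

theorem rZero_qcSheaf_of_bijective {y : X} (hy : y ∈ U) (M : ModuleCat.{u} Γ(X, U)) (f : Γ(X, U))
    (hfy : y ∉ X.basicOpen f) (hf : Function.Bijective fun m : M => f • m) (i : ℕ) :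
    RZero (germsWithSupportFunctor y) i (qcSheaf hU M) :=
  (rZero_iff_of_bijective hy (toRestrictTo (X.basicOpen f) (qcSheaf hU M))
    (sm_bijective_of_basicOpen hU _ (toRestrictTo_bijective M f hf)) i).mpr
    ((qcSheaf_basicGluing M).rZero_restrictTo hU hy f hfy i)

end QuasiCoherent

/-! ### Weakly regular sequences on extensions, unions and `M_f / M` -/

section WeaklyRegular

open RingTheory.Sequence Pointwise

variable {R : Type u} [CommRing R]

theorem _root_.RingTheory.Sequence.IsWeaklyRegular.of_exact {M₁ M₂ M₃ : Type v}
    [AddCommGroup M₁] [Module R M₁] [AddCommGroup M₂] [Module R M₂] [AddCommGroup M₃] [Module R M₃]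
    {i : M₁ →ₗ[R] M₂} {p : M₂ →ₗ[R] M₃} (hi : Function.Injective i) (hip : Function.Exact i p)
    (hp : Function.Surjective p) {rs : List R} (h₁ : IsWeaklyRegular M₁ rs)
    (h₃ : IsWeaklyRegular M₃ rs) : IsWeaklyRegular M₂ rs := by
  induction rs generalizing M₁ M₂ M₃ with
  | nil => exact IsWeaklyRegular.nil R M₂
  | cons r rs ih =>
    rw [isWeaklyRegular_cons_iff] at h₁ h₃ ⊢
    refine ⟨isSMulRegular_of_range_eq_ker hi hip.linearMap_ker_eq.symm h₁.1 h₃.1, ?_⟩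
    refine ih (i := QuotSMulTop.map r i) (p := QuotSMulTop.map r p) ?_
      (QuotSMulTop.map_exact r hip hp) (QuotSMulTop.map_surjective r hp) h₁.2 h₃.2
    have h0 : Function.Exact (0 : M₁ →ₗ[R] M₁) i := by
      intro x
      rw [map_eq_zero_iff i hi]
      exact ⟨fun h => ⟨0, h.symm⟩, fun ⟨_, h⟩ => h.symm⟩
    -- Regularity of `r` on `M₃` keeps the reduction modulo `r` exact on the left.
    have h1 := QuotSMulTop.map_first_exact_on_four_term_exact_of_isSMulRegular_last h0 hip h₃.1
    rw [map_zero] at h1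
    rw [injective_iff_map_eq_zero]
    intro x hx
    obtain ⟨y, hy⟩ := (h1 x).mp hx
    exact hy.symm

/-- Both an element and a witness that a multiple of it lies in an ideal multiple of `Q` already
live in a single member of the chain. -/
theorem isWeaklyRegular_of_directed {Q : Type v} [AddCommGroup Q] [Module R Q]
    (N : ℕ → Submodule R Q) (hN : Monotone N) (hQ : ∀ x, ∃ n, x ∈ N n) {rs : List R}
    (h : ∀ n, IsWeaklyRegular (N n) rs) : IsWeaklyRegular Q rs := by
  refine ⟨fun j hj => ?_⟩
  rw [isSMulRegular_quotient_iff_mem_of_smul_mem]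
  intro x hx
  have htop : (⊤ : Submodule R Q) = ⨆ n, N n := by
    refine (eq_top_iff.mpr fun x _ => ?_).symm
    obtain ⟨n, hn⟩ := hQ x
    exact Submodule.mem_iSup_of_mem n hn
  obtain ⟨n, hn⟩ := hQ x
  rw [htop, Submodule.smul_iSup, Submodule.mem_iSup_of_directed _
    (Monotone.directed_le fun a b hab => smul_mono_right _ (hN hab))] at hx
  obtain ⟨m, hm⟩ := hx
  have h1 := (isSMulRegular_quotient_iff_mem_of_smul_mem _ _).mp
    ((h (max n m)).regular_mod_prev j hj) ⟨x, hN (le_max_left n m) hn⟩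
  have key : ∀ z : N (max n m), z ∈ (Ideal.ofList (rs.take j) • ⊤ : Submodule R (N (max n m))) ↔
      (z : Q) ∈ Ideal.ofList (rs.take j) • N (max n m) := by
    intro z
    have : Ideal.ofList (rs.take j) • N (max n m) = Submodule.map (N (max n m)).subtype
        (Ideal.ofList (rs.take j) • ⊤ : Submodule R (N (max n m))) := by
      rw [Submodule.map_smul'', Submodule.map_top, Submodule.range_subtype]
    rw [this, Submodule.mem_map]
    exact ⟨fun hz => ⟨z, hz, rfl⟩, fun ⟨w, hw, e⟩ => Subtype.ext e ▸ hw⟩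
  rw [key, key] at h1
  have hle : Ideal.ofList (rs.take j) • N (max n m) ≤ Ideal.ofList (rs.take j) • ⊤ :=
    smul_mono_right _ le_top
  exact hle (h1 (smul_mono_right _ (hN (le_max_right n m)) hm))

/-- A module on which `f` acts surjectively and locally nilpotently has the same weakly regular
sequences as its `f`-torsion. -/
theorem isWeaklyRegular_of_torsionBy {Q : Type v} [AddCommGroup Q] [Module R Q] (f : R)
    (hf : Function.Surjective fun x : Q => f • x) (hQ : ∀ x : Q, ∃ n : ℕ, f ^ n • x = 0)
    {rs : List R} (h : IsWeaklyRegular (Submodule.torsionBy R Q f) rs) : IsWeaklyRegular Q rs := by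
  have hfn : ∀ (n : ℕ) (x : Q), ∃ y, f ^ n • y = x := by
    intro n
    induction n with
    | zero => exact fun x => ⟨x, by rw [pow_zero, one_smul]⟩
    | succ n ih =>
      intro x
      obtain ⟨y, rfl⟩ := ih x
      obtain ⟨z, rfl⟩ := hf y
      exact ⟨z, by rw [pow_succ, mul_smul]⟩
  have hmono : Monotone fun n : ℕ => Submodule.torsionBy R Q (f ^ n) := by
    intro a b hab x hx
    rw [Submodule.mem_torsionBy_iff] at hx ⊢
    obtain ⟨c, rfl⟩ := Nat.exists_eq_add_of_le' hab
    rw [pow_add, mul_smul, hx, smul_zero]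
  refine isWeaklyRegular_of_directed (fun n => Submodule.torsionBy R Q (f ^ n)) hmono
    (fun x => (hQ x).imp fun n hn => (Submodule.mem_torsionBy_iff _ _).mpr hn) fun n => ?_
  induction n with
  | zero =>
    have : Subsingleton (Submodule.torsionBy R Q (f ^ 0)) := by
      refine ⟨fun a b => Subtype.ext ?_⟩
      have key : ∀ a ∈ Submodule.torsionBy R Q (f ^ 0), a = 0 := fun a ha => by
        rwa [Submodule.mem_torsionBy_iff, pow_zero, one_smul] at ha
      rw [key a a.2, key b b.2]
    exact ⟨fun j _ => Function.injective_of_subsingleton _⟩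
  | succ n ih =>
    -- Multiplication by `fⁿ` gives `0 → Q[fⁿ] → Q[fⁿ⁺¹] → Q[f] → 0`, exact on the right because `f`
    -- acts surjectively.
    refine IsWeaklyRegular.of_exact (i := Submodule.inclusion (hmono n.le_succ))
      (p := (LinearMap.lsmul R Q (f ^ n)).restrict
        (p := Submodule.torsionBy R Q (f ^ (n + 1))) (q := Submodule.torsionBy R Q f) ?_)
      (Submodule.inclusion_injective _) ?_ ?_ ih h
    · intro x hx
      rw [Submodule.mem_torsionBy_iff] at hx ⊢
      rw [LinearMap.lsmul_apply, ← mul_smul, ← pow_succ', hx]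
    · intro x
      constructor
      · intro hx
        exact ⟨⟨x.1, (Submodule.mem_torsionBy_iff _ _).mpr (congrArg Subtype.val hx)⟩, rfl⟩
      · rintro ⟨y, rfl⟩
        exact Subtype.ext ((Submodule.mem_torsionBy_iff _ _).mp y.2)
    · intro x
      obtain ⟨y, hy⟩ := hfn n x.1
      refine ⟨⟨y, ?_⟩, Subtype.ext hy⟩
      rw [Submodule.mem_torsionBy_iff, pow_succ', mul_smul, hy]
      exact (Submodule.mem_torsionBy_iff _ _).mp x.2

/-- If `f` followed by `rs` is weakly regular on `M`, then `rs` is weakly regular on the cokernel of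
the localization `M → M_f`. -/
theorem isWeaklyRegular_away_quotient {M N : Type v} [AddCommGroup M] [Module R M]
    [AddCommGroup N] [Module R N] (φ : M →ₗ[R] N) (f : R) [IsLocalizedModule.Away f φ]
    {rs : List R} (h : IsWeaklyRegular M (f :: rs)) :
    IsWeaklyRegular (N ⧸ LinearMap.range φ) rs := by
  rw [isWeaklyRegular_cons_iff] at h
  obtain ⟨hf, h⟩ := h
  have hbij : Function.Bijective fun x : N => f • x := (Module.End.isUnit_iff _).mp
    (IsLocalizedModule.map_units φ (⟨f, 1, pow_one f⟩ : Submonoid.powers f))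
  have hφ : Function.Injective φ := by
    rw [injective_iff_map_eq_zero]
    intro m hm
    obtain ⟨⟨_, n, rfl⟩, hn⟩ := (IsLocalizedModule.eq_zero_iff (Submonoid.powers f) φ).mp hm
    exact (hf.pow n) (hn.trans (smul_zero _).symm)
  have hpow : ∀ x : N, ∃ n : ℕ, f ^ n • x ∈ LinearMap.range φ := by
    intro x
    obtain ⟨⟨m, ⟨_, n, rfl⟩⟩, e⟩ := IsLocalizedModule.surj (Submonoid.powers f) φ x
    exact ⟨n, m, e.symm⟩
  refine isWeaklyRegular_of_torsionBy f ?_ ?_ ?_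
  · intro x
    obtain ⟨x, rfl⟩ := Submodule.Quotient.mk_surjective _ x
    obtain ⟨y, rfl⟩ := hbij.2 x
    exact ⟨Submodule.Quotient.mk y, rfl⟩
  · intro x
    obtain ⟨x, rfl⟩ := Submodule.Quotient.mk_surjective _ x
    obtain ⟨n, hn⟩ := hpow x
    exact ⟨n, (Submodule.Quotient.mk_eq_zero _).mpr hn⟩
  · let e : N ≃ₗ[R] N := LinearEquiv.ofBijective (LinearMap.lsmul R N f) hbij
    have he : ∀ x, f • e.symm x = x := fun x => e.apply_symm_apply x
    -- The map `m ↦ m / f` induces `M / fM ≅ (M_f / M)[f]`, which transfers the hypothesis on the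
    -- rest of the sequence.
    let g : M →ₗ[R] Submodule.torsionBy R (N ⧸ LinearMap.range φ) f :=
      ((LinearMap.range φ).mkQ ∘ₗ e.symm.toLinearMap ∘ₗ φ).codRestrict _ fun m => by
        rw [Submodule.mem_torsionBy_iff, LinearMap.comp_apply, ← map_smul, Submodule.mkQ_apply,
          Submodule.Quotient.mk_eq_zero]
        exact ⟨m, (he _).symm⟩
    have hg : Function.Surjective g := by
      rintro ⟨x, hx⟩
      obtain ⟨x, rfl⟩ := Submodule.Quotient.mk_surjective _ x
      obtain ⟨m, hm⟩ := (Submodule.Quotient.mk_eq_zero _).mp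
        ((Submodule.mem_torsionBy_iff _ _).mp hx)
      refine ⟨m, Subtype.ext ?_⟩
      change Submodule.Quotient.mk (e.symm (φ m)) = Submodule.Quotient.mk x
      rw [hm]
      exact congrArg _ (e.symm_apply_apply x)
    have hker : LinearMap.ker g = f • (⊤ : Submodule R M) := by
      ext m
      have h0 : g m = 0 ↔ e.symm (φ m) ∈ LinearMap.range φ := by
        rw [← Submodule.Quotient.mk_eq_zero, Subtype.ext_iff]
        rfl
      rw [LinearMap.mem_ker, h0, Submodule.mem_smul_pointwise_iff_exists]
      constructor
      · rintro ⟨r, hr⟩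
        refine ⟨r, trivial, hφ ?_⟩
        rw [map_smul, hr, he]
      · rintro ⟨r, -, rfl⟩
        refine ⟨r, ?_⟩
        rw [map_smul]
        exact (e.symm_apply_apply (φ r)).symm
    exact (LinearEquiv.isWeaklyRegular_congr ((Submodule.quotEquivOfEq _ _ hker.symm).trans
      (g.quotKerEquivOfSurjective hg)) rs).mp h

end WeaklyRegular

/-! ### Local cohomology of quasi-coherent sheaves along a weakly regular sequence -/

section CohenMacaulay

open RingTheory.Sequence

variable {X : Scheme.{u}} {U : X.Opens} {hU : IsAffineOpen U}

theorem stalk_qcSheaf_eq_zero {M : ModuleCat.{u} Γ(X, U)} {z : X} (hz : z ∈ U)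
    (h : ∀ m : M, ∃ g : Γ(X, U), z ∈ X.basicOpen g ∧ g • m = 0)
    (t : (qcSheaf hU M).presheaf.stalk z) : t = 0 := by
  obtain ⟨V, hV, s, rfl⟩ := exists_gm_eq t
  obtain ⟨g, hgV, hg⟩ := hU.exists_basicOpen_le ⟨z, hV⟩ hz
  rw [← gm_res hgV hg]
  obtain ⟨n, m, e⟩ := exists_toSec_eq (res _ hgV s)
  obtain ⟨g', hg', hm⟩ := h m
  have e' := congrArg (res (qcSheaf hU M) (inf_le_left : X.basicOpen g ⊓ X.basicOpen g' ≤ _)) e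
  rw [res_smul, res_toSec, res_res] at e'
  have h0 : res (qcSheaf hU M) (inf_le_left.trans hgV : X.basicOpen g ⊓ X.basicOpen g' ≤ V) s = 0 := by
    apply (smul_pow_bijective (inf_le_left : X.basicOpen g ⊓ X.basicOpen g' ≤ _) n).1
    apply (smul_bijective (inf_le_right : X.basicOpen g ⊓ X.basicOpen g' ≤ _)).1
    simp only [smul_zero]
    rw [e', ← map_smul, hm, map_zero]
  have := gm_res (F := qcSheaf hU M) (inf_le_left.trans hgV : X.basicOpen g ⊓ X.basicOpen g' ≤ V)
    ⟨hg, hg'⟩ s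
  rw [h0, map_zero] at this
  rw [gm_res]
  exact this.symm

/-- Local cohomology at `y` of a quasi-coherent sheaf vanishes except in degree the length of a
weakly regular sequence that cuts out the closure of `y`. -/
theorem rZero_qcSheaf_of_isWeaklyRegular {y : X} (hy : y ∈ U) (fs : List Γ(X, U))
    (M : ModuleCat.{u} Γ(X, U)) (hM : IsWeaklyRegular M fs) (hfs : ∀ f ∈ fs, y ∉ X.basicOpen f)
    (hsupp : ∀ z ∈ U, z ∉ closure {y} → (∀ f ∈ fs, z ∉ X.basicOpen f) →
      ∀ m : M, ∃ g : Γ(X, U), z ∈ X.basicOpen g ∧ g • m = 0) (i : ℕ) (hi : i ≠ fs.length) :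
    RZero (germsWithSupportFunctor y) i (qcSheaf hU M) := by
  induction fs generalizing M i with
  | nil =>
    obtain ⟨i, rfl⟩ := Nat.exists_eq_succ_of_ne_zero hi
    refine rZero_succ_of_support (D := U ⊓ ⟨(closure {y})ᶜ, isClosed_closure.isOpen_compl⟩) hy
      (fun z hz hzy => ⟨hz, hzy⟩) i _ fun z hz t => ?_
    exact stalk_qcSheaf_eq_zero hz.1 (hsupp z hz.1 hz.2 (by simp)) t
  | cons f fs ih =>
    -- The sequence `0 → M → M_f → M_f / M → 0`. Its middle term has no local cohomology at `y` in
    -- any degree, so that of `M` is that of the quotient one degree lower.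
    let φ : M →ₗ[Γ(X, U)] LocalizedModule (Submonoid.powers f) M := LocalizedModule.mkLinearMap _ _
    let N := ModuleCat.of Γ(X, U) (LocalizedModule (Submonoid.powers f) M)
    let Q := ModuleCat.of Γ(X, U) (LocalizedModule (Submonoid.powers f) M ⧸ LinearMap.range φ)
    have hpow : ∀ x : LocalizedModule (Submonoid.powers f) M,
        ∃ (n : ℕ) (m : M), f ^ n • x = φ m := by
      intro x
      obtain ⟨⟨m, ⟨_, n, rfl⟩⟩, e⟩ := IsLocalizedModule.surj (Submonoid.powers f) φ x
      exact ⟨n, m, e⟩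
    have hbij : Function.Bijective fun x : N => f • x := (Module.End.isUnit_iff _).mp
      (IsLocalizedModule.map_units φ (⟨f, 1, pow_one f⟩ : Submonoid.powers f))
    have hf := ((isWeaklyRegular_cons_iff M f fs).mp hM).1
    have hφ : Function.Injective φ := by
      rw [injective_iff_map_eq_zero]
      intro m hm
      obtain ⟨⟨_, n, rfl⟩, hn⟩ := (IsLocalizedModule.eq_zero_iff (Submonoid.powers f) φ).mp hm
      exact (hf.pow n) (hn.trans (smul_zero _).symm)
    have hφψ : Function.Exact φ (LinearMap.range φ).mkQ := LinearMap.exact_map_mkQ_range φ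
    have w : qcMap hU (ModuleCat.ofHom φ : M ⟶ N) ≫
        qcMap hU (ModuleCat.ofHom (LinearMap.range φ).mkQ : N ⟶ Q) = 0 :=
      qcMap_comp_eq_zero _ _ (ModuleCat.hom_ext (LinearMap.ext fun m => hφψ.apply_apply_eq_zero m))
    have hS := qcMap_shortExactOn (hU := hU) (ModuleCat.ofHom φ : M ⟶ N)
      (ModuleCat.ofHom (LinearMap.range φ).mkQ : N ⟶ Q) hφ hφψ (Submodule.mkQ_surjective _) w
    have hN := rZero_qcSheaf_of_bijective (hU := hU) hy N f (hfs f (by simp)) hbij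
    have hQ := ih Q (isWeaklyRegular_away_quotient φ f hM) (fun g hg => hfs g (by simp [hg])) ?_
    · cases i with
      | zero => exact hS.zero hy (hN 0)
      | succ i => exact hS.left hy (hQ i (by simpa using hi)) (hN (i + 1))
    · intro z hz hzy hzfs m
      obtain ⟨x, rfl⟩ := Submodule.Quotient.mk_surjective _ m
      obtain ⟨n, m, e⟩ := hpow x
      -- The quotient has smaller support: on `D(f)` it is killed by powers of the unit `f`, and
      -- elsewhere the hypothesis on `M` annihilates the numerator.
      by_cases hzf : z ∈ X.basicOpen f
      · refine ⟨f ^ n, ?_, (Submodule.Quotient.mk_eq_zero _).mpr ⟨m, e.symm⟩⟩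
        rw [Scheme.mem_basicOpen _ _ _ hz] at hzf ⊢
        rw [map_pow]
        exact hzf.pow n
      · obtain ⟨g, hg, hgm⟩ := hsupp z hz hzy (by simpa [hzf] using hzfs) m
        refine ⟨g, hg, (Submodule.Quotient.mk_eq_zero _).mpr ⟨0, ?_⟩⟩
        rw [map_zero]
        have hbn : Function.Injective fun x : N => f ^ n • x := by
          have := hbij.1.iterate n
          rwa [smul_iterate] at this
        apply hbn
        change f ^ n • (0 : N) = f ^ n • g • x
        rw [smul_comm, e, smul_zero, ← map_smul, hgm, map_zero]

end CohenMacaulay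

/-! ### Regular parameters in smooth algebras over a field -/

section RegularParameters

open RingTheory.Sequence IsLocalRing Pointwise

/-- The maximal ideal is generated by a weakly regular sequence. -/
def HasRegularParameters (R : Type u) [CommRing R] [IsLocalRing R] : Prop :=
  ∃ rs : List R, IsWeaklyRegular R rs ∧ Ideal.ofList rs = maximalIdeal R

theorem HasRegularParameters.of_flat {R S : Type u} [CommRing R] [IsLocalRing R] [CommRing S]
    [IsLocalRing S] [Algebra R S] [Module.Flat R S]
    (h : (maximalIdeal R).map (algebraMap R S) = maximalIdeal S) (hR : HasRegularParameters R) :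
    HasRegularParameters S := by
  obtain ⟨rs, h1, h2⟩ := hR
  exact ⟨_, h1.of_flat (S := S), by rw [← h, ← h2, Ideal.map_ofList]⟩

theorem HasRegularParameters.of_ringEquiv {R S : Type u} [CommRing R] [IsLocalRing R] [CommRing S]
    [IsLocalRing S] (e : R ≃+* S) (hR : HasRegularParameters R) : HasRegularParameters S := by
  let _ : Algebra R S := e.toRingHom.toAlgebra
  have : Module.Flat R S := Module.Flat.of_linearEquiv
    (LinearEquiv.ofBijective (Algebra.linearMap R S) e.bijective).symm
  have : IsLocalHom (algebraMap R S) := ⟨fun a ha => (isUnit_map_iff e a).mp ha⟩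
  refine hR.of_flat (le_antisymm ?_ fun x hx => ?_)
  · exact ((local_hom_TFAE (algebraMap R S)).out 0 2 rfl rfl).mp ‹_›
  · obtain ⟨y, rfl⟩ := e.surjective x
    refine Ideal.mem_map_of_mem (algebraMap R S) ?_
    rw [mem_maximalIdeal, mem_nonunits_iff] at hx ⊢
    exact fun hy => hx (hy.map e)

open Polynomial in
-- A prime of `R[X]` over the maximal ideal `𝔪` is either `𝔪R[X]` or generated by `𝔪` and one monic
-- polynomial. The polynomial is regular modulo the prime ideal `𝔪R[X]`, since its leading
-- coefficient is not in `𝔪`.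
theorem HasRegularParameters.polynomial_of_comap {R : Type u} [CommRing R] [IsLocalRing R]
    (hR : HasRegularParameters R) (p : Ideal R[X]) [p.IsPrime] (hp : p.comap C = maximalIdeal R) :
    HasRegularParameters (Localization.AtPrime p) := by
  obtain ⟨rs, h1, h2⟩ := hR
  have h3 := h1.of_flat (S := R[X])
  have h4 : Ideal.ofList (rs.map (algebraMap R R[X])) = (maximalIdeal R).map C := by
    rw [← h2, Ideal.map_ofList, algebraMap_eq]
  suffices ∃ fs : List R[X], IsWeaklyRegular R[X] fs ∧ Ideal.ofList fs = p by
    obtain ⟨fs, h5, h6⟩ := this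
    refine ⟨_, h5.of_isLocalization (Localization.AtPrime p) p.primeCompl, ?_⟩
    rw [← Ideal.map_ofList, h6, Localization.AtPrime.map_eq_maximalIdeal]
  by_cases e : p = (p.comap C).map C
  · exact ⟨_, h3, by rw [h4, ← hp, ← e]⟩
  · obtain ⟨y, hy, hy'⟩ := Polynomial.exists_monic_span_sup_map_eq R p
      (hp ▸ maximalIdeal.isMaximal R) e
    rw [hp] at hy'
    refine ⟨rs.map (algebraMap R R[X]) ++ [y], ?_, ?_⟩
    · rw [isWeaklyRegular_append_iff, isWeaklyRegular_singleton_iff]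
      refine ⟨h3, ?_⟩
      rw [h4, isSMulRegular_quotient_iff_mem_of_smul_mem]
      intro x hx
      rw [smul_eq_mul, Ideal.mul_top] at hx ⊢
      have hprime : ((maximalIdeal R).map (C : R →+* R[X])).IsPrime :=
        Ideal.isPrime_map_C_of_isPrime
      refine (hprime.mem_or_mem hx).resolve_left fun hyC => ?_
      have := Ideal.mem_map_C_iff.mp hyC y.natDegree
      rw [hy.coeff_natDegree] at this
      exact (Ideal.ne_top_iff_one _).mp (maximalIdeal.isMaximal R).ne_top this
    · rw [Ideal.ofList_append, h4, Ideal.ofList_singleton]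
      exact hy'.symm

/-- All local rings of `R` have maximal ideals generated by weakly regular sequences. -/
def HasLocalRegularParameters (R : Type u) [CommRing R] : Prop :=
  ∀ (p : Ideal R) [p.IsPrime], HasRegularParameters (Localization.AtPrime p)

theorem HasLocalRegularParameters.of_ringEquiv {R S : Type u} [CommRing R] [CommRing S]
    (e : R ≃+* S) (hR : HasLocalRegularParameters R) : HasLocalRegularParameters S := by
  intro p hp
  have h := hR (p.comap e.toRingHom)
  refine h.of_ringEquiv (IsLocalization.ringEquivOfRingEquiv (M := (p.comap e.toRingHom).primeCompl)
    (T := p.primeCompl) _ _ e ?_)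
  ext x
  constructor
  · rintro ⟨y, hy, rfl⟩
    exact hy
  · intro hx
    exact ⟨e.symm x, by
      change e (e.symm x) ∉ p
      rwa [e.apply_symm_apply], e.apply_symm_apply x⟩

open Polynomial in
-- Localizing first at `q = p ∩ R` replaces `R` by the local ring `R_q` without changing the local
-- ring at `p`, so the prime may be taken to lie over the maximal ideal.
theorem HasLocalRegularParameters.polynomial {R : Type u} [CommRing R]
    (hR : HasLocalRegularParameters R) : HasLocalRegularParameters R[X] := by
  intro p hp
  let q := p.comap C
  let S := (Localization.AtPrime q)[X]
  let pc := Submonoid.map Polynomial.C.toMonoidHom q.primeCompl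
  let : Algebra R[X] S := algebra R (Localization.AtPrime q)
  have : IsLocalization pc S := Polynomial.isLocalization _ _
  let pS := p.map (algebraMap R[X] S)
  have disj : Disjoint (pc : Set R[X]) (p : Set R[X]) := by
    simpa [pc, q] using! Set.disjoint_image_left.mpr
      (Set.disjoint_compl_left_iff_subset.mpr (fun _ a ↦ a))
  have : pS.IsPrime := IsLocalization.isPrime_of_isPrime_disjoint pc _ _ ‹_› disj
  have : IsLocalization.AtPrime (Localization.AtPrime pS) p := by
    convert IsLocalization.isLocalization_isLocalization_atPrime_isLocalization pc
      (Localization.AtPrime pS) pS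
    exact (IsLocalization.under_map_of_isPrime_disjoint pc _ ‹_› disj).symm
  have eq : Ideal.comap C pS = maximalIdeal (Localization.AtPrime q) := by
    rw [← IsLocalization.map_under q.primeCompl _ (Ideal.comap C pS),
      ← IsLocalization.map_under q.primeCompl _ (maximalIdeal (Localization.AtPrime q))]
    simp only [Ideal.comap_comap, S, pS]
    rw [← Polynomial.algebraMap_eq (R := Localization.AtPrime q),
      ← IsScalarTower.algebraMap_eq R (Localization.AtPrime q) (Localization.AtPrime q)[X],
      IsScalarTower.algebraMap_eq R R[X] (Localization.AtPrime q)[X], ← Ideal.comap_comap,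
      ← Ideal.under_def R[X], IsLocalization.under_map_of_isPrime_disjoint pc _ ‹_› disj]
    simp [q, IsLocalization.AtPrime.under_maximalIdeal (Localization.AtPrime q) q]
  exact ((hR q).polynomial_of_comap pS eq).of_ringEquiv (IsLocalization.algEquiv p.primeCompl
    (Localization.AtPrime pS) (Localization.AtPrime p)).toRingEquiv

theorem hasLocalRegularParameters_of_field (k : Type u) [Field k] :
    HasLocalRegularParameters k := by
  intro p hp
  have : p = ⊥ := Ideal.eq_bot_of_prime p
  subst this
  refine ⟨[], IsWeaklyRegular.nil _ _, ?_⟩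
  rw [Ideal.ofList_nil, ← Localization.AtPrime.map_eq_maximalIdeal, Ideal.map_bot]

theorem hasLocalRegularParameters_mvPolynomial (k : Type u) [Field k] (n : ℕ) :
    HasLocalRegularParameters (MvPolynomial (Fin n) k) := by
  induction n with
  | zero =>
    exact (hasLocalRegularParameters_of_field k).of_ringEquiv
      (MvPolynomial.isEmptyRingEquiv k (Fin 0)).symm
  | succ n ih =>
    exact ih.polynomial.of_ringEquiv (MvPolynomial.finSuccEquiv k n).symm.toRingEquiv

/-- Étale maps are flat on local rings, and unramifiedness makes the maximal ideal below generate
the one above, so parameters below remain parameters above. -/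
theorem HasLocalRegularParameters.of_etale {S B : Type u} [CommRing S] [CommRing B] [Algebra S B]
    [Algebra.Etale S B] (hS : HasLocalRegularParameters S) : HasLocalRegularParameters B := by
  intro P hP
  let _ := Localization.AtPrime.algebraOfLiesOver (P.under S) P
  have e := ((Algebra.isUnramifiedAt_iff_map_eq S (P.under S) P).mp inferInstance).2
  have : Module.Flat S B := Algebra.Smooth.flat S B
  refine (hS (P.under S)).of_flat ?_
  rw [← e, ← Localization.AtPrime.map_eq_maximalIdeal, Ideal.map_map,
    ← IsScalarTower.algebraMap_eq]

/-- A weakly regular sequence over a localization can be replaced by one that comes from the ring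
and generates the same ideal. -/
theorem exists_isWeaklyRegular_map {B L : Type u} [CommRing B] [CommRing L] [Algebra B L]
    (T : Submonoid B) [IsLocalization T L] {M : Type u} [AddCommGroup M] [Module L M]
    (rs : List L) (h : IsWeaklyRegular M rs) : ∃ fs : List B,
      IsWeaklyRegular M (fs.map (algebraMap B L)) ∧ fs.length = rs.length ∧
        Ideal.ofList (fs.map (algebraMap B L)) = Ideal.ofList rs := by
  induction rs generalizing M with
  | nil => exact ⟨[], h, rfl, rfl⟩
  | cons r rs ih =>
    rw [isWeaklyRegular_cons_iff] at h
    obtain ⟨fs, h1, h2, h3⟩ := ih h.2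
    -- Clearing the denominator changes `r` by a unit of `L`, which affects neither regularity nor
    -- the ideals.
    obtain ⟨⟨b, t⟩, hb⟩ := IsLocalization.surj T r
    have ht := IsLocalization.map_units L t
    have e1 : algebraMap B L b • (⊤ : Submodule L M) = r • ⊤ := by
      dsimp only at hb
      rw [← hb, mul_smul]
      congr 1
      rw [eq_top_iff]
      intro x _
      exact ⟨ht.unit⁻¹ • x, trivial, smul_inv_smul ht.unit x⟩
    refine ⟨b :: fs, ?_, by simp [h2], ?_⟩
    · rw [List.map_cons, isWeaklyRegular_cons_iff]
      refine ⟨?_, (LinearEquiv.isWeaklyRegular_congr (Submodule.quotEquivOfEq _ _ e1) _).mpr h1⟩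
      dsimp only at hb
      rw [← hb]
      exact h.1.mul (ht.isSMulRegular M)
    · rw [List.map_cons, Ideal.ofList_cons, Ideal.ofList_cons, h3, ← hb]
      rw [Ideal.span_singleton_mul_right_unit ht]

theorem exists_notMem_forall_mul_mem {B : Type u} [CommRing B] (P : Ideal B) [P.IsPrime]
    {I N : Ideal B} (hN : N.FG) (h : ∀ x ∈ N, ∃ g ∉ P, g * x ∈ I) :
    ∃ g ∉ P, ∀ x ∈ N, g * x ∈ I := by
  obtain ⟨s, rfl⟩ := hN
  choose! g hg hgx using h
  refine ⟨∏ x ∈ s, g x, ?_, fun x hx => ?_⟩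
  · exact prod_mem (S := P.primeCompl) fun x hx => hg x (Submodule.subset_span hx)
  · have : Submodule.span B (s : Set B) ≤ Submodule.comap (LinearMap.mulLeft B (∏ x ∈ s, g x)) I := by
      rw [Submodule.span_le]
      intro x hx
      obtain ⟨c, hc⟩ := Finset.dvd_prod_of_mem g hx
      change (∏ x ∈ s, g x) * x ∈ I
      rw [hc, mul_right_comm]
      exact I.mul_mem_right _ (hgx x (Submodule.subset_span hx))
    exact this hx

/-- A regular system of parameters at a prime spreads out to a neighbourhood. -/
theorem HasRegularParameters.exists_spread {B : Type u} [CommRing B] [IsNoetherianRing B]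
    (P : Ideal B) [P.IsPrime] (h : HasRegularParameters (Localization.AtPrime P)) :
    ∃ (fs : List B) (g : B), g ∉ P ∧ (∀ f ∈ fs, f ∈ P) ∧ (∀ b ∈ P, g * b ∈ Ideal.ofList fs) ∧
      (∀ (L : Type u) [CommRing L] [Algebra B L] [IsLocalization.Away g L],
        IsWeaklyRegular L fs) ∧
      (fs.length : WithBot ℕ∞) = ringKrullDim (Localization.AtPrime P) := by
  obtain ⟨rs, h1, h2⟩ := h
  obtain ⟨fs, h3, h4, h5⟩ := exists_isWeaklyRegular_map P.primeCompl rs h1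
  rw [h2, ← Ideal.map_ofList] at h5
  have hfs : ∀ f ∈ fs, f ∈ P := by
    intro f hf
    have : algebraMap B (Localization.AtPrime P) f ∈ maximalIdeal (Localization.AtPrime P) := by
      rw [← h5]
      exact Ideal.mem_map_of_mem _ (Ideal.subset_span hf)
    rwa [IsLocalization.AtPrime.to_map_mem_maximal_iff _ P] at this
  have hmem : ∀ (I : Ideal B) (x : B), algebraMap B (Localization.AtPrime P) x ∈
      I.map (algebraMap B (Localization.AtPrime P)) → ∃ g ∉ P, g * x ∈ I := by
    intro I x hx
    rwa [IsLocalization.algebraMap_mem_map_algebraMap_iff P.primeCompl] at hx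
  -- Regularity in the local ring says that each colon ideal is contained in the previous partial
  -- ideal after localization. Since it is finitely generated, a single `g j` outside `P` achieves
  -- this over `B`.
  have hcolon : ∀ j (hj : j < fs.length), ∃ g ∉ P, ∀ x,
      fs[j] * x ∈ Ideal.ofList (fs.take j) → g * x ∈ Ideal.ofList (fs.take j) := by
    intro j hj
    let N : Ideal B := Submodule.comap (LinearMap.mulLeft B fs[j]) (Ideal.ofList (fs.take j))
    refine exists_notMem_forall_mul_mem P (N := N) (I := Ideal.ofList (fs.take j))
      (IsNoetherian.noetherian N) fun x hx => ?_
    apply hmem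
    have hj' : j < (fs.map (algebraMap B (Localization.AtPrime P))).length := by simpa using hj
    have := (isSMulRegular_quotient_iff_mem_of_smul_mem _ _).mp (h3.regular_mod_prev j hj')
      (algebraMap B (Localization.AtPrime P) x)
    rw [← List.map_take, ← Ideal.map_ofList, List.getElem_map, smul_eq_mul, smul_eq_mul,
      Ideal.mul_top, ← map_mul] at this
    exact this (Ideal.mem_map_of_mem _ hx)
  choose! g hg hgx using hcolon
  -- One further denominator makes `fs` generate `P` itself near the point.
  obtain ⟨g', hg', hgx'⟩ := exists_notMem_forall_mul_mem P (I := Ideal.ofList fs)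
    (IsNoetherian.noetherian P) fun x hx => hmem _ x (by
      rw [h5, IsLocalization.AtPrime.to_map_mem_maximal_iff _ P]
      exact hx)
  refine ⟨fs, g' * ∏ j ∈ Finset.range fs.length, g j, ?_, hfs, fun b hb => ?_, ?_, ?_⟩
  · exact P.primeCompl.mul_mem hg' (prod_mem fun j hj => hg j (Finset.mem_range.mp hj))
  · rw [mul_right_comm]
    exact Ideal.mul_mem_right _ _ (hgx' b hb)
  · intro L _ _ _
    refine ⟨fun j hj => ?_⟩
    rw [isSMulRegular_quotient_iff_mem_of_smul_mem]
    intro x hx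
    set G := g' * ∏ j ∈ Finset.range fs.length, g j with hG
    rw [Ideal.smul_top_eq_map, Submodule.restrictScalars_mem] at hx ⊢
    obtain ⟨⟨b, t⟩, hb⟩ := IsLocalization.surj (Submonoid.powers G) x
    have ht := IsLocalization.map_units L t
    dsimp only at hb
    have h6 : algebraMap B L (fs[j] * b) ∈
        (Ideal.ofList (fs.take j)).map (algebraMap B L) := by
      rw [map_mul, ← hb, ← mul_assoc, ← Algebra.smul_def]
      exact Ideal.mul_mem_right _ _ hx
    rw [IsLocalization.algebraMap_mem_map_algebraMap_iff (Submonoid.powers G)] at h6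
    obtain ⟨m, hm, h6⟩ := h6
    have h7 : G * (m * b) ∈ Ideal.ofList (fs.take j) := by
      obtain ⟨c, hc⟩ := Finset.dvd_prod_of_mem g (Finset.mem_range.mpr hj)
      have h7 := hgx j hj (m * b) (by rwa [mul_left_comm])
      have : G * (m * b) = g' * c * (g j * (m * b)) := by rw [hG, hc]; ring
      rw [this]
      exact Ideal.mul_mem_left _ _ h7
    have hGu : IsUnit (algebraMap B L G) :=
      IsLocalization.map_units L (⟨G, 1, pow_one G⟩ : Submonoid.powers G)
    have hmu : IsUnit (algebraMap B L m) := IsLocalization.map_units L (⟨m, hm⟩ : Submonoid.powers G)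
    have h8 := Ideal.mem_map_of_mem (algebraMap B L) h7
    rw [map_mul (algebraMap B L) G, map_mul (algebraMap B L) m, ← hb, Ideal.unit_mul_mem_iff_mem _ hGu, Ideal.unit_mul_mem_iff_mem _ hmu,
      Ideal.mul_unit_mem_iff_mem _ ht] at h8
    exact h8
  -- Each element of a regular sequence lowers the dimension by one, and the quotient by all of them
  -- is a field.
  · have h9 : IsRegular (Localization.AtPrime P) rs :=
      (IsLocalRing.isRegular_iff_isWeaklyRegular_of_subset_maximalIdeal (fun r hr => by
        rw [← h2]
        exact Ideal.subset_span hr)).mpr h1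
    have h10 := ringKrullDim_add_length_eq_ringKrullDim_of_isRegular rs h9
    rw [h4, ← h10, h2]
    have : ringKrullDim (Localization.AtPrime P ⧸ maximalIdeal (Localization.AtPrime P)) = 0 :=
      ringKrullDim_eq_zero_of_isField ((Ideal.Quotient.maximal_ideal_iff_isField_quotient _).mp
        inferInstance)
    rw [this, zero_add]

end RegularParameters

/-! ### Exterior powers and base change over `ℚ`-algebras -/

section ExteriorPower

variable {R S : Type u} [CommRing R] [CommRing S] [Algebra R S] {M N : Type u} [AddCommGroup M]
  [Module R M] [AddCommGroup N] [Module R N] [Module S N] [IsScalarTower R S N] {ψ : M →ₗ[R] N}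

variable (S ψ) in
/-- The map `⋀^p M → ⋀^p N` induced by a semilinear map `M → N`. -/
def exteriorPowerMap (p : ℕ) : ⋀[R]^p M →ₗ[R] ⋀[S]^p N :=
  exteriorPower.alternatingMapLinearEquiv
    { toMultilinearMap :=
        ((exteriorPower.ιMulti S p (M := N)).toMultilinearMap.restrictScalars R).compLinearMap
          fun _ => ψ
      map_eq_zero_of_eq' := fun v i j hv hij =>
        (exteriorPower.ιMulti S p (M := N)).map_eq_zero_of_eq _ (by rw [hv]) hij }

theorem exteriorPowerMap_ιMulti (p : ℕ) (m : Fin p → M) :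
    exteriorPowerMap S ψ p (exteriorPower.ιMulti R p m) =
      exteriorPower.ιMulti S p fun i => ψ (m i) :=
  exteriorPower.alternatingMapLinearEquiv_apply_ιMulti _ _

variable {Q : Type u} [AddCommGroup Q] [Module R Q] [Module S Q] [IsScalarTower R S Q]

theorem multilinearMap_ext_of_isBaseChange (h : IsBaseChange S ψ) {n : ℕ}
    {F G : MultilinearMap S (fun _ : Fin n => N) Q}
    (e : ∀ m : Fin n → M, F (fun i => ψ (m i)) = G fun i => ψ (m i)) : F = G := by
  induction n with
  | zero =>
    ext v
    rw [Subsingleton.elim v fun i => ψ (Fin.elim0 i)]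
    exact e _
  | succ n ih =>
    rw [← F.uncurry_curryLeft, ← G.uncurry_curryLeft]
    congr 1
    refine h.algHom_ext _ _ fun x => ih fun m => ?_
    have key : (Fin.cons (ψ x) fun i => ψ (m i) : Fin (n + 1) → N) =
        fun i => ψ ((Fin.cons x m : Fin (n + 1) → M) i) := by
      funext i
      cases i using Fin.cases <;> rfl
    rw [MultilinearMap.curryLeft_apply, MultilinearMap.curryLeft_apply, key]
    exact e _

/-- One variable is extended at a time by currying. Uniqueness of extensions makes the curried
family linear, so the universal property of base change applies in the first variable. -/
theorem exists_multilinearMap_of_isBaseChange (h : IsBaseChange S ψ) {n : ℕ}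
    (f : MultilinearMap R (fun _ : Fin n => M) Q) :
    ∃ F : MultilinearMap S (fun _ : Fin n => N) Q,
      ∀ m : Fin n → M, F (fun i => ψ (m i)) = f m := by
  induction n with
  | zero =>
    refine ⟨MultilinearMap.constOfIsEmpty S _ (f Fin.elim0), fun m => ?_⟩
    rw [Subsingleton.elim m Fin.elim0]
    rfl
  | succ n ih =>
    choose E hE using fun x : M => ih (f.curryLeft x)
    let g : M →ₗ[R] MultilinearMap S (fun _ : Fin n => N) Q :=
      { toFun := E
        map_add' := fun x y => multilinearMap_ext_of_isBaseChange h fun m => by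
          rw [add_apply, hE, hE, hE, map_add, add_apply]
        map_smul' := fun r x => multilinearMap_ext_of_isBaseChange h fun m => by
          rw [smul_apply, hE, hE, map_smul, smul_apply,
            RingHom.id_apply] }
    have : IsScalarTower R S (MultilinearMap S (fun _ : Fin n => N) Q) :=
      ⟨fun r s F => MultilinearMap.ext fun v => smul_assoc r s (F v)⟩
    refine ⟨(h.lift g).uncurryLeft, fun m => ?_⟩
    rw [LinearMap.uncurryLeft_apply, h.lift_eq]
    refine (hE _ _).trans ?_
    exact congrArg f (Fin.cons_self_tail m)

/-- Alternating maps extend along a base change, over `ℚ`-algebras. -/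
theorem exists_alternatingMap_of_isBaseChange [Algebra ℚ S] (h : IsBaseChange S ψ) {n : ℕ}
    (f : M [⋀^Fin n]→ₗ[R] Q) :
    ∃ F : N [⋀^Fin n]→ₗ[S] Q, ∀ m : Fin n → M, F (fun i => ψ (m i)) = f m := by
  obtain ⟨F, hF⟩ := exists_multilinearMap_of_isBaseChange h f.toMultilinearMap
  -- The multilinear extension is made alternating by antisymmetrizing. On arguments from `M` this
  -- multiplies by `n!`, which is inverted.
  refine ⟨algebraMap ℚ S (n.factorial : ℚ)⁻¹ • MultilinearMap.alternatization F, fun m => ?_⟩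
  have h1 : MultilinearMap.alternatization F (fun i => ψ (m i)) = n.factorial • f m := by
    have := congrArg (fun g => g m) (AlternatingMap.coe_alternatization f)
    rw [Fintype.card_fin] at this
    refine Eq.trans ?_ this
    rw [MultilinearMap.alternatization_apply]
    rw [MultilinearMap.alternatization_apply]
    refine Finset.sum_congr rfl fun σ _ => congrArg _ ?_
    rw [MultilinearMap.domDomCongr_apply, MultilinearMap.domDomCongr_apply]
    exact hF fun i => m (σ i)
  rw [AlternatingMap.smul_apply, h1, ← Nat.cast_smul_eq_nsmul S, smul_smul,
    ← map_natCast (algebraMap ℚ S), ← map_mul, inv_mul_cancel₀, map_one, one_smul]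
  exact_mod_cast n.factorial_ne_zero

/-- Exterior powers commute with base change, over `ℚ`-algebras. -/
theorem isBaseChange_exteriorPowerMap [Algebra ℚ S] (h : IsBaseChange S ψ) (p : ℕ) :
    IsBaseChange S (exteriorPowerMap S ψ p) := by
  obtain ⟨F, hF⟩ := exists_alternatingMap_of_isBaseChange (Q := S ⊗[R] ⋀[R]^p M) h
    ((TensorProduct.mk R S (⋀[R]^p M) 1).compAlternatingMap (exteriorPower.ιMulti R p))
  refine IsBaseChange.of_equiv (LinearEquiv.ofLinearMap
    (LinearMap.liftBaseChange S (exteriorPowerMap S ψ p))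
    (exteriorPower.alternatingMapLinearEquiv F) ?_ ?_) fun x => ?_
  · refine exteriorPower.linearMap_ext (AlternatingMap.coe_multilinearMap_injective ?_)
    refine multilinearMap_ext_of_isBaseChange h fun m => ?_
    change LinearMap.liftBaseChange S (exteriorPowerMap S ψ p)
      (exteriorPower.alternatingMapLinearEquiv F (exteriorPower.ιMulti S p _)) =
        exteriorPower.ιMulti S p _
    rw [exteriorPower.alternatingMapLinearEquiv_apply_ιMulti, hF]
    simp [exteriorPowerMap_ιMulti]
  · refine TensorProduct.AlgebraTensorModule.curry_injective (LinearMap.ext_ring ?_)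
    refine exteriorPower.linearMap_ext (AlternatingMap.ext fun m => ?_)
    change exteriorPower.alternatingMapLinearEquiv F (LinearMap.liftBaseChange S
      (exteriorPowerMap S ψ p) (1 ⊗ₜ exteriorPower.ιMulti R p m)) = _
    rw [LinearMap.liftBaseChange_tmul, one_smul, exteriorPowerMap_ιMulti,
      exteriorPower.alternatingMapLinearEquiv_apply_ιMulti, hF]
    rfl
  · change LinearMap.liftBaseChange S (exteriorPowerMap S ψ p) (1 ⊗ₜ x) = _
    rw [LinearMap.liftBaseChange_tmul, one_smul]

end ExteriorPower

/-! ### Localization of differential forms -/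

section FormsLocalization

variable (K : Type v) [CommRing K] {R S : Type u} [CommRing R] [Algebra K R] [CommRing S]
  [Algebra K S]

theorem diffFormsMap_apply [Algebra R S] [IsScalarTower K R S] (p : ℕ) (x : DiffForms K R p) :
    diffFormsMap K (IsScalarTower.toAlgHom K R S) p x =
      exteriorPowerMap S (KaehlerDifferential.map K K R S) p x := by
  have : diffFormsMap K (IsScalarTower.toAlgHom K R S) p =
      (exteriorPowerMap S (KaehlerDifferential.map K K R S) p).toAddMonoidHom := by
    refine diffForms_ext K R fun r a => ?_
    rw [diffFormsMap_smul_dForm]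
    change _ = exteriorPowerMap S (KaehlerDifferential.map K K R S) p (r • dForm K a)
    have h : exteriorPowerMap S (KaehlerDifferential.map K K R S) p (dForm K a) =
        dForm K (IsScalarTower.toAlgHom K R S ∘ a) := by
      rw [dForm, exteriorPowerMap_ιMulti]
      simp only [KaehlerDifferential.map_D]
      rfl
    rw [map_smul, h]
    exact algebraMap_smul S r _
  rw [this]
  rfl

/-- Differential forms commute with localization. -/
theorem isLocalizedModule_diffForms [Algebra R S] [IsScalarTower K R S] [Algebra ℚ S] (g : R)
    [IsLocalization.Away g S] (p : ℕ) :
    IsLocalizedModule.Away g (exteriorPowerMap S (KaehlerDifferential.map K K R S) p) := by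
  refine (isLocalizedModule_iff_isBaseChange (Submonoid.powers g) S _).mpr ?_
  exact isBaseChange_exteriorPowerMap ((isLocalizedModule_iff_isBaseChange (Submonoid.powers g) S
    _).mp inferInstance) p

end FormsLocalization

/-! ### Flatness of absolute differential forms over a standard smooth factor -/

section FormsFlat

/-- For a standard smooth algebra, the module of differentials over a smaller base ring comes from
the base. -/
theorem exists_isBaseChange_kaehlerDifferential (K : Type) [CommRing K] (A C : Type u)
    [CommRing A] [CommRing C] [Algebra K A] [Algebra K C] [Algebra A C] [IsScalarTower K A C]
    [Algebra.IsStandardSmooth A C] :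
    ∃ (N : Type u) (_ : AddCommGroup N) (_ : Module A N) (ψ : N →ₗ[A] Ω[C⁄K]),
      IsBaseChange C ψ := by
  let b := Module.Free.chooseBasis C (Ω[C⁄A])
  let ι := Module.Free.ChooseBasisIndex C (Ω[C⁄A])
  have hsurj : Function.Surjective (KaehlerDifferential.map K A C C) :=
    KaehlerDifferential.map_surjective K A C
  choose l hl using fun i => hsurj (b i)
  -- The obstruction to injectivity is the first cotangent homology of `C` over `A`, which vanishes
  -- by smoothness.
  have hinj : Function.Injective (KaehlerDifferential.mapBaseChange K A C) := by
    rw [injective_iff_map_eq_zero]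
    intro x hx
    obtain ⟨y, rfl⟩ := (Algebra.H1Cotangent.exact_δ_mapBaseChange K A C x).mp hx
    rw [Subsingleton.elim y 0, map_zero]
  let s : (ι →₀ C) →ₗ[C] Ω[C⁄K] := Finsupp.linearCombination C l
  have hs : ∀ c, KaehlerDifferential.map K A C C (s c) = Finsupp.linearCombination C b c := by
    intro c
    rw [Finsupp.apply_linearCombination]
    congr 2
    exact funext hl
  -- Lifting a basis of `Ω[C⁄A]` to `Ω[C⁄K]` splits the cotangent sequence. Both summands are then
  -- extended from `A`.
  let ψ : (Ω[A⁄K]) × (ι →₀ A) →ₗ[A] Ω[C⁄K] := LinearMap.coprod (KaehlerDifferential.map K K A C)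
    ((s.restrictScalars A) ∘ₗ Finsupp.mapRange.linearMap (Algebra.linearMap A C))
  refine ⟨(Ω[A⁄K]) × (ι →₀ A), inferInstance, inferInstance, ψ, ?_⟩
  let e₁ : C ⊗[A] ((Ω[A⁄K]) × (ι →₀ A)) ≃ₗ[C] (C ⊗[A] Ω[A⁄K]) × (ι →₀ C) :=
    TensorProduct.prodRight A C C _ _ ≪≫ₗ
      (LinearEquiv.refl C _).prodCongr (TensorProduct.finsuppScalarRight A C C ι)
  let e₂ : ((C ⊗[A] Ω[A⁄K]) × (ι →₀ C)) →ₗ[C] Ω[C⁄K] :=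
    LinearMap.coprod (KaehlerDifferential.mapBaseChange K A C) s
  have he₂ : Function.Bijective e₂ := by
    constructor
    · rw [injective_iff_map_eq_zero]
      rintro ⟨x, c⟩ h
      have h1 := congrArg (KaehlerDifferential.map K A C C) h
      rw [LinearMap.coprod_apply, map_add, hs, map_zero,
        (KaehlerDifferential.exact_mapBaseChange_map K A C).apply_apply_eq_zero, zero_add] at h1
      have hc : c = 0 := b.linearIndependent (h1.trans (map_zero _).symm)
      subst hc
      rw [LinearMap.coprod_apply, map_zero, add_zero] at h
      exact Prod.ext ((map_eq_zero_iff _ hinj).mp h) rfl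
    · intro x
      obtain ⟨c, hc⟩ : ∃ c, Finsupp.linearCombination C b c =
          KaehlerDifferential.map K A C C x := ⟨_, b.linearCombination_repr _⟩
      obtain ⟨y, hy⟩ := (KaehlerDifferential.exact_mapBaseChange_map K A C (x - s c)).mp (by
        rw [map_sub, hs, hc, sub_self])
      exact ⟨(y, c), by rw [LinearMap.coprod_apply, hy, sub_add_cancel]⟩
  refine IsBaseChange.of_equiv (e₁ ≪≫ₗ LinearEquiv.ofBijective e₂ he₂) ?_
  rintro ⟨x, c⟩
  change KaehlerDifferential.mapBaseChange K A C (1 ⊗ₜ x) +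
    s (TensorProduct.finsuppScalarRight A C C ι (1 ⊗ₜ c)) = _
  rw [KaehlerDifferential.mapBaseChange_tmul, one_smul]
  refine congrArg (KaehlerDifferential.map K K A C x + s ·) (Finsupp.ext fun i => ?_)
  simp [Algebra.smul_def]

/-- Let `C = B ⊗_k A` with `B` standard smooth over a field `k`. The module of absolute differential
forms of `C` is flat over `B`. -/
theorem flat_diffForms (K : Type) [CommRing K] (k A B C : Type u) [Field k] [CommRing A]
    [CommRing B] [CommRing C] [Algebra k A] [Algebra k B] [Algebra k C] [Algebra A C] [Algebra B C]
    [IsScalarTower k A C] [IsScalarTower k B C] [Algebra.IsPushout k A B C]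
    [Algebra K A] [Algebra K C] [IsScalarTower K A C] [Algebra ℚ C]
    [Algebra.IsStandardSmooth k B] (p : ℕ) : Module.Flat B (DiffForms K C p) := by
  have : Algebra.IsStandardSmooth A C :=
    Algebra.IsStandardSmooth.of_algEquiv (Algebra.IsPushout.equiv k A B C)
  obtain ⟨N, _, _, ψ, hψ⟩ := exists_isBaseChange_kaehlerDifferential K A C
  have h := isBaseChange_exteriorPowerMap hψ p
  have : Algebra.IsPushout k B A C := Algebra.IsPushout.symm inferInstance
  let _ : Module k (⋀[A]^p N) := Module.compHom _ (algebraMap k A)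
  have : IsScalarTower k A (⋀[A]^p N) := .of_algebraMap_smul fun _ _ => rfl
  -- With `N` the module from which `Ω[C⁄K]` is extended, `C ⊗_A ⋀ᵖN = B ⊗_k ⋀ᵖN` because `C = B ⊗_k
  -- A`. This is free over `B` since `k` is a field.
  have e : DiffForms K C p ≃ₗ[B] B ⊗[k] ⋀[A]^p N :=
    (h.equiv.restrictScalars B).symm ≪≫ₗ Algebra.IsPushout.cancelBaseChange k B A C (⋀[A]^p N)
  exact Module.Flat.of_linearEquiv e

end FormsFlat

/-! ### Comparing a sheafification with a quasi-coherent sheaf near a point -/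

section Comparison

variable {X : Scheme.{u}} {U : X.Opens}

/-- If a morphism from a presheaf to a sheaf is bijective on sections over the basic opens of an
affine neighbourhood of `y`, the associated sheaf has the same local cohomology at `y`. -/
theorem rZero_presheafToSheaf_iff (hU : IsAffineOpen U) {y : X} (hy : y ∈ U)
    {P : TopCat.Presheaf AddCommGrpCat.{u} X} {Q : AbSheaf X} (γ : P ⟶ Q.presheaf)
    (h : ∀ g : Γ(X, U), Function.Bijective (γ.app (op (X.basicOpen g)))) (i : ℕ) :
    RZero (germsWithSupportFunctor y) i
      ((presheafToSheaf (Opens.grothendieckTopology X) AddCommGrpCat.{u}).obj P) ↔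
    RZero (germsWithSupportFunctor y) i Q := by
  let α : (presheafToSheaf (Opens.grothendieckTopology X) AddCommGrpCat.{u}).obj P ⟶ Q :=
    ⟨sheafifyLift (Opens.grothendieckTopology X) γ Q.2⟩
  refine rZero_iff_of_bijective hy α (fun z hz => ?_) i
  have h1 := stalk_bijective_of_basicOpen hU γ h z hz
  -- The morphism `γ` factors through the sheafification, which is bijective on stalks, so
  -- bijectivity of `γ` on stalks passes to `α`.
  rw [← toSheafify_sheafifyLift (Opens.grothendieckTopology X) γ Q.2, Functor.map_comp] at h1
  have h2 := TopCat.Presheaf.stalkFunctor_map_unit_toSheafify_isIso z AddCommGrpCat.{u} P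
  have h3 := (ConcreteCategory.isIso_iff_bijective _).mp h2
  have h4 : Function.Bijective (sm α z ∘ ((TopCat.Presheaf.stalkFunctor AddCommGrpCat.{u} z).map
    (toSheafify (Opens.grothendieckTopology X) P))) := h1
  exact (Function.Bijective.of_comp_iff _ h3).mp h4

variable {hU : IsAffineOpen U}

/-- The abelian sheaf on the spectrum attached to a module. -/
def tildeAb {R : CommRingCat.{u}} (M : ModuleCat.{u} R) : AbSheaf (Spec R) :=
  (sheafCompose _ (forget₂ (ModuleCat.{u} R) AddCommGrpCat.{u})).obj
    (modulesSpecToSheaf.obj (tilde M))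

/-- A presheaf whose sections over basic opens are the localizations of a module maps to the
quasi-coherent sheaf of this module. -/
theorem exists_hom_tildeAb {R : CommRingCat.{u}} (M : ModuleCat.{u} R)
    (F : TopCat.Presheaf AddCommGrpCat.{u} (Spec R)) [∀ W, Module R (F.obj W)]
    (hF : ∀ (W W' : (Opens (Spec R))ᵒᵖ) (h : W ⟶ W') (b : R) (s : F.obj W),
      F.map h (b • s) = b • F.map h s)
    (ρ : ∀ W, M →ₗ[R] F.obj W)
    (hρ : ∀ (W W' : (Opens (Spec R))ᵒᵖ) (h : W ⟶ W') (m : M), F.map h (ρ W m) = ρ W' m)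
    (hloc : ∀ g : R, IsLocalizedModule.Away g (ρ (op (PrimeSpectrum.basicOpen g)))) :
    ∃ β : F ⟶ (tildeAb M).presheaf, ∀ g : R,
      Function.Bijective (β.app (op (PrimeSpectrum.basicOpen g))) := by
  let e : ∀ g : R, F.obj (op (PrimeSpectrum.basicOpen g)) ≃ₗ[R]
      (modulesSpecToSheaf.obj (tilde M)).obj.obj (op (PrimeSpectrum.basicOpen g)) := fun g =>
    IsLocalizedModule.linearEquiv (Submonoid.powers g) (ρ (op (PrimeSpectrum.basicOpen g)))
      (tilde.toOpen M (PrimeSpectrum.basicOpen g)).hom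
  have he : ∀ (g : R) (m : M), e g (ρ _ m) = tilde.toOpen M (PrimeSpectrum.basicOpen g) m :=
    fun g m => IsLocalizedModule.linearEquiv_apply _ _ _ _
  have nat : ∀ (g g' : R) (f : op (PrimeSpectrum.basicOpen g) ⟶ op (PrimeSpectrum.basicOpen g'))
      (s : F.obj (op (PrimeSpectrum.basicOpen g))),
      e g' (F.map f s) = (modulesSpecToSheaf.obj (tilde M)).obj.map f (e g s) := by
    intro g g' f s
    have hu : ∀ x : (Submonoid.powers g), IsUnit (algebraMap R (Module.End R
        ((modulesSpecToSheaf.obj (tilde M)).obj.obj (op (PrimeSpectrum.basicOpen g')))) x) := by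
      rintro ⟨_, n, rfl⟩
      rw [map_pow]
      exact (Scheme.Modules.isUnit_algebraMap_end_of_le_basicOpen (M := tilde M) g
        (leOfHom f.unop)).pow n
    -- Both sides are linear maps out of a localization of `M` at `g` into a module where `g` is
    -- invertible, so agreement on `M` suffices.
    have key : (e g').toLinearMap ∘ₗ
        ({ toFun := F.map f, map_add' := map_add (F.map f).hom, map_smul' := hF _ _ f } :
          F.obj (op (PrimeSpectrum.basicOpen g)) →ₗ[R]
            F.obj (op (PrimeSpectrum.basicOpen g'))) =
        ((modulesSpecToSheaf.obj (tilde M)).obj.map f).hom ∘ₗ (e g).toLinearMap := by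
      refine IsLocalizedModule.ext (Submonoid.powers g)
        (ρ (op (PrimeSpectrum.basicOpen g))) hu (LinearMap.ext fun m => ?_)
      change e g' (F.map f (ρ _ m)) = ((modulesSpecToSheaf.obj (tilde M)).obj.map f).hom
        (e g (ρ _ m))
      exact (congrArg (e g') (hρ _ _ f m)).trans ((he g' m).trans
        (congrArg ((modulesSpecToSheaf.obj (tilde M)).obj.map f).hom (he g m)).symm)
    exact LinearMap.congr_fun key s
  let α : (inducedFunctor (PrimeSpectrum.basicOpen (R := R))).op ⋙ F ⟶
      (inducedFunctor (PrimeSpectrum.basicOpen (R := R))).op ⋙ (tildeAb M).presheaf :=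
    { app := fun g => AddCommGrpCat.ofHom (e g.unop).toLinearMap.toAddMonoidHom
      naturality := fun g g' h => ConcreteCategory.hom_ext _ _ fun s =>
        nat g.unop g'.unop ((inducedFunctor (PrimeSpectrum.basicOpen (R := R))).op.map h) s }
  refine ⟨TopCat.Sheaf.restrictHomEquivHom F (tildeAb M) PrimeSpectrum.isBasis_basic_opens α,
    fun g => ?_⟩
  rw [TopCat.Sheaf.extend_hom_app F (tildeAb M) PrimeSpectrum.isBasis_basic_opens α g]
  exact (e g).bijective

theorem isIso_map_of_le {P : TopCat.Presheaf AddCommGrpCat.{u} X} {V W : X.Opens} (h : V ≤ W)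
    (h' : W ≤ V) : IsIso (P.map (homOfLE h).op) := by
  obtain rfl := le_antisymm h h'
  have : (homOfLE h).op = 𝟙 _ := rfl
  rw [this, P.map_id]
  infer_instance

/-- If the sections of a presheaf over basic opens of an affine open neighbourhood `U` of `y` are
the localizations of a module `M`, then the associated sheaf has the same local cohomology at `y` as
the quasi-coherent sheaf attached to `M`. -/
theorem rZero_presheafToSheaf_iff_qcSheaf {y : X} (hy : y ∈ U) (M : ModuleCat.{u} Γ(X, U))
    (P : TopCat.Presheaf AddCommGrpCat.{u} X)
    [iP : ∀ W : (Opens (Spec Γ(X, U)))ᵒᵖ, Module Γ(X, U) (P.obj (op (hU.fromSpec ''ᵁ W.unop)))]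
    (hP : ∀ (W W' : (Opens (Spec Γ(X, U)))ᵒᵖ) (h : W ⟶ W') (b : Γ(X, U))
      (s : P.obj (op (hU.fromSpec ''ᵁ W.unop))),
      P.map (hU.fromSpec.opensFunctor.map h.unop).op (b • s) =
        b • P.map (hU.fromSpec.opensFunctor.map h.unop).op s)
    (ρ : ∀ W : (Opens (Spec Γ(X, U)))ᵒᵖ, M →ₗ[Γ(X, U)] P.obj (op (hU.fromSpec ''ᵁ W.unop)))
    (hρ : ∀ (W W' : (Opens (Spec Γ(X, U)))ᵒᵖ) (h : W ⟶ W') (m : M),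
      P.map (hU.fromSpec.opensFunctor.map h.unop).op (ρ W m) = ρ W' m)
    (hloc : ∀ g : Γ(X, U), IsLocalizedModule.Away g (ρ (op (PrimeSpectrum.basicOpen g)))) (i : ℕ) :
    RZero (germsWithSupportFunctor y) i
      ((presheafToSheaf (Opens.grothendieckTopology X) AddCommGrpCat.{u}).obj P) ↔
    RZero (germsWithSupportFunctor y) i (qcSheaf hU M) := by
  let F : TopCat.Presheaf AddCommGrpCat.{u} (Spec Γ(X, U)) := hU.fromSpec.opensFunctor.op ⋙ P
  obtain ⟨β, hβ⟩ := @exists_hom_tildeAb Γ(X, U) M F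
    (fun W => iP W) hP ρ hρ hloc
  -- A section over `V` is first restricted to `V ∩ U`. For a basic open of `U` this restriction is
  -- an isomorphism.
  let γ : P ⟶ (qcSheaf hU M).presheaf :=
    { app := fun V => P.map (homOfLE (hU.fromSpec.image_preimage_le V.unop)).op ≫
        β.app (op (hU.fromSpec ⁻¹ᵁ V.unop))
      naturality := by
        intro V V' h
        have h1 := β.naturality ((Opens.map hU.fromSpec.base).op.map h)
        have h2 : P.map h ≫ P.map (homOfLE (hU.fromSpec.image_preimage_le V'.unop)).op =
            P.map (homOfLE (hU.fromSpec.image_preimage_le V.unop)).op ≫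
              F.map ((Opens.map hU.fromSpec.base).op.map h) := by
          change _ = _ ≫ P.map _
          rw [← P.map_comp, ← P.map_comp]
          rfl
        exact (Category.assoc _ _ _).symm.trans ((congrArg (· ≫ β.app _) h2).trans
          ((Category.assoc _ _ _).trans ((congrArg (P.map _ ≫ ·) h1).trans
            (Category.assoc _ _ _).symm))) }
  refine rZero_presheafToSheaf_iff hU hy γ (fun g => ?_) i
  have h1 : IsIso (P.map (homOfLE (hU.fromSpec.image_preimage_le (X.basicOpen g))).op) := by
    refine isIso_map_of_le _ ?_
    rw [hU.fromSpec_preimage_basicOpen, hU.fromSpec_image_basicOpen]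
  have h2 : ∀ W : (Spec Γ(X, U)).Opens, W = PrimeSpectrum.basicOpen g →
      Function.Bijective (β.app (op W)) := by
    rintro W rfl
    exact hβ g
  exact (h2 _ (hU.fromSpec_preimage_basicOpen g)).comp ((ConcreteCategory.isIso_iff_bijective _).mp h1)

end Comparison

/-! ### The sheaf of forms attached to a quasi-coherent sheaf of algebras -/

section FormsSheaf

variable (K : Type) [CommRing K] {B C D : Type u} [CommRing B] [CommRing C] [CommRing D]
  [Algebra K C] [Algebra K D]

theorem isLocalizedModule_restrictScalars_diffForms [Algebra B C] [Algebra C D] [Algebra B D]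
    [IsScalarTower B C D] [IsScalarTower K C D] [Algebra ℚ D] (g : B)
    [IsLocalization.Away (algebraMap B C g) D] (p : ℕ) :
    IsLocalizedModule.Away g
      ((exteriorPowerMap D (KaehlerDifferential.map K K C D) p).restrictScalars B) := by
  have := isLocalizedModule_diffForms (S := D) K (algebraMap B C g) p
  exact IsLocalizedModule.restrictScalars_powers g _

theorem diffFormsMap_eq (φ : C →ₐ[K] D) [Algebra C D] [IsScalarTower K C D]
    (h : ∀ c, algebraMap C D c = φ c) (p : ℕ) (x : DiffForms K C p) :
    diffFormsMap K φ p x = exteriorPowerMap D (KaehlerDifferential.map K K C D) p x := by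
  rw [← diffFormsMap_apply]
  congr 1
  congr 1
  exact AlgHom.ext fun c => (h c).symm

theorem diffFormsMap_algebra_smul (φ : C →ₐ[K] D) [Algebra B C] [Algebra B D]
    (h : ∀ b, φ (algebraMap B C b) = algebraMap B D b) (p : ℕ) (b : B) (x : DiffForms K C p) :
    diffFormsMap K φ p (b • x) = b • diffFormsMap K φ p x := by
  let _ : Algebra C D := φ.toRingHom.toAlgebra
  have : IsScalarTower K C D := .of_algebraMap_eq fun r => (φ.commutes r).symm
  have : IsScalarTower B C D := .of_algebraMap_eq fun b => (h b).symm
  rw [diffFormsMap_eq K φ (fun _ => rfl), diffFormsMap_eq K φ (fun _ => rfl)]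
  exact ((exteriorPowerMap D (KaehlerDifferential.map K K C D) p).restrictScalars B).map_smul b x

variable {X : Scheme.{u}} {U : X.Opens} {hU : IsAffineOpen U}

theorem fromSpec_image_le (hU : IsAffineOpen U) (W : (Spec Γ(X, U)).Opens) :
    hU.fromSpec ''ᵁ W ≤ U :=
  (hU.fromSpec.image_le_opensRange W).trans_eq hU.opensRange_fromSpec

/-- The sheaf of differential forms of a quasi-coherent sheaf of algebras is quasi-coherent. -/
theorem rZero_localize_diffForms_iff {y : X} (hy : y ∈ U) (O : (Opens X)ᵒᵖ ⥤ CommAlgCat.{u} K)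
    (hQ : ∀ V, Nonempty (Algebra ℚ (O.obj V))) [Algebra Γ(X, U) (O.obj (op U))]
    (hloc : ∀ (g : Γ(X, U)) (V : X.Opens) (h : V ≤ U), V = X.basicOpen g →
      @IsLocalization.Away (O.obj (op U)) _ (algebraMap _ _ g) (O.obj (op V)) _
        (O.map (homOfLE h).op).hom.toRingHom.toAlgebra) (p i : ℕ) :
    RZero (germsWithSupportFunctor y) i (localize (diffFormsFunctor K p) O) ↔
    RZero (germsWithSupportFunctor y) i
      (qcSheaf hU (ModuleCat.of Γ(X, U) (DiffForms K (O.obj (op U)) p))) := by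
  let V (W : (Opens (Spec Γ(X, U)))ᵒᵖ) : X.Opens := hU.fromSpec ''ᵁ W.unop
  let r (W) : O.obj (op U) →ₐ[K] O.obj (op (V W)) :=
    (O.map (homOfLE (fromSpec_image_le hU W.unop)).op).hom
  let a₁ (W) : Algebra (O.obj (op U)) (O.obj (op (V W))) := (r W).toRingHom.toAlgebra
  let a₂ (W) : Algebra Γ(X, U) (O.obj (op (V W))) :=
    ((r W).toRingHom.comp (algebraMap _ _)).toAlgebra
  have t₁ (W) : IsScalarTower Γ(X, U) (O.obj (op U)) (O.obj (op (V W))) :=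
    .of_algebraMap_eq fun _ => rfl
  have t₂ (W) : IsScalarTower K (O.obj (op U)) (O.obj (op (V W))) :=
    .of_algebraMap_eq fun c => ((r W).commutes c).symm
  let m (W) : Module Γ(X, U) (DiffForms K (O.obj (op (V W))) p) := inferInstance
  let ρ (W) : DiffForms K (O.obj (op U)) p →ₗ[Γ(X, U)] DiffForms K (O.obj (op (V W))) p :=
    (exteriorPowerMap (O.obj (op (V W)))
      (KaehlerDifferential.map K K (O.obj (op U)) (O.obj (op (V W)))) p).restrictScalars Γ(X, U)
  have hρ (W) (x : DiffForms K (O.obj (op U)) p) : ρ W x = diffFormsMap K (r W) p x :=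
    (diffFormsMap_eq K (r W) (fun _ => rfl) p x).symm
  refine @rZero_presheafToSheaf_iff_qcSheaf X U hU y hy
    (ModuleCat.of Γ(X, U) (DiffForms K (O.obj (op U)) p)) (O ⋙ diffFormsFunctor K p)
    m ?_ ρ ?_ ?_ i
  · intro W W' h b s
    refine diffFormsMap_algebra_smul K (O.map (hU.fromSpec.opensFunctor.map h.unop).op).hom ?_ p b s
    intro b
    change (O.map (homOfLE (fromSpec_image_le hU W.unop)).op ≫
      O.map (hU.fromSpec.opensFunctor.map h.unop).op) (algebraMap _ _ b) = _
    rw [← O.map_comp]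
    rfl
  · intro W W' h x
    refine (congrArg _ (hρ W x)).trans (Eq.trans ?_ (hρ W' x).symm)
    change ((diffFormsFunctor K p).map (O.map _) ≫ (diffFormsFunctor K p).map (O.map _)) x = _
    rw [← Functor.map_comp, ← O.map_comp]
    rfl
  · intro g
    obtain ⟨q⟩ := hQ (op (V (op (PrimeSpectrum.basicOpen g))))
    have := hloc g (V (op (PrimeSpectrum.basicOpen g))) (fromSpec_image_le hU _)
      (hU.fromSpec_image_basicOpen g)
    exact isLocalizedModule_restrictScalars_diffForms K g p

end FormsSheaf

/-! ### Regular sequences cutting out the closure of a point of a smooth scheme -/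

section RegularOpen

open RingTheory.Sequence

variable {k : Type u} [Field k] {X : Scheme.{u}} (f : X ⟶ Spec (.of k))

/-- The ring homomorphism from `k` to the functions on an open subset of a scheme over `k`. -/
def constantsOn (U : X.Opens) : k →+* Γ(X, U) :=
  (X.presheaf.map (homOfLE le_top : U ⟶ ⊤).op).hom.comp (constants f)

theorem exists_isStandardSmooth_constantsOn [Smooth f] (y : X) :
    ∃ (U : X.Opens) (_ : IsAffineOpen U), y ∈ U ∧ (constantsOn f U).IsStandardSmooth := by
  obtain ⟨V, _, U, hU, hy, e, h⟩ := Smooth.exists_isStandardSmooth f y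
  -- The spectrum of a field is a single point, so the open subset of the base containing the image
  -- of `y` is everything.
  obtain rfl : V = ⊤ := by
    refine eq_top_iff.mpr fun z _ => ?_
    have hs : Subsingleton (Spec (.of k)) := inferInstanceAs (Subsingleton (PrimeSpectrum k))
    rw [Subsingleton.elim z (f y)]
    exact e hy
  refine ⟨U, hU, hy, ?_⟩
  have h1 := RingHom.isStandardSmooth_respectsIso.2 _
    (Scheme.ΓSpecIso (.of k)).symm.commRingCatIsoToRingEquiv h
  exact h1

theorem mem_basicOpen_iff_notMem_primeIdealOf {U : X.Opens} (hU : IsAffineOpen U) (z : U)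
    (g : Γ(X, U)) : z.1 ∈ X.basicOpen g ↔ g ∉ (hU.primeIdealOf z).asIdeal := by
  have h : hU.primeIdealOf z ∈ hU.fromSpec ⁻¹ᵁ X.basicOpen g ↔ z.1 ∈ X.basicOpen g := by
    change hU.fromSpec (hU.primeIdealOf z) ∈ X.basicOpen g ↔ _
    rw [hU.fromSpec_primeIdealOf]
  rw [← h, hU.fromSpec_preimage_basicOpen]
  rfl

theorem mem_closure_of_primeIdealOf_le {U : X.Opens} (hU : IsAffineOpen U) (y z : U)
    (h : (hU.primeIdealOf y).asIdeal ≤ (hU.primeIdealOf z).asIdeal) : z.1 ∈ closure {y.1} := by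
  have h1 : hU.primeIdealOf y ⤳ hU.primeIdealOf z := (PrimeSpectrum.le_iff_specializes _ _).mp h
  have h2 := h1.map hU.fromSpec.continuous
  rw [hU.fromSpec_primeIdealOf, hU.fromSpec_primeIdealOf] at h2
  exact h2.mem_closure

/-- A standard smooth algebra is étale over a polynomial ring, whose local rings acquire parameters
one variable at a time. -/
theorem hasLocalRegularParameters_of_isStandardSmooth {B : Type u} [CommRing B] {φ : k →+* B}
    (h : φ.IsStandardSmooth) : HasLocalRegularParameters B := by
  obtain ⟨n, g, -, hg⟩ := h.exists_etale_mvPolynomial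
  let _ := g.toAlgebra
  have : Algebra.Etale (MvPolynomial (Fin n) k) B := hg
  exact (hasLocalRegularParameters_mvPolynomial k n).of_etale

theorem isNoetherianRing_of_isStandardSmooth {B : Type u} [CommRing B] {φ : k →+* B}
    (h : φ.IsStandardSmooth) : IsNoetherianRing B := by
  let _ := φ.toAlgebra
  have : Algebra.IsStandardSmooth k B := h
  exact Algebra.FiniteType.isNoetherianRing k B

/-- A point of a smooth scheme over a field has an affine open neighbourhood on which its closure is
cut out by a regular sequence. -/
theorem exists_isWeaklyRegular_of_smooth [Smooth f] (y : X) :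
    ∃ (U : X.Opens) (_ : IsAffineOpen U) (fs : List Γ(X, U)), y ∈ U ∧
      (constantsOn f U).IsStandardSmooth ∧ IsWeaklyRegular Γ(X, U) fs ∧
      (∀ g ∈ fs, y ∉ X.basicOpen g) ∧
      (∀ z ∈ U, z ∉ closure {y} → ∃ g ∈ fs, z ∈ X.basicOpen g) ∧
      (fs.length : ℕ∞) = Order.coheight y := by
  obtain ⟨U, hU, hy, h⟩ := exists_isStandardSmooth_constantsOn f y
  have := isNoetherianRing_of_isStandardSmooth h
  -- Parameters at the prime of `y` are spread out to `D(g)`, which becomes the required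
  -- neighbourhood.
  obtain ⟨fs, g, hg, hfs, hP, hreg, hlen⟩ := HasRegularParameters.exists_spread
    (hU.primeIdealOf ⟨y, hy⟩).asIdeal (hasLocalRegularParameters_of_isStandardSmooth h _)
  have hloc := hU.isLocalization_basicOpen g
  refine ⟨X.basicOpen g, hU.basicOpen g, fs.map (algebraMap Γ(X, U) Γ(X, X.basicOpen g)),
    (mem_basicOpen_iff_notMem_primeIdealOf hU ⟨y, hy⟩ g).mpr hg, ?_, ?_, ?_, ?_, ?_⟩
  · have h1 := (RingHom.isStandardSmooth_holdsForLocalizationAway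
      Γ(X, X.basicOpen g) g).comp h
    convert h1 using 1
    change _ = (X.presheaf.map (homOfLE (X.basicOpen_le g)).op).hom.comp
      ((X.presheaf.map _).hom.comp _)
    rw [← RingHom.comp_assoc, ← CommRingCat.hom_comp, ← X.presheaf.map_comp]
    rfl
  · exact (isWeaklyRegular_map_algebraMap_iff _ _ _).mpr (hreg _)
  · rintro _ hfa
    obtain ⟨a, ha, rfl⟩ := List.mem_map.mp hfa
    intro hya
    have hya' : y ∈ X.basicOpen a := by
      have := X.basicOpen_res a (homOfLE (X.basicOpen_le g)).op
      exact (this.le hya).2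
    exact (mem_basicOpen_iff_notMem_primeIdealOf hU ⟨y, hy⟩ a).mp hya' (hfs a ha)
  · intro z hz hzy
    by_contra hcon
    have hzU := X.basicOpen_le g hz
    have hgz := (mem_basicOpen_iff_notMem_primeIdealOf hU ⟨z, hzU⟩ g).mp hz
    refine hzy (mem_closure_of_primeIdealOf_le hU ⟨y, hy⟩ ⟨z, hzU⟩ fun b hb => ?_)
    have hle : Ideal.ofList fs ≤ (hU.primeIdealOf ⟨z, hzU⟩).asIdeal := by
      refine Ideal.span_le.mpr fun a ha => ?_
      by_contra haz
      refine hcon ⟨_, List.mem_map.mpr ⟨a, ha, rfl⟩, ?_⟩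
      have := X.basicOpen_res a (homOfLE (X.basicOpen_le g)).op
      exact this.ge ⟨hz, (mem_basicOpen_iff_notMem_primeIdealOf hU ⟨z, hzU⟩ a).mpr haz⟩
    exact ((hU.primeIdealOf ⟨z, hzU⟩).isPrime.mem_or_mem (hle (hP b hb))).resolve_left hgz
  -- The length is the dimension of the local ring at `y`, which equals the coheight of `y`.
  · let _ := TopCat.Presheaf.algebra_section_stalk X.presheaf ⟨y, hy⟩
    have h1 := hU.isLocalization_stalk ⟨y, hy⟩
    have h2 : ringKrullDim (Localization.AtPrime (hU.primeIdealOf ⟨y, hy⟩).asIdeal) =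
        ringKrullDim (X.presheaf.stalk y) :=
      ringKrullDim_eq_of_ringEquiv (IsLocalization.algEquiv
        (hU.primeIdealOf ⟨y, hy⟩).asIdeal.primeCompl _ _).toRingEquiv
    rw [h2, ringKrullDim_stalk_eq_coheight] at hlen
    rw [List.length_map]
    exact_mod_cast hlen

end RegularOpen

/-! ### Forms on the thickening -/

section ThickeningForms

open RingTheory.Sequence

variable {k : Type u} [Field k] {X : Scheme.{u}} (f : X ⟶ Spec (.of k))
  (A : Type u) [CommRing A] [Algebra k A]

instance : IsAffineHom (thickeningProj f A) :=
  MorphismProperty.IsStableUnderBaseChange.of_isPullback (P := @IsAffineHom)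
    (IsPullback.of_hasPullback f (Spec.map (CommRingCat.ofHom (algebraMap k A)))).flip inferInstance

/-- The ring homomorphism from `A` to the functions on an open subset of `X_A`. -/
def thickeningConstants (U : X.Opens) : A →+* Γ(thickening f A, thickeningProj f A ⁻¹ᵁ U) :=
  ((Scheme.ΓSpecIso (.of A)).inv ≫
    (pullback.snd f (Spec.map (CommRingCat.ofHom (algebraMap k A)))).appLE ⊤
      (thickeningProj f A ⁻¹ᵁ U) le_top).hom

/-- On affine opens the fibre product corresponds to the tensor product of rings, so the functions
on `X_A` over `U` are `Γ(X, U) ⊗_k A`. -/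
theorem isPushout_thickening {U : X.Opens} (hU : IsAffineOpen U) :
    IsPushout (CommRingCat.ofHom (constantsOn f U)) (CommRingCat.ofHom (algebraMap k A))
      ((thickeningProj f A).app U) (CommRingCat.ofHom (thickeningConstants f A U)) := by
  have H := IsPullback.of_hasPullback f (Spec.map (CommRingCat.ofHom (algebraMap k A)))
  have h0 := isIso_pushoutSection_of_isAffineOpen H (US := ⊤) (UT := ⊤) (UX := U) le_top le_top
    (inf_top_eq (pullback.fst f (Spec.map (CommRingCat.ofHom (algebraMap k A))) ⁻¹ᵁ U)).symm
    (isAffineOpen_top _) (isAffineOpen_top _) hU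
  have h1 := (isIso_pushoutSection_iff H _ _ _).mp h0
  refine h1.of_iso (Scheme.ΓSpecIso (.of k)) (Iso.refl _) (Scheme.ΓSpecIso (.of A)) (Iso.refl _)
    ?_ ?_ ?_ ?_
  · refine (Category.comp_id _).trans ?_
    exact ((Scheme.ΓSpecIso (.of k)).hom_inv_id_assoc (f.appLE ⊤ U le_top)).symm
  · exact (congrArg (· ≫ (Scheme.ΓSpecIso (.of A)).hom) (Scheme.Hom.appLE_eq_app _)).trans
      (Scheme.ΓSpecIso_naturality _)
  · refine (Category.comp_id _).trans ((Scheme.Hom.appLE_eq_app _).trans ?_)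
    exact (Category.id_comp _).symm
  · refine (Category.comp_id _).trans ?_
    exact ((Scheme.ΓSpecIso (.of A)).hom_inv_id_assoc _).symm

theorem isWeaklyRegular_of_flat {R M : Type u} [CommRing R] [AddCommGroup M] [Module R M]
    [Module.Flat R M] {fs : List R} (h : IsWeaklyRegular R fs) : IsWeaklyRegular M fs :=
  ((TensorProduct.rid R M).isWeaklyRegular_congr fs).mp h.isWeaklyRegular_lTensor

variable [CharZero k]

/-- The functions on `X_A` over `U` are a pushout of `Γ(X, U)` and `A` over `k`, so their absolute
forms are flat over `Γ(X, U)`. Flat modules inherit weakly regular sequences from the ring. -/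
theorem isWeaklyRegular_diffForms_thickening {U : X.Opens} (hU : IsAffineOpen U)
    (h : (constantsOn f U).IsStandardSmooth) {fs : List Γ(X, U)} (hfs : IsWeaklyRegular Γ(X, U) fs)
    (p : ℕ) : letI : Algebra Γ(X, U) ((ratThickening f A).obj (op U)) :=
        ((thickeningProj f A).app U).hom.toAlgebra
      IsWeaklyRegular (DiffForms ℚ ((ratThickening f A).obj (op U)) p) fs := by
  let C := (ratThickening f A).obj (op U)
  let _ : Algebra Γ(X, U) C := ((thickeningProj f A).app U).hom.toAlgebra
  let _ : Algebra k Γ(X, U) := (constantsOn f U).toAlgebra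
  have : Algebra.IsStandardSmooth k Γ(X, U) := h
  let _ : Algebra A C := (thickeningConstants f A U).toAlgebra
  let _ : Algebra k C := ((thickeningConstants f A U).comp (algebraMap k A)).toAlgebra
  have h1 := isPushout_thickening f A hU
  have : IsScalarTower k A C := .of_algebraMap_eq fun _ => rfl
  have : IsScalarTower k Γ(X, U) C := .of_algebraMap_eq' (congrArg CommRingCat.Hom.hom h1.w).symm
  have h2 : Algebra.IsPushout k Γ(X, U) A C := CommRingCat.isPushout_iff_isPushout.mp h1
  have := h2.symm
  let _ : Algebra ℚ A := ((algebraMap k A).comp (algebraMap ℚ k)).toAlgebra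
  have : IsScalarTower ℚ A C := .of_algebraMap_eq' (Subsingleton.elim _ _)
  have := flat_diffForms ℚ k A Γ(X, U) C p
  exact isWeaklyRegular_of_flat hfs

theorem rZero_localize_diffForms [Smooth f] (p : ℕ) (y : X) (i : ℕ)
    (hi : (i : ℕ∞) ≠ Order.coheight y) :
    RZero (germsWithSupportFunctor y) i
      (localize (diffFormsFunctor ℚ p) (ratThickening f A)) := by
  obtain ⟨U, hU, fs, hy, hsm, hfs, hyfs, hsupp, hlen⟩ := exists_isWeaklyRegular_of_smooth f y
  let _ : Algebra Γ(X, U) ((ratThickening f A).obj (op U)) :=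
    ((thickeningProj f A).app U).hom.toAlgebra
  refine (rZero_localize_diffForms_iff (hU := hU) ℚ hy (ratThickening f A)
    (fun V => ⟨inferInstance⟩) ?_ p i).mpr ?_
  · intro g V h hV
    exact (hU.preimage (thickeningProj f A)).isLocalization_of_eq_basicOpen
      ((thickeningProj f A).app U g) (homOfLE ((thickeningProj f A).preimage_mono h))
      (by rw [hV, Scheme.preimage_basicOpen])
  -- The support condition is vacuous here: every point of `U` off the closure of `y` lies in `D(g)`
  -- for some `g` in the sequence.
  · refine rZero_qcSheaf_of_isWeaklyRegular hy fs _
      (isWeaklyRegular_diffForms_thickening f A hU hsm hfs p) hyfs (fun z hz hzy hcon => ?_) i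
      fun h => hi (by rw [h, hlen])
    obtain ⟨g, hg, hzg⟩ := hsupp z hz hzy
    exact absurd hzg (hcon g hg)

end ThickeningForms

/-! ### Splitting of the augmentation and the conclusion -/

section Final

variable {k : Type u} [Field k] [CharZero k] {X : Scheme.{u}} (f : X ⟶ Spec (.of k))
  (A : Type u) [CommRing A] [Algebra k A] (ε : A →ₐ[k] k)

/-- The inclusion `O_X ⟶ O_{X_A}` given by the projection `X_A ⟶ X`. -/
def ratInclude : ratStructure f ⟶ ratThickening f A :=
  algebraPresheafMap _ _ (thickeningProj f A).c (Subsingleton.elim _ _)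

theorem ratInclude_ratRestrict : ratInclude f A ≫ ratRestrict f A ε = 𝟙 (ratStructure f) := by
  ext U : 2
  refine ConcreteCategory.hom_ext _ _ fun a => ?_
  have h : (thickeningProj f A).app U.unop ≫ (thickeningIncl f A ε).appLE
      (thickeningProj f A ⁻¹ᵁ U.unop) U.unop (by
        rw [← Scheme.Hom.comp_preimage, thickeningIncl_proj]
        exact le_rfl) = 𝟙 _ := by
    rw [Scheme.Hom.app_eq_appLE, Scheme.Hom.appLE_comp_appLE]
    simp only [thickeningIncl_proj]
    exact X.presheaf.map_id _
  exact ConcreteCategory.congr_hom h a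

/-- The sheafification of an isomorphism of functors on algebras. -/
def localizeIso {K : Type} [CommRing K] {Y : TopCat.{u}}
    {T T' : CommAlgCat.{u} K ⥤ AddCommGrpCat.{u}} (e : T ≅ T')
    (O : (Opens Y)ᵒᵖ ⥤ CommAlgCat.{u} K) : localize T O ≅ localize T' O :=
  (presheafToSheaf (Opens.grothendieckTopology Y) AddCommGrpCat.{u}).mapIso
    (Functor.isoWhiskerLeft O e)

theorem localizeIso_naturality {K : Type} [CommRing K] {Y : TopCat.{u}}
    {T T' : CommAlgCat.{u} K ⥤ AddCommGrpCat.{u}} (e : T ≅ T')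
    {O O' : (Opens Y)ᵒᵖ ⥤ CommAlgCat.{u} K} (α : O ⟶ O') :
    (localizeIso e O).hom ≫ localizeMap T' α = localizeMap T α ≫ (localizeIso e O').hom := by
  have h : (Functor.isoWhiskerLeft O e).hom ≫ Functor.whiskerRight α T' =
      Functor.whiskerRight α T ≫ (Functor.isoWhiskerLeft O' e).hom := by
    ext U : 2
    exact (e.hom.naturality (α.app U)).symm
  exact (Functor.map_comp _ _ _).symm.trans ((congrArg (presheafToSheaf _ _).map h).trans
    (Functor.map_comp _ _ _))

theorem localizeMap_ratInclude_augMap (T : CommAlgCat.{u} ℚ ⥤ AddCommGrpCat.{u}) :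
    localizeMap T (ratInclude f A) ≫ augMap f A ε T = 𝟙 _ := by
  have h : Functor.whiskerRight (ratInclude f A) T ≫ Functor.whiskerRight (ratRestrict f A ε) T =
      𝟙 (ratStructure f ⋙ T) := by
    rw [← Functor.whiskerRight_comp, ratInclude_ratRestrict]
    exact Functor.whiskerRight_id' _
  exact (Functor.map_comp _ _ _).symm.trans ((congrArg (presheafToSheaf _ _).map h).trans
    (CategoryTheory.Functor.map_id _ _))

/-- The projection of `T(O_{X_A})` to its direct summand, the relative sheaf. -/
def relSheafProj (T : CommAlgCat.{u} ℚ ⥤ AddCommGrpCat.{u}) :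
    localize T (ratThickening f A) ⟶ relSheaf f A ε T :=
  kernel.lift _ (𝟙 _ - augMap f A ε T ≫ localizeMap T (ratInclude f A)) (by
    rw [Preadditive.sub_comp, Category.id_comp, Category.assoc, localizeMap_ratInclude_augMap,
      Category.comp_id, sub_self])

theorem relSheafIncl_relSheafProj (T : CommAlgCat.{u} ℚ ⥤ AddCommGrpCat.{u}) :
    relSheafIncl f A ε T ≫ relSheafProj f A ε T = 𝟙 _ := by
  refine (cancel_mono (kernel.ι (augMap f A ε T))).mp ?_
  have h : kernel.ι (augMap f A ε T) ≫
      (𝟙 _ - augMap f A ε T ≫ localizeMap T (ratInclude f A)) = kernel.ι (augMap f A ε T) := by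
    rw [Preadditive.comp_sub, Category.comp_id, kernel.condition_assoc, zero_comp, sub_zero]
  exact (Category.assoc _ _ _).trans ((congrArg (kernel.ι (augMap f A ε T) ≫ ·)
    (kernel.lift_ι _ _ _)).trans (h.trans (Category.id_comp _).symm))

/-- The relative sheaf is a retract of `HH_p^{(p)}(O_{X_A})`, which is isomorphic to the sheaf of
absolute forms on `X_A`. Vanishing of a derived functor passes to retracts. -/
theorem isCohenMacaulay_relSheaf [Smooth f] (p : ℕ) :
    IsCohenMacaulay (relSheaf f A ε (hodgeHHFunctor ℚ p p)) := fun y i hi =>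
  RZero.of_retract _ (relSheafIncl f A ε _) (relSheafProj f A ε _)
    (relSheafIncl_relSheafProj f A ε _)
    ((rZero_localize_diffForms f A p y i hi).of_iso _ (localizeIso (hodgeHHIso ℚ p) _).symm)

theorem exists_relSheaf_isos (p : ℕ) :
    ∃ (eA : localize (hodgeHHFunctor ℚ p p) (ratThickening f A) ≅
          localize (diffFormsFunctor ℚ p) (ratThickening f A))
      (e : localize (hodgeHHFunctor ℚ p p) (ratStructure f) ≅
          localize (diffFormsFunctor ℚ p) (ratStructure f))
      (r : relSheaf f A ε (hodgeHHFunctor ℚ p p) ≅ relSheaf f A ε (diffFormsFunctor ℚ p)),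
      eA.hom ≫ augMap f A ε (diffFormsFunctor ℚ p) =
          augMap f A ε (hodgeHHFunctor ℚ p p) ≫ e.hom ∧
        r.hom ≫ relSheafIncl f A ε (diffFormsFunctor ℚ p) =
          relSheafIncl f A ε (hodgeHHFunctor ℚ p p) ≫ eA.hom := by
  have h := localizeIso_naturality (hodgeHHIso ℚ p) (ratRestrict f A ε)
  exact ⟨localizeIso (hodgeHHIso ℚ p) _, localizeIso (hodgeHHIso ℚ p) _,
    kernel.mapIso _ _ (localizeIso (hodgeHHIso ℚ p) _) (localizeIso (hodgeHHIso ℚ p) _) h.symm,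
    h, kernel.lift_ι _ _ _⟩

end Final

end HochschildCM

end

theorem mainTheorem7 {k : Type u} [Field k] [CharZero k] {X : Scheme.{u}}
    (f : X ⟶ Spec (.of k)) [IsIntegral X] [Smooth f] (hf : IsProjectiveOver f)
    (A : Type u) [CommRing A] [Algebra k A] [IsLocalRing A] [IsArtinianRing A]
    (hA : Function.Bijective (algebraMap k (IsLocalRing.ResidueField A))) (p : ℕ) :
    -- the relative Hochschild sheaf is Cohen–Macaulay
    IsCohenMacaulay (relSheaf f A (augmentation A hA) (hodgeHHFunctor ℚ p p)) ∧
      -- and it is identified with the kernel of `Ω^p_{X_A/ℚ} ⟶ Ω^p_{X/ℚ}`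
      ∃ (eA : localize (hodgeHHFunctor ℚ p p) (ratThickening f A) ≅
            localize (diffFormsFunctor ℚ p) (ratThickening f A))
        (e : localize (hodgeHHFunctor ℚ p p) (ratStructure f) ≅
            localize (diffFormsFunctor ℚ p) (ratStructure f))
        (r : relSheaf f A (augmentation A hA) (hodgeHHFunctor ℚ p p) ≅
            relSheaf f A (augmentation A hA) (diffFormsFunctor ℚ p)),
        eA.hom ≫ augMap f A (augmentation A hA) (diffFormsFunctor ℚ p) =
            augMap f A (augmentation A hA) (hodgeHHFunctor ℚ p p) ≫ e.hom ∧
          r.hom ≫ relSheafIncl f A (augmentation A hA) (diffFormsFunctor ℚ p) =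
            relSheafIncl f A (augmentation A hA) (hodgeHHFunctor ℚ p p) ≫ eA.hom := by
  exact ⟨isCohenMacaulay_relSheaf f A (augmentation A hA) p,
    exists_relSheaf_isos f A (augmentation A hA) p⟩
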